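/- Conventions. All spaces are real. Let $X$ be a Banach space. A normalized weakly null basic sequence $(x_i)_{i\ge1}$ in $X$ generates the spreading model $(\tilde x_i)$ if for some $\varepsilon_n\downarrow0$ $$(1+\varepsilon_n)^{-1}\Big\|\sum_{i=1}^n a_i\tilde x_i\Big\|\le\Big\|\sum_{i=1}^n a_i x_{k_i}\Big\|\le(1+\varepsilon_n)\Big\|\sum_{i=1}^n a_i\tilde x_i\Big\|$$ for all $n\in\mathbb N$, all $a_1,\dots,a_n\in[-1,1]$ and all $n\le k_1<\dots<k_n$. Write $(\tilde x_i)\le(\tilde y_i)$ if there is $C<\infty$ with $\|\sum a_i\tilde x_i\|\le C\|\sum a_i\tilde y_i\|$ for all finitely supported $(a_i)$. $SP_w(X)$ is the set of all spreading models of $X$ generated by normalized weakly null basic sequences, modulo the equivalence relation "$\le$ and $\ge$", partially ordered by $\le$. An Orlicz function is a continuous, non-decreasing, convex $M:[0,1]\to\mathbb R$ with $M(0)=0$, $M(1)=1$; it satisfies the $\Delta_2$-condition at zero if there is $C>0$ with $M(2t)\le CM(t)$ for $0\le t\le\frac12$. $\ell_M$ is the space of real sequences $a=(a_n)$ with $\sum_n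 M(|a_n|/\lambda)<\infty$ for some $\lambda>0$, with norm $\|a\|=\inf\{\lambda>0:\sum_n M(|a_n|/\lambda)\le1\}$ (in both cases it is required that $|a_n|\le\lambda$ for all $n$). For $0<\tau<1<r<p<\infty$ and a sequence $\eta=(\eta(n))_{n\ge1}$ of zeros and ones, $M_\eta$ is the piecewise linear function on $[0,1]$ with nodes at the points $\tau^k$ such that $M_\eta(0)=0$, $M_\eta(1)=1$ and $M_\eta(\tau^k)=\tau^{rk+(p-r)\sum_{n=1}^k\eta(n)}$ for $k\ge1$. Call $(\tau,r,p)$ admissible if $0<\tau<1<r<p<\infty$ and, for every $\eta$, $M_\eta$ is an Orlicz function satisfying the $\Delta_2$-condition at zero. Theorem. Let $L$ be a countable (finite or countably infinite) lattice with a minimum element and with no infinite strictly increasing sequence. Let $0<\tau<1<p<\infty$. Then $(\tau,r,p)$ is admissible for all $r<p$ sufficiently close to $p$. Moreover, for every $r$ such that $(\tau,r,p)$ is admissible there is a family $(\rho_e)_{e\in L}$ of sequences of zeros and ones such that the space $$X_L=\Big(\sum_{e\in L}\oplus\,\ell_{M_{\rho_e}}\Big)_p$$ is reflexive and $(SP_w(X_L),\le)$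 is order-isomorphic to $L$. -/

import Mathlib

open Filter Topology Set
open scoped ENNReal

noncomputable section

/-! ### Reflexivity, basic sequences, spreading models -/

/-- A real normed space is reflexive if its canonical embedding into its bidual is onto. -/
def IsReflexiveSpace (X : Type*) [NormedAddCommGroup X] [NormedSpace ℝ X] : Prop :=
  Function.Surjective (NormedSpace.inclusionInDoubleDual ℝ X)

section SpreadingModels

variable {X : Type*} [NormedAddCommGroup X] [NormedSpace ℝ X]

/-- A basic sequence: a Schauder basis of its closed linear span. -/
def IsBasicSequence (x : ℕ → X) : Prop :=
  ∃ b : SchauderBasis ℝ (Submodule.span ℝ (Set.range x)).topologicalClosure,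
    ∀ i, ((b.basis i : (Submodule.span ℝ (Set.range x)).topologicalClosure) : X) = x i

/-- The sequence converges weakly to zero. -/
def IsWeaklyNull (x : ℕ → X) : Prop :=
  ∀ f : StrongDual ℝ X, Tendsto (fun i => f (x i)) atTop (𝓝 0)

/-- `(x i)` generates the spreading model whose norm on `c₀₀` (the finitely supported real
sequences; the `i`-th vector of the spreading model is the `i`-th unit vector of `c₀₀`) is `N`.
Sequences are indexed from `0`, so `x 0` is the first term of the sequence, and "all indices are
at least `n`" reads `n ≤ k i + 1`. -/
def GeneratesSpreadingModel (x : ℕ → X) (N : Seminorm ℝ (ℕ →₀ ℝ)) : Prop :=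
  ∃ ε : ℕ → ℝ, Antitone ε ∧ Tendsto ε atTop (𝓝 0) ∧
    ∀ (n : ℕ) (a : Fin n → ℝ), (∀ i, a i ∈ Set.Icc (-1 : ℝ) 1) →
      ∀ k : Fin n → ℕ, StrictMono k → (∀ i, n ≤ k i + 1) →
        (1 + ε n)⁻¹ * N (∑ i : Fin n, Finsupp.single (i : ℕ) (a i)) ≤ ‖∑ i : Fin n, a i • x (k i)‖ ∧
        ‖∑ i : Fin n, a i • x (k i)‖ ≤ (1 + ε n) * N (∑ i : Fin n, Finsupp.single (i : ℕ) (a i))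

end SpreadingModels

/-- The spreading models of `X` generated by normalized weakly null basic sequences of `X`, each
represented by its norm on `c₀₀` (this norm determines it up to isometric equivalence). -/
structure WeaklyNullSpreadingModel (X : Type*) [NormedAddCommGroup X] [NormedSpace ℝ X] where
  /-- The norm on `c₀₀`. -/
  toSeminorm : Seminorm ℝ (ℕ →₀ ℝ)
  generated : ∃ x : ℕ → X, (∀ i, ‖x i‖ = 1) ∧ IsBasicSequence x ∧ IsWeaklyNull x ∧
    GeneratesSpreadingModel x toSeminorm

/-- `S ≤ T` iff `T` `C`-dominates `S` for some finite `C`. -/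
instance WeaklyNullSpreadingModel.instPreorder (X : Type*) [NormedAddCommGroup X]
    [NormedSpace ℝ X] : Preorder (WeaklyNullSpreadingModel X) where
  le S T := ∃ C : ℝ, ∀ a : ℕ →₀ ℝ, S.toSeminorm a ≤ C * T.toSeminorm a
  le_refl S := ⟨1, fun a => by simp⟩
  le_trans S T U := by
    rintro ⟨C, hC⟩ ⟨D, hD⟩
    refine ⟨|C| * D, fun a => ?_⟩
    calc S.toSeminorm a ≤ C * T.toSeminorm a := hC a
      _ ≤ |C| * T.toSeminorm a :=
          mul_le_mul_of_nonneg_right (le_abs_self C) (apply_nonneg T.toSeminorm a)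
      _ ≤ |C| * (D * U.toSeminorm a) := mul_le_mul_of_nonneg_left (hD a) (abs_nonneg C)
      _ = |C| * D * U.toSeminorm a := by ring

/-- `SP_w(X)`: equivalence classes (mutual domination) of spreading models generated by normalized
weakly null sequences; it carries the partial order induced by domination. -/
abbrev SPw (X : Type*) [NormedAddCommGroup X] [NormedSpace ℝ X] : Type :=
  Antisymmetrization (WeaklyNullSpreadingModel X) (· ≤ ·)

/-! ### Orlicz sequence spaces -/

/-- Orlicz functions on `[0,1]`; values outside `[0,1]` play no role. -/
structure IsOrliczFunction (M : ℝ → ℝ) : Prop where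
  continuousOn : ContinuousOn M (Set.Icc 0 1)
  monotoneOn : MonotoneOn M (Set.Icc 0 1)
  convexOn : ConvexOn ℝ (Set.Icc 0 1) M
  map_zero : M 0 = 0
  map_one : M 1 = 1

/-- The `Δ₂`-condition at zero. -/
def DeltaTwoAtZero (M : ℝ → ℝ) : Prop :=
  ∃ C : ℝ, 0 < C ∧ ∀ t : ℝ, 0 ≤ t → t ≤ 1 / 2 → M (2 * t) ≤ C * M t

/-- `∑ M(|a n| / ρ) < ∞`, where every `|a n| / ρ` is in the domain `[0,1]` of `M`. -/
def OrliczFinite (M : ℝ → ℝ) (a : ℕ → ℝ) (ρ : ℝ) : Prop :=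
  0 < ρ ∧ (∀ n, |a n| ≤ ρ) ∧ Summable (fun n => M (|a n| / ρ))

/-- `∑ M(|a n| / ρ) ≤ 1`, where every `|a n| / ρ` is in the domain `[0,1]` of `M`. -/
def OrliczLeOne (M : ℝ → ℝ) (a : ℕ → ℝ) (ρ : ℝ) : Prop :=
  OrliczFinite M a ρ ∧ ∑' n, M (|a n| / ρ) ≤ 1

namespace IsOrliczFunction

variable {M : ℝ → ℝ}

theorem nonneg (hM : IsOrliczFunction M) {t : ℝ} (h0 : 0 ≤ t) (h1 : t ≤ 1) : 0 ≤ M t := by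
  rw [← hM.map_zero]
  exact hM.monotoneOn ⟨le_refl _, zero_le_one⟩ ⟨h0, h1⟩ h0

theorem map_smul_le (hM : IsOrliczFunction M) {t c : ℝ} (h0 : 0 ≤ t) (h1 : t ≤ 1)
    (hc0 : 0 ≤ c) (hc1 : c ≤ 1) : M (c * t) ≤ c * M t := by
  have h := hM.convexOn.2 (show t ∈ Set.Icc (0 : ℝ) 1 from ⟨h0, h1⟩)
    (show (0 : ℝ) ∈ Set.Icc (0 : ℝ) 1 from ⟨le_refl _, zero_le_one⟩) hc0 (sub_nonneg.2 hc1)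
    (by ring)
  simpa [hM.map_zero] using h

theorem div_mem {a : ℕ → ℝ} {ρ : ℝ} (h : OrliczFinite M a ρ) (n : ℕ) :
    |a n| / ρ ∈ Set.Icc (0 : ℝ) 1 :=
  ⟨div_nonneg (abs_nonneg _) h.1.le, (div_le_one h.1).2 (h.2.1 n)⟩

theorem exists_leOne (hM : IsOrliczFunction M) {a : ℕ → ℝ} {ρ : ℝ} (h : OrliczFinite M a ρ) :
    ∃ σ, OrliczLeOne M a σ := by
  set S := ∑' n, M (|a n| / ρ) with hS
  set c := max 1 S with hc
  have hc1 : 1 ≤ c := le_max_left _ _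
  have hc0 : 0 < c := lt_of_lt_of_le one_pos hc1
  have hinv : c⁻¹ ≤ 1 := inv_le_one_of_one_le₀ hc1
  have key : ∀ n, M (|a n| / (c * ρ)) ≤ c⁻¹ * M (|a n| / ρ) := fun n => by
    have := hM.map_smul_le (div_mem h n).1 (div_mem h n).2 (inv_nonneg.2 hc0.le) hinv
    rwa [show c⁻¹ * (|a n| / ρ) = |a n| / (c * ρ) by
      rw [div_eq_mul_inv, div_eq_mul_inv, mul_inv]; ring] at this
  have hle : ∀ n, |a n| ≤ c * ρ := fun n => (h.2.1 n).trans (by nlinarith [h.1])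
  have hpos : 0 < c * ρ := mul_pos hc0 h.1
  have hnn : ∀ n, 0 ≤ M (|a n| / (c * ρ)) := fun n =>
    hM.nonneg (div_nonneg (abs_nonneg _) hpos.le) ((div_le_one hpos).2 (hle n))
  have hsum : Summable (fun n => M (|a n| / (c * ρ))) :=
    Summable.of_nonneg_of_le hnn key (h.2.2.mul_left _)
  refine ⟨c * ρ, ⟨hpos, hle, hsum⟩, ?_⟩
  calc ∑' n, M (|a n| / (c * ρ)) ≤ ∑' n, c⁻¹ * M (|a n| / ρ) :=
        hsum.tsum_le_tsum key (h.2.2.mul_left _)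
    _ = c⁻¹ * S := by rw [tsum_mul_left]
    _ ≤ 1 := by
        rw [inv_mul_le_iff₀ hc0, mul_one]
        exact le_max_right _ _

theorem leOne_zero (hM : IsOrliczFunction M) {ρ : ℝ} (hρ : 0 < ρ) : OrliczLeOne M 0 ρ := by
  refine ⟨⟨hρ, fun n => by simp [hρ.le], ?_⟩, ?_⟩ <;> simp [hM.map_zero, summable_zero]

theorem leOne_add (hM : IsOrliczFunction M) {a b : ℕ → ℝ} {ρ σ : ℝ} (ha : OrliczLeOne M a ρ)
    (hb : OrliczLeOne M b σ) : OrliczLeOne M (a + b) (ρ + σ) := by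
  have hρ := ha.1.1
  have hσ := hb.1.1
  have hpos : 0 < ρ + σ := add_pos hρ hσ
  have hle : ∀ n, |(a + b) n| ≤ ρ + σ := fun n =>
    (abs_add_le (a n) (b n)).trans (add_le_add (ha.1.2.1 n) (hb.1.2.1 n))
  have hw : ρ / (ρ + σ) + σ / (ρ + σ) = 1 := by field_simp
  have key : ∀ n, M (|(a + b) n| / (ρ + σ)) ≤
      ρ / (ρ + σ) * M (|a n| / ρ) + σ / (ρ + σ) * M (|b n| / σ) := fun n => by
    have hA := div_mem ha.1 n
    have hB := div_mem hb.1 n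
    have hconv := hM.convexOn.2 hA hB (div_nonneg hρ.le hpos.le) (div_nonneg hσ.le hpos.le) hw
    have hmem := hM.convexOn.1 hA hB (div_nonneg hρ.le hpos.le) (div_nonneg hσ.le hpos.le) hw
    have heq : (ρ / (ρ + σ)) • (|a n| / ρ) + (σ / (ρ + σ)) • (|b n| / σ)
        = (|a n| + |b n|) / (ρ + σ) := by
      simp only [smul_eq_mul]
      field_simp
    rw [heq] at hconv hmem
    simp only [smul_eq_mul] at hconv
    refine le_trans (hM.monotoneOn ⟨div_nonneg (abs_nonneg _) hpos.le,
      (div_le_one hpos).2 (hle n)⟩ hmem ?_) hconv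
    exact div_le_div_of_nonneg_right (abs_add_le (a n) (b n)) hpos.le
  have hsA := ha.1.2.2.mul_left (ρ / (ρ + σ))
  have hsB := hb.1.2.2.mul_left (σ / (ρ + σ))
  have hsum : Summable (fun n => M (|(a + b) n| / (ρ + σ))) :=
    Summable.of_nonneg_of_le (fun n => hM.nonneg (div_nonneg (abs_nonneg _) hpos.le)
      ((div_le_one hpos).2 (hle n))) key (hsA.add hsB)
  refine ⟨⟨hpos, hle, hsum⟩, ?_⟩
  calc ∑' n, M (|(a + b) n| / (ρ + σ))
      ≤ ∑' n, (ρ / (ρ + σ) * M (|a n| / ρ) + σ / (ρ + σ) * M (|b n| / σ)) :=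
        hsum.tsum_le_tsum key (hsA.add hsB)
    _ = ρ / (ρ + σ) * ∑' n, M (|a n| / ρ) + σ / (ρ + σ) * ∑' n, M (|b n| / σ) := by
        rw [hsA.tsum_add hsB, tsum_mul_left, tsum_mul_left]
    _ ≤ ρ / (ρ + σ) * 1 + σ / (ρ + σ) * 1 :=
        add_le_add (mul_le_mul_of_nonneg_left ha.2 (div_nonneg hρ.le hpos.le))
          (mul_le_mul_of_nonneg_left hb.2 (div_nonneg hσ.le hpos.le))
    _ = 1 := by rw [mul_one, mul_one, hw]

theorem leOne_smul {a : ℕ → ℝ} {ρ c : ℝ} (hc : c ≠ 0) (ha : OrliczLeOne M a ρ) :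
    OrliczLeOne M (c • a) (|c| * ρ) := by
  have hc' : 0 < |c| := abs_pos.2 hc
  have heq : ∀ n, |(c • a) n| / (|c| * ρ) = |a n| / ρ := fun n => by
    rw [Pi.smul_apply, smul_eq_mul, abs_mul, mul_div_mul_left _ _ hc'.ne']
  refine ⟨⟨mul_pos hc' ha.1.1, fun n => ?_, ?_⟩, ?_⟩
  · rw [Pi.smul_apply, smul_eq_mul, abs_mul]
    exact mul_le_mul_of_nonneg_left (ha.1.2.1 n) hc'.le
  · simpa only [heq] using ha.1.2.2
  · simpa only [heq] using ha.2

end IsOrliczFunction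

/-- The vector space of all real sequences `a` with `∑ M(|a n| / ρ) < ∞` for some `ρ > 0`. -/
def orliczSubmodule {M : ℝ → ℝ} (hM : IsOrliczFunction M) : Submodule ℝ (ℕ → ℝ) where
  carrier := {a | ∃ ρ, OrliczFinite M a ρ}
  zero_mem' := ⟨1, (hM.leOne_zero one_pos).1⟩
  add_mem' := by
    rintro a b ⟨ρ, ha⟩ ⟨σ, hb⟩
    obtain ⟨ρ', ha'⟩ := hM.exists_leOne ha
    obtain ⟨σ', hb'⟩ := hM.exists_leOne hb
    exact ⟨_, (hM.leOne_add ha' hb').1⟩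
  smul_mem' := by
    rintro c a ⟨ρ, ha⟩
    obtain ⟨ρ', ha'⟩ := hM.exists_leOne ha
    rcases eq_or_ne c 0 with rfl | hc
    · rw [zero_smul]
      exact ⟨1, (hM.leOne_zero one_pos).1⟩
    · exact ⟨_, (IsOrliczFunction.leOne_smul hc ha').1⟩

/-- The Orlicz sequence space `ℓ_M`. -/
def OrliczSpace {M : ℝ → ℝ} (hM : IsOrliczFunction M) : Type := orliczSubmodule hM

namespace OrliczSpace

variable {M : ℝ → ℝ} {hM : IsOrliczFunction M}

instance : AddCommGroup (OrliczSpace hM) := inferInstanceAs (AddCommGroup (orliczSubmodule hM))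

instance : Module ℝ (OrliczSpace hM) := inferInstanceAs (Module ℝ (orliczSubmodule hM))

/-- The underlying sequence. -/
def seq (a : OrliczSpace hM) : ℕ → ℝ := Subtype.val a

/-- The norm `‖a‖ = inf {ρ > 0 : ∑ M(|a n| / ρ) ≤ 1}`. -/
instance : Norm (OrliczSpace hM) := ⟨fun a => sInf {ρ : ℝ | OrliczLeOne M a.seq ρ}⟩

theorem norm_def (a : OrliczSpace hM) : ‖a‖ = sInf {ρ : ℝ | OrliczLeOne M a.seq ρ} := rfl

theorem nonempty_set (a : OrliczSpace hM) : {ρ : ℝ | OrliczLeOne M a.seq ρ}.Nonempty := by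
  obtain ⟨ρ, h⟩ := a.2
  exact hM.exists_leOne h

theorem bddBelow_set (a : ℕ → ℝ) : BddBelow {ρ : ℝ | OrliczLeOne M a ρ} :=
  ⟨0, fun _ h => h.1.1.le⟩

theorem norm_le {a : OrliczSpace hM} {ρ : ℝ} (h : OrliczLeOne M a.seq ρ) : ‖a‖ ≤ ρ :=
  csInf_le (bddBelow_set _) h

theorem abs_le_norm (a : OrliczSpace hM) (n : ℕ) : |a.seq n| ≤ ‖a‖ :=
  le_csInf a.nonempty_set fun _ h => h.1.2.1 n

theorem norm_zero' : ‖(0 : OrliczSpace hM)‖ = 0 := by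
  refine le_antisymm (le_of_forall_pos_le_add fun ε hε => ?_)
    ((abs_nonneg _).trans (abs_le_norm _ 0))
  rw [zero_add]
  exact norm_le (hM.leOne_zero hε)

theorem norm_smul_le' (c : ℝ) (a : OrliczSpace hM) : ‖c • a‖ ≤ |c| * ‖a‖ := by
  rcases eq_or_ne c 0 with rfl | hc
  · rw [zero_smul, norm_zero', abs_zero, zero_mul]
  · have hc' : 0 < |c| := abs_pos.2 hc
    rw [mul_comm, ← div_le_iff₀ hc']
    refine le_csInf a.nonempty_set fun ρ h => ?_
    rw [div_le_iff₀ hc', mul_comm]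
    exact norm_le (a := c • a) (IsOrliczFunction.leOne_smul hc h)

theorem core : NormedSpace.Core ℝ (OrliczSpace hM) where
  norm_nonneg a := (abs_nonneg _).trans (abs_le_norm a 0)
  norm_smul c a := by
    rw [Real.norm_eq_abs]
    refine le_antisymm (norm_smul_le' c a) ?_
    rcases eq_or_ne c 0 with rfl | hc
    · rw [zero_smul, norm_zero', abs_zero, zero_mul]
    · have h := norm_smul_le' c⁻¹ (c • a)
      rw [smul_smul, inv_mul_cancel₀ hc, one_smul, abs_inv] at h
      rwa [le_inv_mul_iff₀ (abs_pos.2 hc)] at h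
  norm_triangle a b := by
    refine le_of_forall_pos_lt_add fun ε hε => ?_
    obtain ⟨ρ, hρ, hρ'⟩ := exists_lt_of_csInf_lt a.nonempty_set
      (show sInf {ρ : ℝ | OrliczLeOne M a.seq ρ} < ‖a‖ + ε / 2 by rw [← norm_def]; linarith)
    obtain ⟨σ, hσ, hσ'⟩ := exists_lt_of_csInf_lt b.nonempty_set
      (show sInf {ρ : ℝ | OrliczLeOne M b.seq ρ} < ‖b‖ + ε / 2 by rw [← norm_def]; linarith)
    have h := norm_le (a := a + b) (hM.leOne_add hρ hσ)
    linarith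
  norm_eq_zero_iff a := by
    refine ⟨fun h => ?_, fun h => by rw [h, norm_zero']⟩
    refine Subtype.ext (funext fun n => ?_)
    have := abs_le_norm a n
    rw [h] at this
    exact abs_nonpos_iff.1 this

instance : NormedAddCommGroup (OrliczSpace hM) := NormedAddCommGroup.ofCore core

instance : NormedSpace ℝ (OrliczSpace hM) := NormedSpace.ofCore core

end OrliczSpace

/-! ### Orlicz functions given by sequences of zeros and ones -/

/-- The value `τ ^ (r k + (p - r) ∑_{n = 1}^k η(n))` at `τ ^ k`; the `n`-th term of the 0–1
sequence is `η (n - 1)`. -/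
def patternValue (τ r p : ℝ) (η : ℕ → Fin 2) (k : ℕ) : ℝ :=
  τ ^ (r * k + (p - r) * ∑ n ∈ Finset.range k, ((η n : ℕ) : ℝ))

/-- The piecewise linear function `M_η` on `[0,1]` with `M_η 0 = 0`, `M_η 1 = 1`,
`M_η (τ ^ k) = patternValue τ r p η k` and nodes at the points `τ ^ k`. For `0 < t ≤ 1` the number
`k = ⌊log_τ t⌋` is the one with `τ ^ (k + 1) < t ≤ τ ^ k`. -/
def patternFun (τ r p : ℝ) (η : ℕ → Fin 2) (t : ℝ) : ℝ :=
  if t ≤ 0 then 0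
  else
    let k := ⌊Real.logb τ t⌋₊
    patternValue τ r p η (k + 1) +
      (patternValue τ r p η k - patternValue τ r p η (k + 1)) * (t - τ ^ (k + 1)) /
        (τ ^ k - τ ^ (k + 1))

/-- Parameters `0 < τ < 1 < r < p < ∞` for which every `M_η` is an Orlicz function satisfying the
`Δ₂`-condition at zero. -/
structure AdmissibleParams (τ r p : ℝ) : Prop where
  tau_pos : 0 < τ
  tau_lt_one : τ < 1
  one_lt_r : 1 < r
  r_lt_p : r < p
  orlicz : ∀ η : ℕ → Fin 2, IsOrliczFunction (patternFun τ r p η)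
  deltaTwo : ∀ η : ℕ → Fin 2, DeltaTwoAtZero (patternFun τ r p η)

/-! ### The `ℓ_p`-sum -/

/-- The `ℓ_p`-sum of the Orlicz sequence spaces `ℓ_{M_{ρ j}}`, `j ∈ J`. -/
def PatternOrliczSum {J : Type*} {τ r p : ℝ} (h : AdmissibleParams τ r p)
    (ρ : J → ℕ → Fin 2) : Type _ :=
  lp (fun j : J => OrliczSpace (h.orlicz (ρ j))) (ENNReal.ofReal p)

namespace PatternOrliczSum

variable {J : Type*} {τ r p : ℝ} {h : AdmissibleParams τ r p} {ρ : J → ℕ → Fin 2}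

theorem fact_one_le (h : AdmissibleParams τ r p) : Fact ((1 : ℝ≥0∞) ≤ ENNReal.ofReal p) :=
  ⟨ENNReal.one_le_ofReal.2 (h.one_lt_r.trans h.r_lt_p).le⟩

instance : NormedAddCommGroup (PatternOrliczSum h ρ) :=
  @lp.normedAddCommGroup J (fun j => OrliczSpace (h.orlicz (ρ j))) (ENNReal.ofReal p) _
    (fact_one_le h)

instance : NormedSpace ℝ (PatternOrliczSum h ρ) :=
  @lp.instNormedSpace ℝ J (fun j => OrliczSpace (h.orlicz (ρ j))) (ENNReal.ofReal p) _ _ _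
    (fact_one_le h)

end PatternOrliczSum

end

/-! At the node `t = τ ^ k` the function `M_η` equals `t ^ p` times the `Z`-th power of `τ ^ (-(p -
r)) > 1`, where `Z` is the number of zeros among the first `k` terms of `η`. The all-ones pattern
therefore gives `ℓ_p`, more zeros give a larger norm, and an unbounded excess of zeros prevents
domination (`not_exists_patternNorm_le`). The zeros are kept so sparse that a window starting at `k`
of length at most `k` contains at most one. Then `M (s t) ≤ C s ^ p M t` whenever `t ≤ s ≤ 1`, and
since `s ^ p ≤ C M s`, each `M` is submultiplicative up to a constant.

Let a normalized weakly null sequence generate the spreading model `S`. Small perturbations make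
finitely many of its terms disjointly supported. The lower `p`-estimate shows that `S` dominates
`ℓ_p` (`exists_patternNorm_one_le`), and `S` dominates the norm of every component `f` in which the
coordinates do not tend to zero uniformly (`exists_patternNorm_le`). Let `F` be the set of these
`f`. On a component outside `F` all vectors but one can be made flat: their entries are so small
compared with the coefficients that the sparse estimate makes them behave as in `ℓ_p`. On the
components in `F` submultiplicativity applies. Hence `S` is dominated by `ℓ_{M_η}` as soon as `η`
lies above all `ρ f`, `f ∈ F` (`exists_le_patternNorm`).

The elements `e` of the lattice whose norm `S` dominates include `⊥` and are closed under joins. As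
there is no infinite strictly increasing sequence, they have a greatest element, which bounds `F`;
the two estimates then meet, so `S` is equivalent to the norm of that component
(`exists_equivalent_unitVectorModel`). The unit vectors of each component generate its own norm, so
the classes of spreading models correspond to the elements of `L`.

It remains to encode the order. On a logarithmic scale, block `i` tests whether `e ≤ g i`, where `g`
takes every value infinitely often: the zeros come late if so and early otherwise. Joins become
maxima of counts, and if `e ≰ f` the blocks with `g i = f` separate `e` from `f` by arbitrarily many
zeros.

For reflexivity, an upper `r`-estimate with `r > 1` makes the unit vector basis shrinking, the form
of the norm makes it boundedly complete, and James' argument concludes. -/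

noncomputable section

/-! ### Growth of the pattern functions -/

section PatternGrowth

variable {τ r p : ℝ} {η : ℕ → Fin 2}

theorem patternValue_pos (hτ0 : 0 < τ) (k : ℕ) : 0 < patternValue τ r p η k :=
  Real.rpow_pos_of_pos hτ0 _

theorem patternValue_zero : patternValue τ r p η 0 = 1 := by
  simp [patternValue]

theorem patternValue_succ (hτ0 : 0 < τ) (k : ℕ) :
    patternValue τ r p η (k + 1) = patternValue τ r p η k * τ ^ (r + (p - r) * ((η k : ℕ) : ℝ)) := by
  rw [patternValue, patternValue, ← Real.rpow_add hτ0, Finset.sum_range_succ]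
  congr 1
  push_cast
  ring

theorem fin_two_cast_mem (x : Fin 2) : (0 : ℝ) ≤ ((x : ℕ) : ℝ) ∧ ((x : ℕ) : ℝ) ≤ 1 :=
  ⟨Nat.cast_nonneg _, by exact_mod_cast Nat.lt_succ_iff.1 x.2⟩

/-- Each step multiplies the value by `τ ^ r` or `τ ^ p`. The two extremes give this bound and the
next: the decay always lies between the powers `r` and `p`. -/
theorem patternValue_add_ge (hτ0 : 0 < τ) (hτ1 : τ < 1) (hrp : r ≤ p) (k j : ℕ) :
    (τ ^ j) ^ p * patternValue τ r p η k ≤ patternValue τ r p η (k + j) := by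
  induction j with
  | zero => simp
  | succ j ih =>
    have h1 := fin_two_cast_mem (η (k + j))
    have h2 : τ ^ p ≤ τ ^ (r + (p - r) * ((η (k + j) : ℕ) : ℝ)) :=
      Real.rpow_le_rpow_of_exponent_ge hτ0 hτ1.le (by nlinarith)
    rw [← add_assoc, patternValue_succ hτ0, pow_succ, Real.mul_rpow (by positivity) hτ0.le]
    calc (τ ^ j) ^ p * τ ^ p * patternValue τ r p η k
        = ((τ ^ j) ^ p * patternValue τ r p η k) * τ ^ p := by ring
      _ ≤ _ := mul_le_mul ih h2 (by positivity) (patternValue_pos hτ0 _).le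

theorem patternValue_add_le (hτ0 : 0 < τ) (hτ1 : τ < 1) (hrp : r ≤ p) (k j : ℕ) :
    patternValue τ r p η (k + j) ≤ (τ ^ j) ^ r * patternValue τ r p η k := by
  induction j with
  | zero => simp
  | succ j ih =>
    have h1 := fin_two_cast_mem (η (k + j))
    have h2 : τ ^ (r + (p - r) * ((η (k + j) : ℕ) : ℝ)) ≤ τ ^ r :=
      Real.rpow_le_rpow_of_exponent_ge hτ0 hτ1.le (by nlinarith)
    rw [← add_assoc, patternValue_succ hτ0, pow_succ, Real.mul_rpow (by positivity) hτ0.le]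
    calc patternValue τ r p η (k + j) * τ ^ (r + (p - r) * ((η (k + j) : ℕ) : ℝ))
        ≤ ((τ ^ j) ^ r * patternValue τ r p η k) * τ ^ r :=
          mul_le_mul ih h2 (by positivity) (mul_nonneg (by positivity) (patternValue_pos hτ0 _).le)
      _ = _ := by ring

theorem patternValue_antitone (hτ0 : 0 < τ) (hτ1 : τ < 1) (hr : 0 ≤ r) (hrp : r ≤ p) :
    Antitone (patternValue τ r p η) := by
  refine antitone_nat_of_succ_le fun k => (patternValue_add_le hτ0 hτ1 hrp k 1).trans ?_
  have : (τ ^ 1) ^ r ≤ 1 := Real.rpow_le_one (by positivity) (by simpa using hτ1.le) hr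
  exact mul_le_of_le_one_left (patternValue_pos hτ0 _).le this

theorem patternValue_le_pow (hτ0 : 0 < τ) (hτ1 : τ < 1) (hr : 1 ≤ r) (hrp : r ≤ p) (k : ℕ) :
    patternValue τ r p η k ≤ τ ^ k := by
  have h := patternValue_add_le (η := η) hτ0 hτ1 hrp 0 k
  rw [patternValue_zero, zero_add, mul_one] at h
  exact h.trans (by
    simpa using Real.rpow_le_rpow_of_exponent_ge (pow_pos hτ0 k) (pow_le_one₀ hτ0.le hτ1.le) hr)

/-- The affine function that interpolates between `τ ^ (k + 1)` and `τ ^ k`. -/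
def patternLine (τ r p : ℝ) (η : ℕ → Fin 2) (k : ℕ) (t : ℝ) : ℝ :=
  patternValue τ r p η (k + 1) +
    (patternValue τ r p η k - patternValue τ r p η (k + 1)) * (t - τ ^ (k + 1)) /
      (τ ^ k - τ ^ (k + 1))

theorem patternFun_of_pos {t : ℝ} (ht : 0 < t) :
    patternFun τ r p η t = patternLine τ r p η ⌊Real.logb τ t⌋₊ t := by
  simp [patternFun, patternLine, ht.not_ge]

theorem patternFun_zero : patternFun τ r p η 0 = 0 := by simp [patternFun]

theorem pow_sub_pow_succ_pos (hτ0 : 0 < τ) (hτ1 : τ < 1) (k : ℕ) : 0 < τ ^ k - τ ^ (k + 1) :=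
  sub_pos.2 (pow_lt_pow_right_of_lt_one₀ hτ0 hτ1 (Nat.lt_succ_self k))

theorem floor_logb_spec (hτ0 : 0 < τ) (hτ1 : τ < 1) {t : ℝ} (h0 : 0 < t) (h1 : t ≤ 1) :
    τ ^ (⌊Real.logb τ t⌋₊ + 1) < t ∧ t ≤ τ ^ ⌊Real.logb τ t⌋₊ := by
  have hlog : 0 ≤ Real.logb τ t :=
    Real.logb_nonneg_of_base_lt_one hτ0 hτ1 h0 h1
  have ht : τ ^ Real.logb τ t = t := Real.rpow_logb hτ0 hτ1.ne h0
  constructor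
  · rw [← Real.rpow_natCast]
    conv_rhs => rw [← ht]
    exact Real.rpow_lt_rpow_of_exponent_gt hτ0 hτ1 (by exact_mod_cast Nat.lt_floor_add_one _)
  · rw [← Real.rpow_natCast]
    conv_lhs => rw [← ht]
    exact Real.rpow_le_rpow_of_exponent_ge hτ0 hτ1.le (Nat.floor_le hlog)

/-- The natural floor of a nonpositive logarithm is `0`, so `patternFun` continues beyond `1` along
its first line. The modulars below use this extension. -/
theorem floor_logb_of_one_le (hτ0 : 0 < τ) (hτ1 : τ < 1) {t : ℝ} (h1 : 1 ≤ t) :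
    ⌊Real.logb τ t⌋₊ = 0 :=
  Nat.floor_of_nonpos (div_nonpos_of_nonneg_of_nonpos (Real.log_nonneg h1) (Real.log_neg hτ0 hτ1).le)

theorem patternLine_bounds (hτ0 : 0 < τ) (hτ1 : τ < 1) (hr : 0 ≤ r) (hrp : r ≤ p) {k : ℕ} {t : ℝ}
    (h1 : τ ^ (k + 1) ≤ t) (h2 : t ≤ τ ^ k) :
    patternValue τ r p η (k + 1) ≤ patternLine τ r p η k t ∧
      patternLine τ r p η k t ≤ patternValue τ r p η k := by
  have hd := pow_sub_pow_succ_pos hτ0 hτ1 k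
  have hV := patternValue_antitone (η := η) hτ0 hτ1 hr hrp (Nat.le_succ k)
  unfold patternLine
  constructor
  · have : 0 ≤ (patternValue τ r p η k - patternValue τ r p η (k + 1)) * (t - τ ^ (k + 1)) /
      (τ ^ k - τ ^ (k + 1)) :=
      div_nonneg (mul_nonneg (sub_nonneg.2 hV) (sub_nonneg.2 h1)) hd.le
    linarith
  · have : (patternValue τ r p η k - patternValue τ r p η (k + 1)) * (t - τ ^ (k + 1)) /
      (τ ^ k - τ ^ (k + 1)) ≤ patternValue τ r p η k - patternValue τ r p η (k + 1) := by
      rw [div_le_iff₀ hd]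
      exact mul_le_mul_of_nonneg_left (by linarith) (sub_nonneg.2 hV)
    linarith

theorem patternFun_index (hτ0 : 0 < τ) (hτ1 : τ < 1) (hr : 0 ≤ r) (hrp : r ≤ p) {t : ℝ}
    (h0 : 0 < t) (h1 : t ≤ 1) :
    ∃ k : ℕ, τ ^ (k + 1) < t ∧ t ≤ τ ^ k ∧ ∀ η : ℕ → Fin 2,
      patternValue τ r p η (k + 1) ≤ patternFun τ r p η t ∧
        patternFun τ r p η t ≤ patternValue τ r p η k := by
  obtain ⟨h2, h3⟩ := floor_logb_spec hτ0 hτ1 h0 h1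
  refine ⟨_, h2, h3, fun η => ?_⟩
  rw [patternFun_of_pos h0]
  exact patternLine_bounds hτ0 hτ1 hr hrp h2.le h3

theorem patternFun_le_of_le_pow (hτ0 : 0 < τ) (hτ1 : τ < 1) (hr : 0 ≤ r) (hrp : r ≤ p) {t : ℝ}
    {l : ℕ} (h0 : 0 < t) (h : t ≤ τ ^ l) : patternFun τ r p η t ≤ patternValue τ r p η l := by
  obtain ⟨k, h1, -, h3⟩ := patternFun_index hτ0 hτ1 hr hrp h0
    (h.trans (pow_le_one₀ hτ0.le hτ1.le))
  have : l < k + 1 := (pow_lt_pow_iff_right_of_lt_one₀ hτ0 hτ1).1 (h1.trans_le h)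
  exact (h3 η).2.trans (patternValue_antitone hτ0 hτ1 hr hrp (Nat.lt_succ_iff.1 this))

theorem patternValue_le_of_pow_lt (hτ0 : 0 < τ) (hτ1 : τ < 1) (hr : 0 ≤ r) (hrp : r ≤ p) {t : ℝ}
    {l : ℕ} (h : τ ^ l < t) (ht : t ≤ 1) : patternValue τ r p η l ≤ patternFun τ r p η t := by
  obtain ⟨k, -, h2, h3⟩ := patternFun_index hτ0 hτ1 hr hrp ((pow_pos hτ0 l).trans h) ht
  have : k < l := (pow_lt_pow_iff_right_of_lt_one₀ hτ0 hτ1).1 (h.trans_le h2)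
  exact (patternValue_antitone hτ0 hτ1 hr hrp this).trans (h3 η).1

theorem patternFun_of_one_le (hτ0 : 0 < τ) (hτ1 : τ < 1) {t : ℝ} (ht : 1 ≤ t) :
    patternFun τ r p η t = 1 + (1 - patternValue τ r p η 1) / (1 - τ) * (t - 1) := by
  rw [patternFun_of_pos (by linarith), floor_logb_of_one_le hτ0 hτ1 ht, patternLine,
    patternValue_zero]
  have : 1 - τ ≠ 0 := by linarith
  simp only [zero_add, pow_one, pow_zero]
  field_simp
  ring

theorem one_le_slope (hτ0 : 0 < τ) (hτ1 : τ < 1) (hr : 1 ≤ r) (hrp : r ≤ p) :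
    1 ≤ (1 - patternValue τ r p η 1) / (1 - τ) := by
  rw [le_div_iff₀ (by linarith)]
  have := patternValue_le_pow (η := η) hτ0 hτ1 hr hrp 1
  rw [pow_one] at this
  linarith

/-- Because the extension stays above the identity, a modular at most `1` forces every entry into
`[0,1]`, and the domain condition in the norm need not be carried along. -/
theorem le_patternFun_of_one_le (hτ0 : 0 < τ) (hτ1 : τ < 1) (hr : 1 ≤ r) (hrp : r ≤ p) {t : ℝ}
    (ht : 1 ≤ t) : t ≤ patternFun τ r p η t := by
  rw [patternFun_of_one_le hτ0 hτ1 ht]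
  nlinarith [one_le_slope (η := η) hτ0 hτ1 hr hrp]

theorem patternFun_le_of_one_le (hτ0 : 0 < τ) (hτ1 : τ < 1) {t : ℝ}
    (ht : 1 ≤ t) : patternFun τ r p η t ≤ (1 - τ)⁻¹ * t := by
  rw [patternFun_of_one_le hτ0 hτ1 ht]
  have h1 : (1 - patternValue τ r p η 1) / (1 - τ) ≤ (1 - τ)⁻¹ := by
    rw [div_eq_mul_inv]
    exact mul_le_of_le_one_left (inv_nonneg.2 (by linarith))
      (by linarith [patternValue_pos (r := r) (p := p) (η := η) hτ0 1])
  have h2 : 1 ≤ (1 - τ)⁻¹ := (one_le_inv₀ (by linarith)).2 (by linarith)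
  nlinarith

theorem patternFun_pos (hτ0 : 0 < τ) (hτ1 : τ < 1) (hr : 1 ≤ r) (hrp : r ≤ p) {t : ℝ}
    (ht : 0 < t) : 0 < patternFun τ r p η t := by
  rcases le_total t 1 with h | h
  · obtain ⟨k, -, -, h3⟩ := patternFun_index hτ0 hτ1 (zero_le_one.trans hr) hrp ht h
    exact (patternValue_pos hτ0 _).trans_le (h3 η).1
  · exact ht.trans_le (le_patternFun_of_one_le hτ0 hτ1 hr hrp h)

theorem patternFun_nonneg (hτ0 : 0 < τ) (hτ1 : τ < 1) (hr : 1 ≤ r) (hrp : r ≤ p) (t : ℝ) :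
    0 ≤ patternFun τ r p η t := by
  rcases le_or_gt t 0 with h | h
  · simp [patternFun, h]
  · exact (patternFun_pos hτ0 hτ1 hr hrp h).le

/-! ### Convexity -/

/-- The slopes increase towards `1`: the exact condition on the parameters for convexity. -/
def SlopeCondition (τ r p : ℝ) : Prop := τ ^ (r - 1) * (1 - τ ^ p) ≤ 1 - τ ^ r

def patternSlope (τ r p : ℝ) (η : ℕ → Fin 2) (k : ℕ) : ℝ :=
  (patternValue τ r p η k - patternValue τ r p η (k + 1)) / (τ ^ k - τ ^ (k + 1))

theorem patternLine_eq (k : ℕ) (t : ℝ) : patternLine τ r p η k t =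
    patternValue τ r p η (k + 1) + patternSlope τ r p η k * (t - τ ^ (k + 1)) := by
  rw [patternLine, patternSlope]
  ring

theorem patternLine_eq' (hτ0 : 0 < τ) (hτ1 : τ < 1) (k : ℕ) (t : ℝ) : patternLine τ r p η k t =
    patternValue τ r p η k + patternSlope τ r p η k * (t - τ ^ k) := by
  rw [patternLine, patternSlope]
  have := (pow_sub_pow_succ_pos hτ0 hτ1 k).ne'
  field_simp
  ring

theorem patternSlope_nonneg (hτ0 : 0 < τ) (hτ1 : τ < 1) (hr : 0 ≤ r) (hrp : r ≤ p) (k : ℕ) :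
    0 ≤ patternSlope τ r p η k :=
  div_nonneg (sub_nonneg.2 (patternValue_antitone hτ0 hτ1 hr hrp (Nat.le_succ k)))
    (pow_sub_pow_succ_pos hτ0 hτ1 k).le

/-- For consecutive exponents `a, b ∈ {r, p}` the claim reduces to `τ ^ (a - 1) * (1 - τ ^ b) ≤ 1 -
τ ^ a`. Only `a = r`, `b = p` needs the slope condition; the other cases follow from `τ ^ (a - 1) ≤
1` and `τ ^ p ≤ τ ^ r`. -/
theorem patternSlope_succ_le (hτ0 : 0 < τ) (hτ1 : τ < 1) (hr : 1 < r) (hrp : r < p)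
    (hs : SlopeCondition τ r p) (k : ℕ) :
    patternSlope τ r p η (k + 1) ≤ patternSlope τ r p η k := by
  have hd := pow_sub_pow_succ_pos hτ0 hτ1 k
  have hd' := pow_sub_pow_succ_pos hτ0 hτ1 (k + 1)
  have hdd : τ ^ (k + 1) - τ ^ (k + 1 + 1) = τ * (τ ^ k - τ ^ (k + 1)) := by ring
  rw [patternSlope, patternSlope, hdd, div_le_div_iff₀ (by rw [← hdd]; exact hd') hd]
  rw [patternValue_succ hτ0 (k + 1), patternValue_succ hτ0 k]
  set V := patternValue τ r p η k
  have hV : 0 < V := patternValue_pos hτ0 k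
  set d := τ ^ k - τ ^ (k + 1)
  have hq : ∀ x : Fin 2, r + (p - r) * ((x : ℕ) : ℝ) = r ∨ r + (p - r) * ((x : ℕ) : ℝ) = p := by
    intro x
    fin_cases x <;> simp
  have key : ∀ a b : ℝ, (a = r ∨ a = p) → (b = r ∨ b = p) →
      τ ^ a * (1 - τ ^ b) ≤ τ * (1 - τ ^ a) := by
    intro a b ha hb
    have hpos : ∀ c : ℝ, 0 < c → τ ^ c < 1 := fun c hc =>
      Real.rpow_lt_one hτ0.le hτ1 hc
    have hsub : τ ^ (r - 1) * (1 - τ ^ p) ≤ 1 - τ ^ r := hs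
    have e1 : ∀ c : ℝ, τ ^ c = τ * τ ^ (c - 1) := fun c => by
      rw [Real.rpow_sub_one hτ0.ne']; field_simp
    have hpr : τ ^ p ≤ τ ^ r := Real.rpow_le_rpow_of_exponent_ge hτ0 hτ1.le hrp.le
    have c1 : ∀ c : ℝ, 1 < c → τ ^ (c - 1) ≤ 1 := fun c hc =>
      Real.rpow_le_one hτ0.le hτ1.le (by linarith)
    have hp := hpos p (by linarith)
    have hr' := hpos r (by linarith)
    have : τ ^ (a - 1) * (1 - τ ^ b) ≤ 1 - τ ^ a := by
      rcases ha with rfl | rfl <;> rcases hb with rfl | rfl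
      · exact mul_le_of_le_one_left (by linarith) (c1 _ hr)
      · exact hsub
      · exact (mul_le_of_le_one_left (by linarith) (c1 _ (by linarith))).trans (by linarith)
      · exact mul_le_of_le_one_left (by linarith) (c1 _ (by linarith))
    calc τ ^ a * (1 - τ ^ b) = τ * (τ ^ (a - 1) * (1 - τ ^ b)) := by rw [e1 a]; ring
      _ ≤ _ := mul_le_mul_of_nonneg_left this hτ0.le
  have := key _ _ (hq (η k)) (hq (η (k + 1)))
  have hVd : 0 < V * d := mul_pos hV hd
  nlinarith [mul_le_mul_of_nonneg_left this hVd.le]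

/-- Neighbouring lines `i` and `i + 1` cross at `τ ^ (i + 1)` and their slopes are ordered. Moving
from the line active at `t` to line `j` one index at a time, every change goes down. -/
theorem patternLine_le_patternFun (hτ0 : 0 < τ) (hτ1 : τ < 1) (hr : 1 < r) (hrp : r < p)
    (hs : SlopeCondition τ r p) (j : ℕ) {t : ℝ} (h0 : 0 < t) (h1 : t ≤ 1) :
    patternLine τ r p η j t ≤ patternFun τ r p η t := by
  rw [patternFun_of_pos h0]
  obtain ⟨hlt, hle⟩ := floor_logb_spec hτ0 hτ1 h0 h1
  set k := ⌊Real.logb τ t⌋₊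
  have hstep : ∀ i, patternLine τ r p η i t - patternLine τ r p η (i + 1) t =
      (patternSlope τ r p η i - patternSlope τ r p η (i + 1)) * (t - τ ^ (i + 1)) := fun i => by
    rw [patternLine_eq, patternLine_eq' hτ0 hτ1 (i + 1)]
    ring
  rcases le_total k j with hkj | hkj
  · obtain ⟨d, rfl⟩ := Nat.exists_eq_add_of_le hkj
    clear hkj
    induction d with
    | zero => exact le_rfl
    | succ d ih =>
      refine le_trans ?_ ih
      have hm := mul_nonneg (sub_nonneg.2
        (patternSlope_succ_le (η := η) hτ0 hτ1 hr hrp hs (k + d)))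
        (sub_nonneg.2 ((pow_le_pow_of_le_one hτ0.le hτ1.le
          (show k + 1 ≤ k + d + 1 by omega)).trans hlt.le))
      rw [← hstep] at hm
      rw [← add_assoc]
      linarith
  · obtain ⟨d, hd⟩ := Nat.exists_eq_add_of_le hkj
    induction d generalizing j with
    | zero => rw [hd]; simp
    | succ d ih =>
      refine le_trans ?_ (ih (j + 1) (by omega) (by omega))
      have hm := mul_nonneg (sub_nonneg.2
        (patternSlope_succ_le (η := η) hτ0 hτ1 hr hrp hs j))
        (sub_nonneg.2 (hle.trans (pow_le_pow_of_le_one hτ0.le hτ1.le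
          (show j + 1 ≤ k by omega))))
      have h2 := hstep j
      nlinarith

theorem patternLine_zero_nonpos (hτ0 : 0 < τ) (hτ1 : τ < 1) (hr : 1 < r) (hrp : r < p) (j : ℕ) :
    patternLine τ r p η j 0 ≤ 0 := by
  have hd := pow_sub_pow_succ_pos hτ0 hτ1 j
  rw [patternLine_eq, patternSlope]
  have h := patternValue_add_le (η := η) hτ0 hτ1 hrp.le j 1
  have h2 : (τ ^ 1) ^ r ≤ τ := by
    simpa using Real.rpow_le_rpow_of_exponent_ge hτ0 hτ1.le hr.le
  have hV : 0 < patternValue τ r p η j := patternValue_pos hτ0 j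
  have h3 : patternValue τ r p η (j + 1) ≤ τ * patternValue τ r p η j :=
    h.trans (mul_le_mul_of_nonneg_right h2 hV.le)
  have e : τ ^ (j + 1) / (τ ^ j - τ ^ (j + 1)) = τ / (1 - τ) := by
    have : 1 - τ ≠ 0 := by linarith
    rw [div_eq_div_iff hd.ne' this]
    ring
  have e2 : (patternValue τ r p η j - patternValue τ r p η (j + 1)) / (τ ^ j - τ ^ (j + 1)) *
      (0 - τ ^ (j + 1)) = -((patternValue τ r p η j - patternValue τ r p η (j + 1)) *
        (τ ^ (j + 1) / (τ ^ j - τ ^ (j + 1)))) := by ring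
  rw [e2, e, ← sub_eq_add_neg, sub_nonpos, mul_div_assoc', le_div_iff₀ (by linarith)]
  nlinarith

theorem isOrliczFunction_patternFun (hτ0 : 0 < τ) (hτ1 : τ < 1) (hr : 1 < r) (hrp : r < p)
    (hs : SlopeCondition τ r p) (η : ℕ → Fin 2) : IsOrliczFunction (patternFun τ r p η) := by
  have hone : patternFun τ r p η 1 = 1 := by rw [patternFun_of_one_le hτ0 hτ1 le_rfl]; simp
  have hle : ∀ j, ∀ t ∈ Icc (0 : ℝ) 1, patternLine τ r p η j t ≤ patternFun τ r p η t := by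
    intro j t ht
    rcases ht.1.eq_or_lt with rfl | h
    · rw [patternFun_zero]
      exact patternLine_zero_nonpos hτ0 hτ1 hr hrp j
    · exact patternLine_le_patternFun hτ0 hτ1 hr hrp hs j h ht.2
  have hconv : ConvexOn ℝ (Icc 0 1) (patternFun τ r p η) := by
    refine ⟨convex_Icc 0 1, fun x hx y hy a b ha hb hab => ?_⟩
    simp only [smul_eq_mul]
    have hz : a * x + b * y ∈ Icc (0 : ℝ) 1 := by
      simpa using convex_Icc (0 : ℝ) 1 hx hy ha hb hab
    rcases hz.1.eq_or_lt with h | h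
    · rw [← h, patternFun_zero]
      exact add_nonneg (mul_nonneg ha (patternFun_nonneg hτ0 hτ1 hr.le hrp.le _))
        (mul_nonneg hb (patternFun_nonneg hτ0 hτ1 hr.le hrp.le _))
    -- The line active at the convex combination is affine and lies below the function at both `x`
    -- and `y`.
    · rw [patternFun_of_pos h]
      set k := ⌊Real.logb τ (a * x + b * y)⌋₊
      calc patternLine τ r p η k (a * x + b * y)
          = a * patternLine τ r p η k x + b * patternLine τ r p η k y := by
            simp only [patternLine_eq]
            obtain rfl : b = 1 - a := by linarith
            ring
        _ ≤ _ := add_le_add (mul_le_mul_of_nonneg_left (hle k x hx) ha)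
            (mul_le_mul_of_nonneg_left (hle k y hy) hb)
  -- Convexity gives continuity only in the interior. At `0` the function is squeezed between `0`
  -- and `t`; near `1` it coincides with its first line.
  refine ⟨?_, ?_, hconv, patternFun_zero, hone⟩
  · have hid : ∀ t ∈ Icc (0 : ℝ) 1, patternFun τ r p η t ≤ t := fun t ht => by
      have := hconv.2 (show (1 : ℝ) ∈ Icc (0 : ℝ) 1 by simp)
        (show (0 : ℝ) ∈ Icc (0 : ℝ) 1 by simp) ht.1 (sub_nonneg.2 ht.2) (by ring)
      simpa [hone, patternFun_zero] using this
    intro t ht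
    rcases ht.1.eq_or_lt with rfl | h0
    · rw [ContinuousWithinAt, patternFun_zero]
      refine tendsto_of_tendsto_of_tendsto_of_le_of_le' tendsto_const_nhds
        (show Tendsto (fun t : ℝ => t) (𝓝[Icc 0 1] 0) (𝓝 0) from
          tendsto_id.mono_left nhdsWithin_le_nhds) ?_ ?_
      · exact Eventually.of_forall fun t => patternFun_nonneg hτ0 hτ1 hr.le hrp.le t
      · filter_upwards [self_mem_nhdsWithin] with t ht using hid t ht
    rcases ht.2.lt_or_eq with h1 | rfl
    · have := hconv.continuousOn_interior
      rw [interior_Icc] at this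
      exact (this.continuousAt (Ioo_mem_nhds h0 h1)).continuousWithinAt
    · have hev : patternFun τ r p η =ᶠ[𝓝[Icc 0 1] 1] patternLine τ r p η 0 := by
        have : Ioi τ ∈ 𝓝[Icc 0 1] (1 : ℝ) := mem_nhdsWithin_of_mem_nhds (Ioi_mem_nhds hτ1)
        filter_upwards [this, self_mem_nhdsWithin] with t h1 h2
        have h3 : 0 < t := hτ0.trans h1
        rw [patternFun_of_pos h3]
        obtain ⟨-, h4⟩ := floor_logb_spec hτ0 hτ1 h3 h2.2
        have : ⌊Real.logb τ t⌋₊ < 1 := by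
          refine (pow_lt_pow_iff_right_of_lt_one₀ hτ0 hτ1).1 ?_
          rw [pow_one]
          exact lt_of_lt_of_le h1 h4
        rw [Nat.lt_one_iff.1 this]
      have hc : Continuous (patternLine τ r p η 0) := by
        have : patternLine τ r p η 0 = fun t => patternValue τ r p η (0 + 1) +
          patternSlope τ r p η 0 * (t - τ ^ (0 + 1)) := funext fun t => patternLine_eq 0 t
        rw [this]
        fun_prop
      exact (hc.continuousWithinAt).congr_of_eventuallyEq_of_mem hev (by simp)
  · intro x hx y hy hxy
    rcases hx.1.eq_or_lt with rfl | h0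
    · rw [patternFun_zero]
      exact patternFun_nonneg hτ0 hτ1 hr.le hrp.le _
    · rw [patternFun_of_pos h0]
      refine le_trans ?_ (hle ⌊Real.logb τ x⌋₊ y hy)
      simp only [patternLine_eq]
      have := mul_le_mul_of_nonneg_left (sub_le_sub_right hxy (τ ^ (⌊Real.logb τ x⌋₊ + 1)))
        (patternSlope_nonneg (η := η) hτ0 hτ1 (by linarith) hrp.le ⌊Real.logb τ x⌋₊)
      linarith

end PatternGrowth

/-! ### Power-type growth and comparison of the pattern functions. -/

section GrowthEstimates

variable {τ r p : ℝ} {η : ℕ → Fin 2}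

/-- A window of length at most its starting point contains at most one zero more. -/
def IsSparsePattern (η : ℕ → Fin 2) : Prop :=
  ∀ k j : ℕ, j ≤ k →
    (∑ n ∈ Finset.range k, ((η n : ℕ) : ℝ)) + j ≤ (∑ n ∈ Finset.range (k + j), ((η n : ℕ) : ℝ)) + 1

theorem rpow_pow_comm (hτ0 : 0 < τ) (j : ℕ) (q : ℝ) : (τ ^ j) ^ q = (τ ^ q) ^ j := by
  rw [← Real.rpow_natCast, ← Real.rpow_mul hτ0.le, mul_comm, Real.rpow_mul hτ0.le,
    Real.rpow_natCast]

/-- Decay is at most of power `p`. Rounding `s` and `t` to nodes costs one factor `τ ^ p` each; the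
factor `1 - τ` pays for `t > 1`, where the function is at most `(1 - τ)⁻¹ * t`. -/
theorem rpow_mul_patternFun_le (hτ0 : 0 < τ) (hτ1 : τ < 1) (hr : 1 < r) (hrp : r < p) {s t : ℝ}
    (hs0 : 0 < s) (hs1 : s ≤ 1) (ht : 0 ≤ t) :
    s ^ p * patternFun τ r p η t ≤ ((τ ^ p) ^ 2 * (1 - τ))⁻¹ * patternFun τ r p η (s * t) := by
  have h1τ : 0 < 1 - τ := by linarith
  have hc : 0 < (τ ^ p) ^ 2 * (1 - τ) := by positivity
  rw [le_inv_mul_iff₀ hc]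
  have hτp : 0 < τ ^ p := by positivity
  have hτp1 : τ ^ p ≤ 1 := Real.rpow_le_one hτ0.le hτ1.le (by linarith)
  have key : ∀ {s t : ℝ}, 0 < s → s ≤ 1 → 0 < t → t ≤ 1 →
      (τ ^ p) ^ 2 * (s ^ p * patternFun τ r p η t) ≤ patternFun τ r p η (s * t) := by
    intro s t hs0 hs1 ht0 ht1
    obtain ⟨j, hj1, hj2, -⟩ := patternFun_index (r := r) (p := p) hτ0 hτ1 (by linarith) hrp.le hs0 hs1
    obtain ⟨k, hk1, hk2, hk3⟩ := patternFun_index (r := r) (p := p) hτ0 hτ1 (by linarith) hrp.le ht0 ht1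
    have hlt : τ ^ (k + (j + 2)) < s * t := by
      calc τ ^ (k + (j + 2)) = τ ^ (j + 1) * τ ^ (k + 1) := by ring
        _ < s * t := mul_lt_mul'' hj1 hk1 (by positivity) (by positivity)
    have h1 := patternValue_le_of_pow_lt (η := η) hτ0 hτ1 (by linarith) hrp.le hlt
      (mul_le_one₀ hs1 ht0.le ht1)
    have h2 := patternValue_add_ge (η := η) hτ0 hτ1 hrp.le k (j + 2)
    have h3 : s ^ p ≤ (τ ^ j) ^ p := Real.rpow_le_rpow hs0.le hj2 (by linarith)
    have h4 : (τ ^ (j + 2)) ^ p = (τ ^ p) ^ 2 * (τ ^ j) ^ p := by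
      rw [rpow_pow_comm hτ0, rpow_pow_comm hτ0]; ring
    calc (τ ^ p) ^ 2 * (s ^ p * patternFun τ r p η t)
        ≤ (τ ^ p) ^ 2 * ((τ ^ j) ^ p * patternValue τ r p η k) :=
          mul_le_mul_of_nonneg_left (mul_le_mul h3 (hk3 η).2
            (patternFun_nonneg hτ0 hτ1 hr.le hrp.le _) (by positivity)) (by positivity)
      _ = (τ ^ (j + 2)) ^ p * patternValue τ r p η k := by rw [h4]; ring
      _ ≤ _ := h2.trans h1
  have hnn : ∀ t, 0 ≤ patternFun τ r p η t := patternFun_nonneg hτ0 hτ1 hr.le hrp.le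
  have hsp : 0 ≤ s ^ p := by positivity
  have hone : patternFun τ r p η 1 = 1 := by rw [patternFun_of_one_le hτ0 hτ1 le_rfl]; simp
  rcases ht.eq_or_lt with rfl | ht0
  · simp [patternFun_zero]
  rcases le_total t 1 with ht1 | ht1
  · refine le_trans ?_ (key hs0 hs1 ht0 ht1)
    have := mul_nonneg (mul_nonneg (sq_nonneg (τ ^ p)) (mul_nonneg hsp (hnn t))) hτ0.le
    nlinarith
  have ht2 : (1 - τ) * patternFun τ r p η t ≤ t := by
    rw [← le_inv_mul_iff₀ h1τ]
    exact patternFun_le_of_one_le hτ0 hτ1 ht1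
  have ht2' := mul_le_mul_of_nonneg_left ht2 hsp
  have hsq : (τ ^ p) ^ 2 ≤ 1 := pow_le_one₀ hτp.le hτp1
  have goal1 : (τ ^ p) ^ 2 * (1 - τ) * (s ^ p * patternFun τ r p η t) ≤
      (τ ^ p) ^ 2 * (s ^ p * t) := by
    nlinarith [mul_le_mul_of_nonneg_left ht2' (sq_nonneg (τ ^ p))]
  refine goal1.trans ?_
  rcases le_total 1 (s * t) with hst | hst
  · have hsps : s ^ p ≤ s := by
      simpa using Real.rpow_le_rpow_of_exponent_ge hs0 hs1 (show (1 : ℝ) ≤ p by linarith)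
    calc (τ ^ p) ^ 2 * (s ^ p * t) ≤ 1 * (s * t) :=
          mul_le_mul hsq (mul_le_mul_of_nonneg_right hsps ht) (by positivity) zero_le_one
      _ = s * t := one_mul _
      _ ≤ _ := le_patternFun_of_one_le hτ0 hτ1 hr.le hrp.le hst
  · have h := key (mul_pos hs0 ht0) hst one_pos le_rfl
    rw [hone, mul_one, mul_one] at h
    refine le_trans (mul_le_mul_of_nonneg_left ?_ (by positivity)) h
    rw [Real.mul_rpow hs0.le ht]
    exact mul_le_mul_of_nonneg_left (by
      simpa using Real.rpow_le_rpow_of_exponent_le ht1 (show (1 : ℝ) ≤ p by linarith)) hsp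

theorem patternFun_mul_le_rpow (hτ0 : 0 < τ) (hτ1 : τ < 1) (hr : 1 < r) (hrp : r < p) {s t : ℝ}
    (hs0 : 0 ≤ s) (hs1 : s ≤ 1) (ht : 0 ≤ t) (ht1 : t ≤ 1) :
    patternFun τ r p η (s * t) ≤ ((τ ^ p) ^ 2)⁻¹ * (s ^ r * patternFun τ r p η t) := by
  have hnn : ∀ t, 0 ≤ patternFun τ r p η t := patternFun_nonneg hτ0 hτ1 hr.le hrp.le
  rcases hs0.eq_or_lt with rfl | hs0'
  · rw [zero_mul, patternFun_zero]
    exact mul_nonneg (by positivity) (mul_nonneg (by positivity) (hnn _))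
  rcases ht.eq_or_lt with rfl | ht0
  · simp [patternFun_zero]
  obtain ⟨j, hj1, hj2, -⟩ := patternFun_index (r := r) (p := p) hτ0 hτ1 (by linarith) hrp.le hs0' hs1
  obtain ⟨k, hk1, hk2, hk3⟩ := patternFun_index (r := r) (p := p) hτ0 hτ1 (by linarith) hrp.le ht0 ht1
  rw [le_inv_mul_iff₀ (by positivity)]
  have hle : s * t ≤ τ ^ (k + j) := by
    rw [pow_add, mul_comm]
    exact mul_le_mul hk2 hj2 hs0 (by positivity)
  have h1 := patternFun_le_of_le_pow (r := r) (p := p) (η := η) hτ0 hτ1 (by linarith) hrp.le (mul_pos hs0' ht0) hle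
  have h2 := patternValue_add_le (η := η) hτ0 hτ1 hrp.le k j
  have h3 : τ ^ p * (τ ^ j) ^ r ≤ s ^ r := by
    calc τ ^ p * (τ ^ j) ^ r ≤ τ ^ r * (τ ^ j) ^ r :=
          mul_le_mul_of_nonneg_right
            (Real.rpow_le_rpow_of_exponent_ge hτ0 hτ1.le hrp.le) (by positivity)
      _ = (τ ^ (j + 1)) ^ r := by rw [rpow_pow_comm hτ0, rpow_pow_comm hτ0]; ring
      _ ≤ s ^ r := Real.rpow_le_rpow (by positivity) hj1.le (by linarith)
  have h4 : τ ^ p * patternValue τ r p η k ≤ patternFun τ r p η t := by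
    have := patternValue_add_ge (η := η) hτ0 hτ1 hrp.le k 1
    rw [pow_one] at this
    exact this.trans (hk3 η).1
  calc (τ ^ p) ^ 2 * patternFun τ r p η (s * t)
      ≤ (τ ^ p) ^ 2 * ((τ ^ j) ^ r * patternValue τ r p η k) :=
        mul_le_mul_of_nonneg_left (h1.trans h2) (by positivity)
    _ = (τ ^ p * (τ ^ j) ^ r) * (τ ^ p * patternValue τ r p η k) := by ring
    _ ≤ _ := mul_le_mul h3 h4 (mul_nonneg (by positivity) (patternValue_pos hτ0 _).le)
      (by positivity)

theorem IsSparsePattern.patternValue_add_le (hη : IsSparsePattern η) (hτ0 : 0 < τ) (hτ1 : τ < 1)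
    (hr : 0 ≤ r) (hrp : r ≤ p) {k j : ℕ} (hjk : j ≤ k) :
    τ ^ p * patternValue τ r p η (k + j) ≤ (τ ^ p) ^ j * patternValue τ r p η k := by
  rw [← rpow_pow_comm hτ0, patternValue, patternValue, ← Real.rpow_natCast, ← Real.rpow_mul hτ0.le,
    ← Real.rpow_add hτ0, ← Real.rpow_add hτ0]
  refine Real.rpow_le_rpow_of_exponent_ge hτ0 hτ1.le ?_
  have h := mul_le_mul_of_nonneg_left (hη k j hjk) (sub_nonneg.2 hrp)
  push_cast
  nlinarith

/-- In terms of node indices `t ≤ s` means `j ≤ k`, so the window from `k` to `k + j` has at most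
one zero and the value decays with the full power `p`. Of the three factors `τ ^ p`, two come from
rounding and one from that zero. -/
theorem IsSparsePattern.patternFun_mul_le (hη : IsSparsePattern η) (hτ0 : 0 < τ) (hτ1 : τ < 1)
    (hr : 1 < r) (hrp : r < p) {s t : ℝ} (hts : t ≤ s) (ht : 0 ≤ t) (hs1 : s ≤ 1) :
    patternFun τ r p η (s * t) ≤ ((τ ^ p) ^ 3)⁻¹ * (s ^ p * patternFun τ r p η t) := by
  have hnn : ∀ t, 0 ≤ patternFun τ r p η t := patternFun_nonneg hτ0 hτ1 hr.le hrp.le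
  rcases ht.eq_or_lt with rfl | ht0
  · simp [patternFun_zero]
  have hs0 : 0 < s := ht0.trans_le hts
  obtain ⟨j, hj1, hj2, -⟩ := patternFun_index (r := r) (p := p) hτ0 hτ1 (by linarith) hrp.le hs0 hs1
  obtain ⟨k, hk1, hk2, hk3⟩ :=
    patternFun_index (r := r) (p := p) hτ0 hτ1 (by linarith) hrp.le ht0 (hts.trans hs1)
  have hjk : j ≤ k := by
    have : τ ^ (k + 1) < τ ^ j := hk1.trans_le (hts.trans hj2)
    exact Nat.lt_succ_iff.1 ((pow_lt_pow_iff_right_of_lt_one₀ hτ0 hτ1).1 this)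
  rw [le_inv_mul_iff₀ (by positivity)]
  have hle : s * t ≤ τ ^ (k + j) := by
    rw [pow_add, mul_comm]
    exact mul_le_mul hk2 hj2 hs0.le (by positivity)
  have h1 := patternFun_le_of_le_pow (r := r) (p := p) (η := η) hτ0 hτ1 (by linarith) hrp.le
    (mul_pos hs0 ht0) hle
  have h2 := hη.patternValue_add_le hτ0 hτ1 (by linarith) hrp.le hjk
  have h3 : τ ^ p * (τ ^ p) ^ j ≤ s ^ p := by
    rw [← pow_succ', ← rpow_pow_comm hτ0]
    exact Real.rpow_le_rpow (by positivity) hj1.le (by linarith)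
  have h4 : τ ^ p * patternValue τ r p η k ≤ patternFun τ r p η t := by
    have := patternValue_add_ge (η := η) hτ0 hτ1 hrp.le k 1
    rw [pow_one] at this
    exact this.trans (hk3 η).1
  calc (τ ^ p) ^ 3 * patternFun τ r p η (s * t)
      ≤ (τ ^ p) ^ 3 * patternValue τ r p η (k + j) := mul_le_mul_of_nonneg_left h1 (by positivity)
    _ = (τ ^ p) ^ 2 * (τ ^ p * patternValue τ r p η (k + j)) := by ring
    _ ≤ (τ ^ p) ^ 2 * ((τ ^ p) ^ j * patternValue τ r p η k) :=
        mul_le_mul_of_nonneg_left h2 (by positivity)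
    _ = (τ ^ p * (τ ^ p) ^ j) * (τ ^ p * patternValue τ r p η k) := by ring
    _ ≤ _ := mul_le_mul h3 h4 (mul_nonneg (by positivity) (patternValue_pos hτ0 _).le)
      (by positivity)

theorem patternFun_one_le_rpow (hτ0 : 0 < τ) (hτ1 : τ < 1) (hr : 1 < r) (hrp : r < p) {t : ℝ}
    (ht : 0 ≤ t) : patternFun τ r p (fun _ => 1) t ≤ (τ ^ p * (1 - τ))⁻¹ * t ^ p := by
  have h1τ : 0 < 1 - τ := by linarith
  have hτp1 : τ ^ p ≤ 1 := Real.rpow_le_one hτ0.le hτ1.le (by linarith)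
  have hτp : 0 < τ ^ p := by positivity
  rcases ht.eq_or_lt with rfl | ht0
  · rw [patternFun_zero]
    positivity
  rw [le_inv_mul_iff₀ (by positivity)]
  rcases le_total t 1 with ht1 | ht1
  · obtain ⟨k, hk1, hk2, hk3⟩ :=
      patternFun_index (r := r) (p := p) hτ0 hτ1 (by linarith) hrp.le ht0 ht1
    have hV : patternValue τ r p (fun _ => 1) k = (τ ^ k) ^ p := by
      rw [patternValue, ← Real.rpow_natCast τ k, ← Real.rpow_mul hτ0.le]
      congr 1
      simp
      ring
    have h := (hk3 fun _ => 1).2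
    rw [hV] at h
    calc τ ^ p * (1 - τ) * patternFun τ r p (fun _ => 1) t
        ≤ τ ^ p * 1 * (τ ^ k) ^ p :=
          mul_le_mul (mul_le_mul_of_nonneg_left (by linarith) hτp.le) h
            (patternFun_nonneg hτ0 hτ1 hr.le hrp.le _) (by positivity)
      _ = (τ ^ (k + 1)) ^ p := by rw [rpow_pow_comm hτ0, rpow_pow_comm hτ0]; ring
      _ ≤ t ^ p := Real.rpow_le_rpow (by positivity) hk1.le (by linarith)
  · have h := patternFun_le_of_one_le (r := r) (p := p) (η := fun _ => 1) hτ0 hτ1 ht1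
    rw [le_inv_mul_iff₀ h1τ] at h
    calc τ ^ p * (1 - τ) * patternFun τ r p (fun _ => 1) t
        = τ ^ p * ((1 - τ) * patternFun τ r p (fun _ => 1) t) := by ring
      _ ≤ 1 * t := mul_le_mul hτp1 h
          (mul_nonneg h1τ.le (patternFun_nonneg hτ0 hτ1 hr.le hrp.le _)) zero_le_one
      _ = t := one_mul t
      _ ≤ t ^ p := by
        simpa using Real.rpow_le_rpow_of_exponent_le ht1 (show (1 : ℝ) ≤ p by linarith)

/-- Information at the nodes is turned into information about the functions. Joins in the lattice
use it with two patterns, monotonicity with `η₁ = η₂`. -/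
theorem patternFun_le_add_of_patternValue_le_max (hτ0 : 0 < τ) (hτ1 : τ < 1) (hr : 1 < r)
    (hrp : r < p) {η₁ η₂ : ℕ → Fin 2} (hmax : ∀ k, patternValue τ r p η k ≤
      max (patternValue τ r p η₁ k) (patternValue τ r p η₂ k)) {t : ℝ} (ht : 0 ≤ t) :
    patternFun τ r p η t ≤
      (τ ^ p * (1 - τ))⁻¹ * (patternFun τ r p η₁ t + patternFun τ r p η₂ t) := by
  have h1τ : 0 < 1 - τ := by linarith
  have hτp1 : τ ^ p ≤ 1 := Real.rpow_le_one hτ0.le hτ1.le (by linarith)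
  have hτp : 0 < τ ^ p := by positivity
  have hnn : ∀ η t, 0 ≤ patternFun τ r p η t :=
    fun η t => patternFun_nonneg hτ0 hτ1 hr.le hrp.le t
  rcases ht.eq_or_lt with rfl | ht0
  · simp [patternFun_zero]
  rw [le_inv_mul_iff₀ (by positivity)]
  rcases le_total t 1 with ht1 | ht1
  · obtain ⟨k, hk1, hk2, hk3⟩ :=
      patternFun_index (r := r) (p := p) hτ0 hτ1 (by linarith) hrp.le ht0 ht1
    have h4 : ∀ η, τ ^ p * patternValue τ r p η k ≤ patternFun τ r p η t := fun η => by
      have := patternValue_add_ge (η := η) hτ0 hτ1 hrp.le k 1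
      rw [pow_one] at this
      exact this.trans (hk3 η).1
    have h5 : τ ^ p * patternValue τ r p η k ≤ patternFun τ r p η₁ t + patternFun τ r p η₂ t := by
      rcases le_max_iff.1 (hmax k) with h | h
      · linarith [mul_le_mul_of_nonneg_left h hτp.le, h4 η₁, hnn η₂ t]
      · linarith [mul_le_mul_of_nonneg_left h hτp.le, h4 η₂, hnn η₁ t]
    refine le_trans ?_ h5
    calc τ ^ p * (1 - τ) * patternFun τ r p η t ≤ τ ^ p * 1 * patternValue τ r p η k :=
          mul_le_mul (mul_le_mul_of_nonneg_left (by linarith) hτp.le) (hk3 η).2 (hnn _ _)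
            (by positivity)
      _ = _ := by rw [mul_one]
  · have h := patternFun_le_of_one_le (r := r) (p := p) (η := η) hτ0 hτ1 ht1
    rw [le_inv_mul_iff₀ h1τ] at h
    calc τ ^ p * (1 - τ) * patternFun τ r p η t = τ ^ p * ((1 - τ) * patternFun τ r p η t) := by ring
      _ ≤ 1 * t := mul_le_mul hτp1 h (mul_nonneg h1τ.le (hnn _ _)) zero_le_one
      _ = t := one_mul t
      _ ≤ patternFun τ r p η₁ t := le_patternFun_of_one_le hτ0 hτ1 hr.le hrp.le ht1
      _ ≤ _ := le_add_of_nonneg_right (hnn _ _)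

theorem deltaTwoAtZero_patternFun (hτ0 : 0 < τ) (hτ1 : τ < 1) (hr : 1 < r) (hrp : r < p)
    (η : ℕ → Fin 2) : DeltaTwoAtZero (patternFun τ r p η) := by
  have h1τ : 0 < 1 - τ := by linarith
  refine ⟨2 ^ p * ((τ ^ p) ^ 2 * (1 - τ))⁻¹, by positivity, fun t ht _ => ?_⟩
  have h := rpow_mul_patternFun_le (η := η) hτ0 hτ1 hr hrp (s := 1 / 2) (t := 2 * t) (by norm_num)
    (by norm_num) (by linarith)
  rw [show 1 / 2 * (2 * t) = t by ring, one_div, Real.inv_rpow (by norm_num),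
    inv_mul_le_iff₀ (by positivity)] at h
  rwa [mul_assoc]

/-- At `r = p` the slope condition is strict, because `τ ^ (p - 1) < 1`; by continuity it persists
for `r` near `p`. -/
theorem exists_admissibleParams (hτ0 : 0 < τ) (hτ1 : τ < 1) (hp : 1 < p) :
    ∃ r₀ : ℝ, r₀ < p ∧ ∀ r : ℝ, r₀ < r → r < p → AdmissibleParams τ r p := by
  have hp1 : τ ^ p < 1 := Real.rpow_lt_one hτ0.le hτ1 (by linarith)
  have hcont : Continuous fun r : ℝ => τ ^ (r - 1) * (1 - τ ^ p) - (1 - τ ^ r) := by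
    have h1 : Continuous fun r : ℝ => τ ^ r := Real.continuous_const_rpow hτ0.ne'
    exact ((h1.comp (continuous_id.sub continuous_const)).mul continuous_const).sub
      (continuous_const.sub h1)
  have hlt : τ ^ (p - 1) * (1 - τ ^ p) - (1 - τ ^ p) < 0 := by
    have : τ ^ (p - 1) < 1 := Real.rpow_lt_one hτ0.le hτ1 (by linarith)
    nlinarith
  have hev := hcont.continuousAt.eventually_lt (x₀ := p) continuousAt_const hlt
  obtain ⟨l, u, ⟨hl, hu⟩, hsub⟩ := mem_nhds_iff_exists_Ioo_subset.1 hev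
  refine ⟨max l 1, max_lt hl hp, fun r h1 h2 => ?_⟩
  have hr : 1 < r := (le_max_right _ _).trans_lt h1
  have hs : SlopeCondition τ r p :=
    (sub_neg.1 (hsub ⟨(le_max_left _ _).trans_lt h1, h2.trans hu⟩)).le
  exact ⟨hτ0, hτ1, hr, h2, isOrliczFunction_patternFun hτ0 hτ1 hr h2 hs,
    deltaTwoAtZero_patternFun hτ0 hτ1 hr h2⟩

end GrowthEstimates

/-! ### The growth estimates with a single constant. -/

namespace AdmissibleParams

variable {τ r p : ℝ}

/-- A common constant for all the growth estimates. -/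
def growthConst (_ : AdmissibleParams τ r p) : ℝ := ((τ ^ p) ^ 3 * (1 - τ))⁻¹

variable (h : AdmissibleParams τ r p)
include h

theorem tau_rpow_mem : 0 < τ ^ p ∧ τ ^ p ≤ 1 :=
  ⟨Real.rpow_pos_of_pos h.tau_pos _, Real.rpow_le_one h.tau_pos.le h.tau_lt_one.le
    (by linarith [h.one_lt_r, h.r_lt_p])⟩

theorem one_lt_p : 1 < p := h.one_lt_r.trans h.r_lt_p

theorem growthConst_aux {x : ℝ} (hx : (τ ^ p) ^ 3 * (1 - τ) ≤ x) : x⁻¹ ≤ h.growthConst :=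
  inv_anti₀ (mul_pos (pow_pos h.tau_rpow_mem.1 3) (by linarith [h.tau_lt_one])) hx

theorem one_le_growthConst : 1 ≤ h.growthConst := by
  have h1 := h.tau_rpow_mem
  have h2 : (τ ^ p) ^ 3 ≤ 1 := pow_le_one₀ h1.1.le h1.2
  have := h.growthConst_aux (x := 1) (by
    nlinarith [h.tau_pos, h.tau_lt_one, pow_pos h1.1 3])
  simpa using this

theorem growthConst_pos : 0 < h.growthConst := one_pos.trans_le h.one_le_growthConst

theorem patternFun_nonneg (η : ℕ → Fin 2) (t : ℝ) : 0 ≤ patternFun τ r p η t :=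
  _root_.patternFun_nonneg h.tau_pos h.tau_lt_one h.one_lt_r.le h.r_lt_p.le t

theorem rpow_mul_patternFun_le {η : ℕ → Fin 2} {s t : ℝ} (hs0 : 0 < s) (hs1 : s ≤ 1) (ht : 0 ≤ t) :
    s ^ p * patternFun τ r p η t ≤ h.growthConst * patternFun τ r p η (s * t) := by
  have h1 := h.tau_rpow_mem
  have h2 := h.tau_lt_one
  refine (_root_.rpow_mul_patternFun_le h.tau_pos h.tau_lt_one h.one_lt_r h.r_lt_p hs0 hs1 ht).trans
    (mul_le_mul_of_nonneg_right (h.growthConst_aux ?_) (h.patternFun_nonneg _ _))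
  exact mul_le_mul_of_nonneg_right (pow_le_pow_of_le_one h1.1.le h1.2 (by norm_num)) (by linarith)

theorem patternFun_mul_le_rpow {η : ℕ → Fin 2} {s t : ℝ} (hs0 : 0 ≤ s) (hs1 : s ≤ 1) (ht : 0 ≤ t)
    (ht1 : t ≤ 1) :
    patternFun τ r p η (s * t) ≤ h.growthConst * (s ^ r * patternFun τ r p η t) := by
  have h1 := h.tau_rpow_mem
  refine (_root_.patternFun_mul_le_rpow h.tau_pos h.tau_lt_one h.one_lt_r h.r_lt_p hs0 hs1 ht
    ht1).trans (mul_le_mul_of_nonneg_right (h.growthConst_aux ?_)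
      (mul_nonneg (Real.rpow_nonneg hs0 _) (h.patternFun_nonneg _ _)))
  have h3 : (τ ^ p) ^ 3 ≤ (τ ^ p) ^ 2 := pow_le_pow_of_le_one h1.1.le h1.2 (by norm_num)
  nlinarith [h.tau_pos, pow_pos h1.1 3]

theorem patternFun_mul_le_of_le {η : ℕ → Fin 2} (hη : IsSparsePattern η) {s t : ℝ} (hts : t ≤ s)
    (ht : 0 ≤ t) (hs1 : s ≤ 1) :
    patternFun τ r p η (s * t) ≤ h.growthConst * (s ^ p * patternFun τ r p η t) := by
  have h1 := h.tau_rpow_mem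
  refine (hη.patternFun_mul_le h.tau_pos h.tau_lt_one h.one_lt_r h.r_lt_p hts ht hs1).trans
    (mul_le_mul_of_nonneg_right (h.growthConst_aux ?_)
      (mul_nonneg (Real.rpow_nonneg (ht.trans hts) _) (h.patternFun_nonneg _ _)))
  nlinarith [h.tau_pos, pow_pos h1.1 3]

theorem patternFun_map_one (η : ℕ → Fin 2) : patternFun τ r p η 1 = 1 := (h.orlicz η).map_one

theorem rpow_le_patternFun {η : ℕ → Fin 2} {t : ℝ} (ht : 0 ≤ t) (ht1 : t ≤ 1) :
    t ^ p ≤ h.growthConst * patternFun τ r p η t := by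
  rcases ht.eq_or_lt with rfl | ht0
  · rw [Real.zero_rpow (by linarith [h.one_lt_p])]
    exact mul_nonneg h.growthConst_pos.le (h.patternFun_nonneg _ _)
  · simpa [h.patternFun_map_one] using h.rpow_mul_patternFun_le (η := η) ht0 ht1 zero_le_one

/-- Sparse patterns give submultiplicative functions. -/
theorem patternFun_mul_le {η : ℕ → Fin 2} (hη : IsSparsePattern η) {s t : ℝ} (hs0 : 0 ≤ s)
    (hs1 : s ≤ 1) (ht : 0 ≤ t) (ht1 : t ≤ 1) :
    patternFun τ r p η (s * t) ≤
      h.growthConst ^ 2 * (patternFun τ r p η s * patternFun τ r p η t) := by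
  wlog hts : t ≤ s generalizing s t
  · rw [mul_comm s, mul_comm (patternFun τ r p η s)]
    exact this ht ht1 hs0 hs1 (le_of_not_ge hts)
  have h1 := h.patternFun_mul_le_of_le hη hts ht hs1
  have h2 := mul_le_mul_of_nonneg_right (h.rpow_le_patternFun (η := η) hs0 hs1)
    (h.patternFun_nonneg η t)
  nlinarith [mul_le_mul_of_nonneg_left h2 h.growthConst_pos.le]

theorem patternFun_one_le_rpow {t : ℝ} (ht : 0 ≤ t) :
    patternFun τ r p (fun _ => 1) t ≤ h.growthConst * t ^ p := by
  have h1 := h.tau_rpow_mem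
  refine (_root_.patternFun_one_le_rpow h.tau_pos h.tau_lt_one h.one_lt_r h.r_lt_p ht).trans
    (mul_le_mul_of_nonneg_right (h.growthConst_aux ?_) (by positivity))
  exact mul_le_mul_of_nonneg_right (pow_le_of_le_one h1.1.le h1.2 (by norm_num))
    (by linarith [h.tau_lt_one])

theorem patternFun_le_add {η η₁ η₂ : ℕ → Fin 2} (hmax : ∀ k, patternValue τ r p η k ≤
      max (patternValue τ r p η₁ k) (patternValue τ r p η₂ k)) {t : ℝ} (ht : 0 ≤ t) :
    patternFun τ r p η t ≤
      h.growthConst * (patternFun τ r p η₁ t + patternFun τ r p η₂ t) := by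
  have h1 := h.tau_rpow_mem
  refine (patternFun_le_add_of_patternValue_le_max h.tau_pos h.tau_lt_one h.one_lt_r h.r_lt_p hmax
    ht).trans (mul_le_mul_of_nonneg_right (h.growthConst_aux ?_)
      (add_nonneg (h.patternFun_nonneg _ _) (h.patternFun_nonneg _ _)))
  exact mul_le_mul_of_nonneg_right (pow_le_of_le_one h1.1.le h1.2 (by norm_num))
    (by linarith [h.tau_lt_one])

theorem le_patternFun (η : ℕ → Fin 2) {t : ℝ} (ht : 1 ≤ t) : t ≤ patternFun τ r p η t :=
  le_patternFun_of_one_le h.tau_pos h.tau_lt_one h.one_lt_r.le h.r_lt_p.le ht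

theorem patternFun_mono (η : ℕ → Fin 2) {s t : ℝ} (hs : 0 ≤ s) (hst : s ≤ t) :
    patternFun τ r p η s ≤ patternFun τ r p η t := by
  rcases le_total t 1 with ht | ht
  · exact (h.orlicz η).monotoneOn ⟨hs, hst.trans ht⟩ ⟨hs.trans hst, ht⟩ hst
  rcases le_total s 1 with hs1 | hs1
  · have h1 : patternFun τ r p η s ≤ patternFun τ r p η 1 :=
      (h.orlicz η).monotoneOn ⟨hs, hs1⟩ ⟨zero_le_one, le_rfl⟩ hs1
    rw [h.patternFun_map_one] at h1
    linarith [h.le_patternFun η ht]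
  · have h1 := one_le_slope (η := η) h.tau_pos h.tau_lt_one h.one_lt_r.le h.r_lt_p.le
    rw [patternFun_of_one_le h.tau_pos h.tau_lt_one hs1,
      patternFun_of_one_le h.tau_pos h.tau_lt_one ht]
    nlinarith

/-- On `[0,1]` this is convexity with `M 0 = 0`; the other cases check that the extension keeps the
property. It turns a modular bounded by `K` into a norm bounded by `K`. -/
theorem patternFun_div_le (η : ℕ → Fin 2) {K t : ℝ} (hK : 1 ≤ K) (ht : 0 ≤ t) :
    patternFun τ r p η (t / K) ≤ patternFun τ r p η t / K := by
  have hK0 : 0 < K := one_pos.trans_le hK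
  have hKi : K⁻¹ ≤ 1 := inv_le_one_of_one_le₀ hK
  rcases le_total t 1 with ht1 | ht1
  · simpa [div_eq_inv_mul] using
      (h.orlicz η).map_smul_le ht ht1 (inv_nonneg.2 hK0.le) hKi
  rcases le_total (t / K) 1 with hs | hs
  · have h1 := (h.orlicz η).map_smul_le zero_le_one le_rfl (div_nonneg ht hK0.le) hs
    rw [mul_one, h.patternFun_map_one, mul_one] at h1
    exact h1.trans (div_le_div_of_nonneg_right (h.le_patternFun η ht1) hK0.le)
  · have h1 := one_le_slope (η := η) h.tau_pos h.tau_lt_one h.one_lt_r.le h.r_lt_p.le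
    rw [patternFun_of_one_le h.tau_pos h.tau_lt_one hs,
      patternFun_of_one_le h.tau_pos h.tau_lt_one ht1, le_div_iff₀ hK0]
    have : t / K * K = t := div_mul_cancel₀ _ hK0.ne'
    nlinarith

end AdmissibleParams

/-! ### Modulars of Orlicz sequence spaces -/

/-- The modular `∑ M(|a n|)`. -/
def orliczModular (M : ℝ → ℝ) (a : ℕ → ℝ) : ℝ≥0∞ := ∑' n, ENNReal.ofReal (M |a n|)

namespace OrliczSpace

variable {M : ℝ → ℝ} {hM : IsOrliczFunction M}

theorem ext_seq {a b : OrliczSpace hM} (h : ∀ n, a.seq n = b.seq n) : a = b :=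
  Subtype.ext (funext h)

@[simp] theorem seq_zero (n : ℕ) : (0 : OrliczSpace hM).seq n = 0 := rfl

@[simp] theorem seq_add (a b : OrliczSpace hM) (n : ℕ) : (a + b).seq n = a.seq n + b.seq n := rfl

@[simp] theorem seq_smul (c : ℝ) (a : OrliczSpace hM) (n : ℕ) : (c • a).seq n = c * a.seq n := rfl

theorem seq_sum {ι : Type*} (s : Finset ι) (u : ι → OrliczSpace hM) (n : ℕ) :
    (∑ i ∈ s, u i).seq n = ∑ i ∈ s, (u i).seq n := by
  classical
  induction s using Finset.induction_on with
  | empty => simp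
  | insert i s hi ih => rw [Finset.sum_insert hi, Finset.sum_insert hi, seq_add, ih]

end OrliczSpace

namespace AdmissibleParams

variable {τ r p : ℝ} (h : AdmissibleParams τ r p) {η : ℕ → Fin 2}

include h in
theorem orliczModular_mono {a b : ℕ → ℝ} (hab : ∀ n, |a n| ≤ |b n|) :
    orliczModular (patternFun τ r p η) a ≤ orliczModular (patternFun τ r p η) b :=
  ENNReal.tsum_le_tsum fun n => ENNReal.ofReal_le_ofReal (h.patternFun_mono η (abs_nonneg _) (hab n))

include h in
theorem orliczModular_ne_top_iff {a : ℕ → ℝ} : orliczModular (patternFun τ r p η) a ≠ ⊤ ↔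
    Summable fun n => patternFun τ r p η |a n| := by
  constructor
  · intro hs
    have := ENNReal.summable_toReal hs
    refine this.congr fun n => ENNReal.toReal_ofReal (h.patternFun_nonneg _ _)
  · exact fun hs => hs.tsum_ofReal_ne_top

include h in
theorem le_one_of_orliczModular_le_one {a : ℕ → ℝ}
    (ha : orliczModular (patternFun τ r p η) a ≤ 1) (n : ℕ) : |a n| ≤ 1 := by
  by_contra! hn
  have h1 : ENNReal.ofReal (patternFun τ r p η |a n|) ≤ 1 := (ENNReal.le_tsum n).trans ha
  rw [ENNReal.ofReal_le_one] at h1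
  linarith [h.le_patternFun η hn.le]

include h in
theorem orliczLeOne_iff {a : ℕ → ℝ} {ρ : ℝ} : OrliczLeOne (patternFun τ r p η) a ρ ↔
    0 < ρ ∧ orliczModular (patternFun τ r p η) (fun n => a n / ρ) ≤ 1 := by
  have key : 0 < ρ → ∀ n, |a n / ρ| = |a n| / ρ := fun hρ n => by rw [abs_div, abs_of_pos hρ]
  have hnn : ∀ n, 0 ≤ patternFun τ r p η (|a n| / ρ) := fun n => h.patternFun_nonneg _ _
  constructor
  · rintro ⟨⟨hρ, h1, h2⟩, h3⟩
    refine ⟨hρ, ?_⟩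
    simp only [orliczModular, key hρ]
    rw [← ENNReal.ofReal_tsum_of_nonneg hnn h2]
    exact ENNReal.ofReal_le_one.2 h3
  · rintro ⟨hρ, hm⟩
    have h1 := h.le_one_of_orliczModular_le_one hm
    have h2 := h.orliczModular_ne_top_iff.1 (hm.trans_lt ENNReal.one_lt_top).ne
    simp only [orliczModular, key hρ] at h1 h2 hm
    refine ⟨⟨hρ, fun n => (div_le_one hρ).1 (h1 n), h2⟩, ?_⟩
    rwa [← ENNReal.ofReal_tsum_of_nonneg hnn h2, ENNReal.ofReal_le_one] at hm

theorem norm_le_of_orliczModular_le_one {a : OrliczSpace (h.orlicz η)} {ρ : ℝ} (hρ : 0 < ρ)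
    (ha : orliczModular (patternFun τ r p η) (fun n => a.seq n / ρ) ≤ 1) : ‖a‖ ≤ ρ :=
  OrliczSpace.norm_le (h.orliczLeOne_iff.2 ⟨hρ, ha⟩)

theorem orliczModular_le_one_of_norm_lt {a : OrliczSpace (h.orlicz η)} {ρ : ℝ} (ha : ‖a‖ < ρ) :
    orliczModular (patternFun τ r p η) (fun n => a.seq n / ρ) ≤ 1 := by
  obtain ⟨σ, hσ, hσρ⟩ := exists_lt_of_csInf_lt a.nonempty_set (by rwa [← OrliczSpace.norm_def])
  obtain ⟨hσ0, h1⟩ := h.orliczLeOne_iff.1 hσ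
  refine (h.orliczModular_mono fun n => ?_).trans h1
  rw [abs_div, abs_div, abs_of_pos hσ0, abs_of_pos (hσ0.trans hσρ)]
  exact div_le_div_of_nonneg_left (abs_nonneg _) hσ0 hσρ.le

include h in
theorem orliczModular_div_le {a : ℕ → ℝ} {K : ℝ} (hK : 1 ≤ K) :
    orliczModular (patternFun τ r p η) (fun n => a n / K) ≤
      ENNReal.ofReal K⁻¹ * orliczModular (patternFun τ r p η) a := by
  rw [orliczModular, orliczModular, ← ENNReal.tsum_mul_left]
  refine ENNReal.tsum_le_tsum fun n => ?_
  rw [← ENNReal.ofReal_mul (by positivity)]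
  refine ENNReal.ofReal_le_ofReal ?_
  rw [abs_div, abs_of_pos (one_pos.trans_le hK), inv_mul_eq_div]
  exact h.patternFun_div_le η hK (abs_nonneg _)

theorem norm_le_of_orliczModular_le {a : OrliczSpace (h.orlicz η)} {ρ K : ℝ} (hρ : 0 < ρ)
    (hK : 1 ≤ K)
    (ha : orliczModular (patternFun τ r p η) (fun n => a.seq n / ρ) ≤ ENNReal.ofReal K) :
    ‖a‖ ≤ K * ρ := by
  have hK0 : 0 < K := one_pos.trans_le hK
  refine h.norm_le_of_orliczModular_le_one (mul_pos hK0 hρ) ?_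
  have e : (fun n => a.seq n / (K * ρ)) = fun n => a.seq n / ρ / K :=
    funext fun n => by rw [div_div, mul_comm]
  rw [e]
  refine (h.orliczModular_div_le hK).trans ((mul_le_mul_right ha _).trans ?_)
  rw [← ENNReal.ofReal_mul (by positivity), inv_mul_cancel₀ hK0.ne', ENNReal.ofReal_one]

-- Undoing a contraction by `s` costs at most `growthConst / s ^ p` in the modular. This
-- quantitative `Δ₂`-condition lies behind both the lower `p`-estimate and the change of scale in
-- the upper one.
include h in
theorem orliczModular_le_of_scale {b : ℕ → ℝ} {s x : ℝ} (hs0 : 0 < s) (hs1 : s ≤ 1)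
    (hb : orliczModular (patternFun τ r p η) (fun n => s * b n) ≤ ENNReal.ofReal x) :
    orliczModular (patternFun τ r p η) b ≤ ENNReal.ofReal (h.growthConst * x / s ^ p) := by
  have hsp : 0 < s ^ p := Real.rpow_pos_of_pos hs0 _
  have hC := h.growthConst_pos
  rw [mul_div_right_comm, ENNReal.ofReal_mul (by positivity)]
  refine le_trans ?_ (mul_le_mul_right hb _)
  rw [orliczModular, orliczModular, ← ENNReal.tsum_mul_left]
  refine ENNReal.tsum_le_tsum fun n => ?_
  rw [← ENNReal.ofReal_mul (by positivity)]
  refine ENNReal.ofReal_le_ofReal ?_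
  rw [div_mul_eq_mul_div, le_div_iff₀ hsp, mul_comm, abs_mul, abs_of_pos hs0]
  exact h.rpow_mul_patternFun_le hs0 hs1 (abs_nonneg _)

omit h in
theorem orliczModular_sum {ι : Type*} [Fintype ι] {u : ι → ℕ → ℝ}
    (hu : ∀ n i j, i ≠ j → u i n = 0 ∨ u j n = 0) :
    orliczModular (patternFun τ r p η) (fun n => ∑ i, u i n) =
      ∑ i, orliczModular (patternFun τ r p η) (u i) := by
  classical
  unfold orliczModular
  rw [← Summable.tsum_finsetSum fun i _ => ENNReal.summable]
  refine tsum_congr fun n => ?_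
  by_cases hz : ∃ i, u i n ≠ 0
  · obtain ⟨i, hi⟩ := hz
    have h0 : ∀ j, j ≠ i → u j n = 0 := fun j hj => (hu n j i hj).resolve_right hi
    beta_reduce
    rw [Fintype.sum_eq_single i h0, Fintype.sum_eq_single i]
    intro j hj
    rw [h0 j hj, abs_zero, patternFun_zero, ENNReal.ofReal_zero]
  · push Not at hz
    simp [hz, patternFun_zero]

theorem norm_le_norm_of_abs_le {a b : OrliczSpace (h.orlicz η)}
    (hab : ∀ n, |a.seq n| ≤ |b.seq n|) : ‖a‖ ≤ ‖b‖ := by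
  refine le_of_forall_gt_imp_ge_of_dense fun ρ hρ => ?_
  have hρ0 : 0 < ρ := (norm_nonneg b).trans_lt hρ
  refine h.norm_le_of_orliczModular_le_one hρ0
    ((h.orliczModular_mono fun n => ?_).trans (h.orliczModular_le_one_of_norm_lt hρ))
  rw [abs_div, abs_div]
  exact div_le_div_of_nonneg_right (hab n) (abs_nonneg _)

include h in
theorem orliczModular_div_ne_top {a : ℕ → ℝ} (ha : orliczModular (patternFun τ r p η) a ≠ ⊤)
    {ρ : ℝ} (hρ : 0 < ρ) : orliczModular (patternFun τ r p η) (fun n => a n / ρ) ≠ ⊤ := by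
  rcases le_total 1 ρ with h1 | h1
  · exact ((h.orliczModular_div_le h1).trans_lt
      (ENNReal.mul_lt_top ENNReal.ofReal_lt_top ha.lt_top)).ne
  · have e : (fun n => ρ * (a n / ρ)) = a := funext fun n => mul_div_cancel₀ _ hρ.ne'
    have := h.orliczModular_le_of_scale (η := η) (b := fun n => a n / ρ)
      (x := (orliczModular (patternFun τ r p η) a).toReal) hρ h1
      (by rw [e, ENNReal.ofReal_toReal ha])
    exact (this.trans_lt ENNReal.ofReal_lt_top).ne

theorem orliczModular_seq_ne_top (a : OrliczSpace (h.orlicz η)) :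
    orliczModular (patternFun τ r p η) a.seq ≠ ⊤ := by
  have hρ : 0 < ‖a‖ + 1 := by positivity
  have h1 := h.orliczModular_le_one_of_norm_lt (lt_add_one ‖a‖)
  have h2 := h.orliczModular_div_ne_top (h1.trans_lt ENNReal.one_lt_top).ne (inv_pos.2 hρ)
  simpa [div_mul_cancel₀ _ hρ.ne'] using h2

/-- The element of `ℓ_M` given by a sequence of finite modular. -/
def ofSeq (η : ℕ → Fin 2) (a : ℕ → ℝ) (ha : orliczModular (patternFun τ r p η) a ≠ ⊤) :
    OrliczSpace (h.orlicz η) :=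
  ⟨a, by
    set K := max 1 (orliczModular (patternFun τ r p η) a).toReal
    have hK : 1 ≤ K := le_max_left _ _
    have hK0 : 0 < K := one_pos.trans_le hK
    refine ⟨K, ((h.orliczLeOne_iff).2 ⟨hK0, ?_⟩).1⟩
    refine (h.orliczModular_div_le hK).trans ?_
    rw [← ENNReal.ofReal_toReal ha, ← ENNReal.ofReal_mul (by positivity), ENNReal.ofReal_le_one,
      inv_mul_le_one₀ hK0]
    exact le_max_right _ _⟩

@[simp] theorem seq_ofSeq (a : ℕ → ℝ) (ha : orliczModular (patternFun τ r p η) a ≠ ⊤) (n : ℕ) :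
    (h.ofSeq η a ha).seq n = a n := rfl

open Classical in
/-- Restriction of the sequences in `ℓ_M` to a set of indices. -/
def seqRestrict (η : ℕ → Fin 2) (B : Set ℕ) :
    OrliczSpace (h.orlicz η) →ₗ[ℝ] OrliczSpace (h.orlicz η) where
  toFun a := h.ofSeq η (fun n => if n ∈ B then a.seq n else 0)
    ((h.orliczModular_mono fun n => by split_ifs <;> simp).trans_lt
      (h.orliczModular_seq_ne_top a).lt_top).ne
  map_add' a b := OrliczSpace.ext_seq fun n => by
    simp only [seq_ofSeq, OrliczSpace.seq_add]
    split_ifs <;> simp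
  map_smul' c a := OrliczSpace.ext_seq fun n => by simp [OrliczSpace.seq_smul]

open Classical in
theorem seq_seqRestrict (B : Set ℕ) (a : OrliczSpace (h.orlicz η)) (n : ℕ) :
    (h.seqRestrict η B a).seq n = if n ∈ B then a.seq n else 0 := rfl

theorem norm_seqRestrict_le (B : Set ℕ) (a : OrliczSpace (h.orlicz η)) :
    ‖h.seqRestrict η B a‖ ≤ ‖a‖ :=
  h.norm_le_norm_of_abs_le fun n => by rw [seq_seqRestrict]; split_ifs <;> simp

/-- By the `Δ₂`-type growth the modular of `a / ε` is finite for every `ε`, so its tails drop below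
`1`. -/
theorem exists_norm_tail_le (a : OrliczSpace (h.orlicz η)) {ε : ℝ} (hε : 0 < ε) :
    ∃ N : ℕ, ‖h.seqRestrict η {n | N ≤ n} a‖ ≤ ε := by
  set f : ℕ → ℝ≥0∞ := fun n => ENNReal.ofReal (patternFun τ r p η |a.seq n / ε|) with hf
  have hs : ∑' n, f n ≠ ⊤ := h.orliczModular_div_ne_top (h.orliczModular_seq_ne_top a) hε
  obtain ⟨N, hN⟩ := ((ENNReal.tendsto_sum_nat_add f hs).eventually_lt_const
    (show (0 : ℝ≥0∞) < 1 from one_pos)).exists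
  refine ⟨N, h.norm_le_of_orliczModular_le_one hε (le_trans (le_of_eq ?_) hN.le)⟩
  set g : ℕ → ℝ≥0∞ := fun n => ENNReal.ofReal
    (patternFun τ r p η |(h.seqRestrict η {n | N ≤ n} a).seq n / ε|) with hg
  have h1 : ∀ n ∈ Finset.range N, g n = 0 := fun n hn => by
    have hn' : n ∉ {n | N ≤ n} := by simpa using hn
    rw [hg]
    simp only [seq_seqRestrict, if_neg hn', zero_div, abs_zero, patternFun_zero, ENNReal.ofReal_zero]
  have h2 : ∀ n, g (n + N) = f (n + N) := fun n => by
    have hn' : n + N ∈ {n | N ≤ n} := by simp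
    simp only [hg, hf, seq_seqRestrict, if_pos hn']
  change ∑' n, g n = _
  rw [← Summable.sum_add_tsum_nat_add' (k := N) ENNReal.summable, Finset.sum_eq_zero h1, zero_add]
  exact tsum_congr h2

/-! ### Estimates for sums of disjoint vectors of `ℓ_M` -/

/-- The scale changes from `c`, adapted to one vector, to the common `l`. If `c ≤ l` the modular
only decreases; otherwise `orliczModular_le_of_scale` costs a factor `growthConst * (c / l) ^ p`.
The sum covers both cases. -/
theorem orliczModular_smul_le_of_good {u : OrliczSpace (h.orlicz η)} {a c m D l : ℝ} (hD : 1 ≤ D)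
    (hm : 0 ≤ m) (hc : 0 < c) (hl : 0 < l)
    (hg : orliczModular (patternFun τ r p η) (fun n => a * u.seq n / (2 * c)) ≤
      ENNReal.ofReal (D * m)) :
    orliczModular (patternFun τ r p η) (fun n => a * u.seq n / (2 * D * l)) ≤
      ENNReal.ofReal (D * m + h.growthConst * D * (c ^ p * m) / l ^ p) := by
  have hC := h.growthConst_pos
  have hD0 : 0 < D := by linarith
  have hlp : 0 < l ^ p := Real.rpow_pos_of_pos hl _
  have hcp : 0 < c ^ p := Real.rpow_pos_of_pos hc _
  have t1 : 0 ≤ D * m := mul_nonneg hD0.le hm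
  have t2 : 0 ≤ h.growthConst * D * (c ^ p * m) / l ^ p := by positivity
  have hmono : ∀ k, 0 < k → k ≤ D * l →
      orliczModular (patternFun τ r p η) (fun n => a * u.seq n / (2 * D * l)) ≤
        orliczModular (patternFun τ r p η) (fun n => a * u.seq n / (2 * k)) := fun k hk hkl =>
    h.orliczModular_mono fun n => by
      rw [abs_div, abs_div, abs_of_pos (show 0 < 2 * D * l by positivity),
        abs_of_pos (show 0 < 2 * k by positivity)]
      exact div_le_div_of_nonneg_left (abs_nonneg _) (by positivity) (by linarith)
  have hDl : l ≤ D * l := le_mul_of_one_le_left hl.le hD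
  rcases le_or_gt c l with hcl | hcl
  · exact (hmono c hc (hcl.trans hDl)).trans
      (hg.trans (ENNReal.ofReal_le_ofReal (by linarith)))
  · have hs := h.orliczModular_le_of_scale (η := η) (b := fun n => a * u.seq n / (2 * l))
      (s := l / c) (x := D * m) (div_pos hl hc) ((div_le_one hc).2 hcl.le) (by
        have e : (fun n => l / c * (a * u.seq n / (2 * l))) =
            fun n => a * u.seq n / (2 * c) := by
          funext n
          field_simp
        rw [e]
        exact hg)
    refine (hmono l hl hDl).trans (hs.trans (ENNReal.ofReal_le_ofReal ?_))
    have : h.growthConst * (D * m) / (l / c) ^ p = h.growthConst * D * (c ^ p * m) / l ^ p := by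
      rw [Real.div_rpow hl.le hc.le]
      field_simp
    rw [this]
    linarith

/-- For an exceptional vector only `|a| * c ≤ D * l` is available, from `|a| ^ p * c ^ p ≤ D * (c ^
p * m) ≤ (D * l) ^ p`. This suffices for one vector, not for many. -/
theorem orliczModular_smul_le_one {u : OrliczSpace (h.orlicz η)} {a c m D l : ℝ} (hD : 1 ≤ D)
    (hc : 0 < c) (hl : 0 < l) (huc : ‖u‖ ≤ c) (ha : |a| ^ p ≤ D * m) (hcm : c ^ p * m ≤ l ^ p) :
    orliczModular (patternFun τ r p η) (fun n => a * u.seq n / (2 * D * l)) ≤ 1 := by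
  have hp : 0 < p := by linarith [h.one_lt_p]
  have hD0 : 0 < D := by linarith
  have hlp : 0 < l ^ p := Real.rpow_pos_of_pos hl _
  have hcp : 0 < c ^ p := Real.rpow_pos_of_pos hc _
  have hac : |a| * c ≤ D * l := by
    refine (Real.rpow_le_rpow_iff (mul_nonneg (abs_nonneg _) hc.le) (by positivity) hp).1 ?_
    rw [Real.mul_rpow (abs_nonneg _) hc.le, Real.mul_rpow hD0.le hl.le]
    have hDp : D ≤ D ^ p := by
      simpa using Real.rpow_le_rpow_of_exponent_le hD h.one_lt_p.le
    calc |a| ^ p * c ^ p ≤ D * m * c ^ p := mul_le_mul_of_nonneg_right ha hcp.le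
      _ = D * (c ^ p * m) := by ring
      _ ≤ D * l ^ p := mul_le_mul_of_nonneg_left hcm hD0.le
      _ ≤ _ := mul_le_mul_of_nonneg_right hDp hlp.le
  refine (h.orliczModular_mono fun n => ?_).trans
    (h.orliczModular_le_one_of_norm_lt (show ‖u‖ < 2 * c by linarith))
  rw [abs_div, abs_div, abs_mul, abs_of_pos (show 0 < 2 * D * l by positivity),
    abs_of_pos (show 0 < 2 * c by positivity), div_le_div_iff₀ (by positivity) (by positivity)]
  linarith [mul_le_mul_of_nonneg_right hac (abs_nonneg (u.seq n))]

/-- The upper estimate in one component; `m i` is the mass of the coefficient `a i`. At scale `2 * D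
* l` the modulars of disjoint vectors add up: the good ones contribute at most `D + growthConst *
D`, the single bad one at most `1`. Leaving `l` tied only to `∑ c i ^ p * m i` is what allows
summation over components. -/
theorem norm_sum_le_of_orliczModular_le {ι : Type*} [Fintype ι] {u : ι → OrliczSpace (h.orlicz η)}
    (hdisj : ∀ n i j, i ≠ j → (u i).seq n = 0 ∨ (u j).seq n = 0) {a c m : ι → ℝ} {D : ℝ}
    (hD : 1 ≤ D) (hm : ∀ i, 0 ≤ m i) (hm1 : ∑ i, m i ≤ 1) (huc : ∀ i, ‖u i‖ ≤ c i)
    (ha : ∀ i, |a i| ^ p ≤ D * m i) {bad : ι → Prop} (hbad : ∀ i j, bad i → bad j → i = j)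
    (hgood : ∀ i, ¬bad i → 0 < c i → orliczModular (patternFun τ r p η)
      (fun n => a i * (u i).seq n / (2 * c i)) ≤ ENNReal.ofReal (D * m i))
    {l : ℝ} (hl : 0 < l) (hcl : ∑ i, c i ^ p * m i ≤ l ^ p) :
    ‖∑ i, a i • u i‖ ≤ (D + h.growthConst * D + 1) * (2 * D * l) := by
  classical
  have hC := h.growthConst_pos
  have hD0 : 0 < D := by linarith
  have hc : ∀ i, 0 ≤ c i := fun i => (norm_nonneg _).trans (huc i)
  have hlp : 0 < l ^ p := Real.rpow_pos_of_pos hl _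
  have hcm : ∀ i, c i ^ p * m i ≤ l ^ p := fun i =>
    (Finset.single_le_sum (f := fun i => c i ^ p * m i)
      (fun j _ => mul_nonneg (Real.rpow_nonneg (hc j) _) (hm j)) (Finset.mem_univ i)).trans hcl
  have t : ∀ i, 0 ≤ D * m i + h.growthConst * D * (c i ^ p * m i) / l ^ p := fun i =>
    add_nonneg (mul_nonneg hD0.le (hm i)) (div_nonneg (mul_nonneg (by positivity)
      (mul_nonneg (Real.rpow_nonneg (hc i) _) (hm i))) hlp.le)
  have hK : 1 ≤ D + h.growthConst * D + 1 := by
    have := mul_pos hC hD0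
    linarith
  refine h.norm_le_of_orliczModular_le (by positivity) hK ?_
  have e : (fun n => (∑ i, a i • u i).seq n / (2 * D * l)) =
      fun n => ∑ i, a i * (u i).seq n / (2 * D * l) := by
    funext n
    rw [OrliczSpace.seq_sum, Finset.sum_div]
    rfl
  rw [e, orliczModular_sum fun n i j hij => by
    rcases hdisj n i j hij with h0 | h0 <;> simp [h0]]
  have hbound : ∀ i, orliczModular (patternFun τ r p η) (fun n => a i * (u i).seq n / (2 * D * l)) ≤
      ENNReal.ofReal (D * m i + h.growthConst * D * (c i ^ p * m i) / l ^ p +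
        if bad i then 1 else 0) := by
    intro i
    rcases (hc i).eq_or_lt with hci | hci
    · have hu : u i = 0 := norm_le_zero_iff.1 ((huc i).trans hci.ge)
      simp [orliczModular, hu, patternFun_zero]
    by_cases hb : bad i
    · rw [if_pos hb]
      refine (h.orliczModular_smul_le_one hD hci hl (huc i) (ha i) (hcm i)).trans ?_
      rw [← ENNReal.ofReal_one]
      exact ENNReal.ofReal_le_ofReal (by linarith [t i])
    · rw [if_neg hb, add_zero]
      exact h.orliczModular_smul_le_of_good hD (hm i) hci hl (hgood i hb hci)
  refine (Finset.sum_le_sum fun i _ => hbound i).trans ?_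
  rw [← ENNReal.ofReal_sum_of_nonneg fun i _ => add_nonneg (t i) (by split_ifs <;> simp)]
  refine ENNReal.ofReal_le_ofReal ?_
  rw [Finset.sum_add_distrib, Finset.sum_add_distrib, ← Finset.mul_sum, ← Finset.sum_div,
    ← Finset.mul_sum]
  refine add_le_add (add_le_add ?_ ?_) ?_
  · exact mul_le_of_le_one_right hD0.le hm1
  · rw [div_le_iff₀ hlp]
    exact mul_le_mul_of_nonneg_left hcl (by positivity)
  · rw [Finset.sum_ite, Finset.sum_const_zero, add_zero, Finset.sum_const, nsmul_eq_mul, mul_one]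
    have : (Finset.univ.filter bad).card ≤ 1 := Finset.card_le_one.2 fun i hi j hj =>
      hbad i j (Finset.mem_filter.1 hi).2 (Finset.mem_filter.1 hj).2
    exact_mod_cast this

/-- The lower `p`-estimate. -/
theorem sum_norm_rpow_le {ι : Type*} [Fintype ι] {u : ι → OrliczSpace (h.orlicz η)}
    (hdisj : ∀ n i j, i ≠ j → (u i).seq n = 0 ∨ (u j).seq n = 0) :
    ∑ i, ‖u i‖ ^ p ≤ h.growthConst * 2 ^ p * ‖∑ i, u i‖ ^ p := by
  classical
  have hp : 0 < p := by linarith [h.one_lt_p]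
  have hC := h.growthConst_pos
  have hle : ∀ i, ‖u i‖ ≤ ‖∑ i, u i‖ := fun i => h.norm_le_norm_of_abs_le fun n => by
    rw [OrliczSpace.seq_sum]
    by_cases hz : (u i).seq n = 0
    · rw [hz, abs_zero]
      exact abs_nonneg _
    · rw [Fintype.sum_eq_single i fun j hj => (hdisj n j i hj).resolve_right hz]
  have key : ∀ l, ‖∑ i, u i‖ < l → ∑ i, ‖u i‖ ^ p ≤ h.growthConst * 2 ^ p * l ^ p := by
    intro l hl
    have hl0 : 0 < l := (norm_nonneg _).trans_lt hl
    have h1 := h.orliczModular_le_one_of_norm_lt hl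
    have e : (fun n => (∑ i, u i).seq n / l) = fun n => ∑ i, (u i).seq n / l := by
      funext n
      rw [OrliczSpace.seq_sum, Finset.sum_div]
    rw [e, orliczModular_sum fun n i j hij => by
      rcases hdisj n i j hij with h0 | h0 <;> simp [h0]] at h1
    -- Otherwise rescaling from `l` to `‖u i‖ / 2` would give a modular at most `1`, hence `‖u i‖ ≤
    -- ‖u i‖ / 2`.
    have h2 : ∀ i, ENNReal.ofReal ((‖u i‖ / 2 / l) ^ p / h.growthConst) ≤
        orliczModular (patternFun τ r p η) (fun n => (u i).seq n / l) := by
      intro i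
      rcases (norm_nonneg (u i)).eq_or_lt with h0 | h0
      · rw [← h0]
        simp [Real.zero_rpow hp.ne']
      by_contra! hlt
      have hs0 : 0 < ‖u i‖ / 2 / l := by positivity
      have := h.orliczModular_le_of_scale (η := η) (b := fun n => (u i).seq n / (‖u i‖ / 2))
        (s := ‖u i‖ / 2 / l) hs0 (by rw [div_le_one hl0]; linarith [hle i])
        (x := (‖u i‖ / 2 / l) ^ p / h.growthConst) (by
          have e : (fun n => ‖u i‖ / 2 / l * ((u i).seq n / (‖u i‖ / 2))) =
              fun n => (u i).seq n / l := by
            funext n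
            field_simp
          rw [e]
          exact hlt.le)
      rw [mul_div_cancel₀ _ hC.ne', div_self (Real.rpow_pos_of_pos hs0 _).ne',
        ENNReal.ofReal_one] at this
      linarith [h.norm_le_of_orliczModular_le_one (half_pos h0) this]
    have h3 := (Finset.sum_le_sum fun i _ => h2 i).trans h1
    rw [← ENNReal.ofReal_sum_of_nonneg fun i _ => by positivity, ENNReal.ofReal_le_one,
      ← Finset.sum_div, div_le_one hC] at h3
    have e2 : ∀ i, (‖u i‖ / 2 / l) ^ p = ‖u i‖ ^ p / (2 ^ p * l ^ p) := fun i => by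
      rw [div_div, Real.div_rpow (norm_nonneg _) (by positivity),
        Real.mul_rpow (by norm_num) hl0.le]
    simp only [e2] at h3
    rw [← Finset.sum_div, div_le_iff₀ (by positivity)] at h3
    linarith
  have ht : Tendsto (fun l : ℝ => h.growthConst * 2 ^ p * l ^ p) (𝓝[>] ‖∑ i, u i‖)
      (𝓝 (h.growthConst * 2 ^ p * ‖∑ i, u i‖ ^ p)) :=
    (((Real.continuous_rpow_const hp.le).tendsto _).const_mul _).mono_left nhdsWithin_le_nhds
  exact ge_of_tendsto ht (by filter_upwards [self_mem_nhdsWithin] with l hl using key l hl)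

end AdmissibleParams

/-! ### Finitely supported sequences in `ℓ_M` -/

namespace AdmissibleParams

variable {τ r p : ℝ} (h : AdmissibleParams τ r p)

theorem orliczModular_finsupp_ne_top (M : ℝ → ℝ) (hM : M 0 = 0) (a : ℕ →₀ ℝ) :
    orliczModular M a ≠ ⊤ := by
  rw [orliczModular, tsum_eq_sum (s := a.support) fun n hn => by
    rw [Finsupp.notMem_support_iff.1 hn, abs_zero, hM, ENNReal.ofReal_zero]]
  exact ENNReal.sum_ne_top.2 fun n _ => ENNReal.ofReal_ne_top

/-- The finitely supported sequences as elements of `ℓ_M`. -/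
def ofFinsupp (η : ℕ → Fin 2) : (ℕ →₀ ℝ) →ₗ[ℝ] OrliczSpace (h.orlicz η) where
  toFun a := h.ofSeq η a (orliczModular_finsupp_ne_top _ patternFun_zero a)
  map_add' a b := OrliczSpace.ext_seq fun n => by simp
  map_smul' c a := OrliczSpace.ext_seq fun n => by simp [OrliczSpace.seq_smul]

@[simp] theorem seq_ofFinsupp (η : ℕ → Fin 2) (a : ℕ →₀ ℝ) (n : ℕ) :
    (h.ofFinsupp η a).seq n = a n := rfl

end AdmissibleParams

namespace PatternOrliczSum

variable {J : Type*} {τ r p : ℝ} {h : AdmissibleParams τ r p} {ρ : J → ℕ → Fin 2}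

/-! ### Components and coordinates -/

/-- The `f`-th component of an element of the `ℓ_p`-sum. -/
def comp (f : J) : PatternOrliczSum h ρ →ₗ[ℝ] OrliczSpace (h.orlicz (ρ f)) where
  toFun x := (show lp (fun j : J => OrliczSpace (h.orlicz (ρ j))) (ENNReal.ofReal p) from x) f
  map_add' _ _ := rfl
  map_smul' _ _ := rfl

/-- The `n`-th coordinate of the `f`-th component. -/
def coordinate (f : J) (n : ℕ) (x : PatternOrliczSum h ρ) : ℝ := (comp f x).seq n

@[simp] theorem coordinate_add (f : J) (n : ℕ) (x y : PatternOrliczSum h ρ) :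
    coordinate f n (x + y) = coordinate f n x + coordinate f n y := rfl

@[simp] theorem coordinate_sub (f : J) (n : ℕ) (x y : PatternOrliczSum h ρ) :
    coordinate f n (x - y) = coordinate f n x - coordinate f n y := rfl

@[simp] theorem coordinate_smul (f : J) (n : ℕ) (c : ℝ) (x : PatternOrliczSum h ρ) :
    coordinate f n (c • x) = c * coordinate f n x := rfl

theorem coordinate_sum {ι : Type*} (s : Finset ι) (w : ι → PatternOrliczSum h ρ) (f : J) (n : ℕ) :
    coordinate f n (∑ i ∈ s, w i) = ∑ i ∈ s, coordinate f n (w i) := by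
  rw [coordinate, map_sum, OrliczSpace.seq_sum]
  rfl

theorem ext_comp {x y : PatternOrliczSum h ρ} (hxy : ∀ f, comp f x = comp f y) : x = y :=
  lp.ext (E := fun j : J => OrliczSpace (h.orlicz (ρ j))) (p := ENNReal.ofReal p) (funext hxy)

theorem ext_coordinate {x y : PatternOrliczSum h ρ}
    (hxy : ∀ f n, coordinate f n x = coordinate f n y) : x = y :=
  ext_comp fun f => OrliczSpace.ext_seq (hxy f)

theorem toReal_exponent (h : AdmissibleParams τ r p) : (ENNReal.ofReal p).toReal = p :=
  ENNReal.toReal_ofReal (by linarith [h.one_lt_p])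

theorem exponent_pos (h : AdmissibleParams τ r p) : 0 < p := by linarith [h.one_lt_p]

theorem norm_comp_le (f : J) (x : PatternOrliczSum h ρ) : ‖comp f x‖ ≤ ‖x‖ :=
  lp.norm_apply_le_norm (E := fun j : J => OrliczSpace (h.orlicz (ρ j))) (p := ENNReal.ofReal p)
    (ENNReal.ofReal_pos.2 (exponent_pos h)).ne' x f

theorem abs_coordinate_le (f : J) (n : ℕ) (x : PatternOrliczSum h ρ) :
    |coordinate f n x| ≤ ‖x‖ :=
  (OrliczSpace.abs_le_norm _ n).trans (norm_comp_le f x)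

theorem hasSum_norm_comp_rpow (x : PatternOrliczSum h ρ) :
    HasSum (fun f => ‖comp f x‖ ^ p) (‖x‖ ^ p) := by
  have := lp.hasSum_norm (E := fun j : J => OrliczSpace (h.orlicz (ρ j)))
    (p := ENNReal.ofReal p) (by rw [toReal_exponent h]; exact exponent_pos h) x
  rwa [toReal_exponent h] at this

theorem sum_norm_comp_rpow_le (s : Finset J) (x : PatternOrliczSum h ρ) :
    ∑ f ∈ s, ‖comp f x‖ ^ p ≤ ‖x‖ ^ p :=
  sum_le_hasSum s (fun _ _ => Real.rpow_nonneg (norm_nonneg _) _) (hasSum_norm_comp_rpow x)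

theorem norm_le_of_forall_sum_le {x : PatternOrliczSum h ρ} {C : ℝ} (hC : 0 ≤ C)
    (hx : ∀ s : Finset J, ∑ f ∈ s, ‖comp f x‖ ^ p ≤ C ^ p) : ‖x‖ ≤ C :=
  (Real.rpow_le_rpow_iff (norm_nonneg _) hC (exponent_pos h)).1
    (le_of_tendsto' (hasSum_norm_comp_rpow x) hx)

theorem exists_comp_eq (z : ∀ f, OrliczSpace (h.orlicz (ρ f))) {C : ℝ}
    (hz : ∀ s : Finset J, ∑ f ∈ s, ‖z f‖ ^ p ≤ C) :
    ∃ x : PatternOrliczSum h ρ, ∀ f, comp f x = z f :=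
  ⟨(⟨z, memℓp_gen' (C := C) (by rwa [toReal_exponent h])⟩ :
    lp (fun j : J => OrliczSpace (h.orlicz (ρ j))) (ENNReal.ofReal p)), fun _ => rfl⟩

theorem norm_le_norm_of_abs_le {x y : PatternOrliczSum h ρ}
    (hxy : ∀ f n, |coordinate f n x| ≤ |coordinate f n y|) : ‖x‖ ≤ ‖y‖ :=
  norm_le_of_forall_sum_le (norm_nonneg _) fun s =>
    (Finset.sum_le_sum fun f _ => Real.rpow_le_rpow (norm_nonneg _)
      (h.norm_le_norm_of_abs_le (hxy f)) (exponent_pos h).le).trans (sum_norm_comp_rpow_le s y)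

theorem norm_comp_le_norm_comp_of_abs_le {x y : PatternOrliczSum h ρ} {f : J}
    (hxy : ∀ n, |coordinate f n x| ≤ |coordinate f n y|) : ‖comp f x‖ ≤ ‖comp f y‖ :=
  h.norm_le_norm_of_abs_le hxy

/-! ### Restriction to sets of coordinates -/

/-- Restriction to a set of coordinates. -/
def restrict (A : Set (J × ℕ)) : PatternOrliczSum h ρ →L[ℝ] PatternOrliczSum h ρ :=
  have hex : ∀ x : PatternOrliczSum h ρ, ∃ y : PatternOrliczSum h ρ,
      ∀ f, comp f y = h.seqRestrict (ρ f) {n | (f, n) ∈ A} (comp f x) := fun x =>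
    exists_comp_eq _ (C := ‖x‖ ^ p) fun s =>
      (Finset.sum_le_sum fun f _ => Real.rpow_le_rpow (norm_nonneg _)
        (h.norm_seqRestrict_le _ _) (exponent_pos h).le).trans (sum_norm_comp_rpow_le s x)
  LinearMap.mkContinuous
    { toFun := fun x => (hex x).choose
      map_add' := fun x y => ext_comp fun f => by
        rw [map_add, (hex x).choose_spec, (hex y).choose_spec, (hex _).choose_spec, map_add, map_add]
      map_smul' := fun c x => ext_comp fun f => by
        rw [map_smul, (hex x).choose_spec, (hex _).choose_spec, map_smul, map_smul]
        rfl }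
    1 fun x => by
      rw [one_mul]
      refine norm_le_of_forall_sum_le (norm_nonneg _) fun s => ?_
      refine (Finset.sum_le_sum fun f _ => Real.rpow_le_rpow (norm_nonneg _) ?_
        (exponent_pos h).le).trans (sum_norm_comp_rpow_le s x)
      change ‖comp f (hex x).choose‖ ≤ _
      rw [(hex x).choose_spec]
      exact h.norm_seqRestrict_le _ _

theorem comp_restrict (A : Set (J × ℕ)) (x : PatternOrliczSum h ρ) (f : J) :
    comp f (restrict A x) = h.seqRestrict (ρ f) {n | (f, n) ∈ A} (comp f x) :=
  Exists.choose_spec (p := fun y : PatternOrliczSum h ρ =>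
    ∀ f, comp f y = h.seqRestrict (ρ f) {n | (f, n) ∈ A} (comp f x)) _ f

open Classical in
theorem coordinate_restrict (A : Set (J × ℕ)) (x : PatternOrliczSum h ρ) (f : J) (n : ℕ) :
    coordinate f n (restrict A x) = if (f, n) ∈ A then coordinate f n x else 0 := by
  rw [coordinate, comp_restrict, AdmissibleParams.seq_seqRestrict]
  rfl

theorem abs_coordinate_restrict_le (A : Set (J × ℕ)) (x : PatternOrliczSum h ρ) (f : J) (n : ℕ) :
    |coordinate f n (restrict A x)| ≤ |coordinate f n x| := by
  rw [coordinate_restrict]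
  split_ifs <;> simp

theorem norm_restrict_le (A : Set (J × ℕ)) (x : PatternOrliczSum h ρ) : ‖restrict A x‖ ≤ ‖x‖ :=
  norm_le_norm_of_abs_le (abs_coordinate_restrict_le A x)

theorem norm_restrict_mono {A B : Set (J × ℕ)} (hAB : A ⊆ B) (x : PatternOrliczSum h ρ) :
    ‖restrict A x‖ ≤ ‖restrict B x‖ := by
  refine norm_le_norm_of_abs_le fun f n => ?_
  rw [coordinate_restrict, coordinate_restrict]
  by_cases hA : (f, n) ∈ A
  · rw [if_pos hA, if_pos (hAB hA)]
  · rw [if_neg hA, abs_zero]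
    exact abs_nonneg _

theorem restrict_add_restrict_compl (A : Set (J × ℕ)) (x : PatternOrliczSum h ρ) :
    restrict A x + restrict Aᶜ x = x := by
  refine ext_coordinate fun f n => ?_
  simp only [coordinate_add, coordinate_restrict, mem_compl_iff]
  split_ifs <;> simp_all

theorem norm_restrict_union_le (A B : Set (J × ℕ)) (x : PatternOrliczSum h ρ) :
    ‖restrict (A ∪ B) x‖ ≤ ‖restrict A x‖ + ‖restrict B x‖ := by
  have e : restrict (A ∪ B) x = restrict A x + restrict (B \ A) x := by
    refine ext_coordinate fun f n => ?_
    simp only [coordinate_add, coordinate_restrict, mem_union, Set.mem_sdiff]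
    split_ifs <;> simp_all
  rw [e]
  exact (norm_add_le _ _).trans (add_le_add_right (norm_restrict_mono sdiff_subset x) _)

theorem exists_finset_norm_restrict_compl_le (x : PatternOrliczSum h ρ) {ε : ℝ} (hε : 0 < ε) :
    ∃ A : Finset (J × ℕ), ‖restrict (A : Set (J × ℕ))ᶜ x‖ ≤ ε := by
  classical
  have hp := exponent_pos h
  have hεp : 0 < ε ^ p := Real.rpow_pos_of_pos hε _
  obtain ⟨s, hs⟩ := (summable_iff_vanishing_norm.1 (hasSum_norm_comp_rpow x).summable)
    (ε ^ p / 2) (by positivity)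
  -- Half of `ε ^ p` is shared among the components in `s`, the other half bounds all components
  -- outside `s`; the `+ 1` avoids division by zero.
  set d : ℝ := ε ^ p / (2 * (s.card + 1)) with hd
  have hd0 : 0 < d := by positivity
  choose N hN using fun f => h.exists_norm_tail_le (comp f x)
    (Real.rpow_pos_of_pos hd0 p⁻¹)
  refine ⟨s.biUnion fun f => (Finset.range (N f)).image fun n => (f, n), ?_⟩
  set A := s.biUnion fun f => (Finset.range (N f)).image fun n => (f, n) with hA
  have hmem : ∀ f n, (f, n) ∈ A ↔ f ∈ s ∧ n < N f := by
    intro f n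
    simp only [hA, Finset.mem_biUnion, Finset.mem_image, Finset.mem_range, Prod.mk.injEq]
    constructor
    · rintro ⟨f', hf', n', hn', rfl, rfl⟩
      exact ⟨hf', hn'⟩
    · rintro ⟨hf, hn⟩
      exact ⟨f, hf, n, hn, rfl, rfl⟩
  refine norm_le_of_forall_sum_le hε.le fun t => ?_
  rw [← Finset.sum_inter_add_sum_sdiff t s]
  have h1 : ∑ f ∈ t ∩ s, ‖comp f (restrict (A : Set (J × ℕ))ᶜ x)‖ ^ p ≤ ε ^ p / 2 := by
    calc ∑ f ∈ t ∩ s, ‖comp f (restrict (A : Set (J × ℕ))ᶜ x)‖ ^ p ≤ ∑ f ∈ t ∩ s, d := by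
          refine Finset.sum_le_sum fun f hf => ?_
          have hle : ‖comp f (restrict (A : Set (J × ℕ))ᶜ x)‖ ≤ d ^ p⁻¹ := by
            refine le_trans (le_of_eq ?_) (hN f)
            rw [comp_restrict]
            congr 3
            ext n
            have := hmem f n
            simp only [mem_compl_iff, Finset.mem_coe, mem_ofPred_eq]
            rw [this, not_and, not_lt]
            exact ⟨fun h => h (Finset.mem_inter.1 hf).2, fun h _ => h⟩
          calc _ ≤ (d ^ p⁻¹) ^ p := Real.rpow_le_rpow (norm_nonneg _) hle hp.le
            _ = d := Real.rpow_inv_rpow hd0.le hp.ne'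
      _ = (t ∩ s).card * d := by rw [Finset.sum_const, nsmul_eq_mul]
      _ ≤ (s.card + 1) * d := by
          refine mul_le_mul_of_nonneg_right ?_ hd0.le
          have : (t ∩ s).card ≤ s.card := Finset.card_le_card Finset.inter_subset_right
          have : ((t ∩ s).card : ℝ) ≤ s.card := by exact_mod_cast this
          linarith
      _ = ε ^ p / 2 := by rw [hd]; field_simp
  have h2 : ∑ f ∈ t \ s, ‖comp f (restrict (A : Set (J × ℕ))ᶜ x)‖ ^ p ≤ ε ^ p / 2 := by
    have := hs (t \ s) Finset.sdiff_disjoint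
    rw [Real.norm_eq_abs] at this
    refine le_trans (Finset.sum_le_sum fun f _ => Real.rpow_le_rpow (norm_nonneg _) ?_ hp.le)
      ((le_abs_self _).trans this.le)
    exact norm_comp_le_norm_comp_of_abs_le fun n => abs_coordinate_restrict_le _ x f n
  linarith

/-! ### Unit vectors -/

open Classical in
/-- The embedding of a component. -/
def incl (f : J) : OrliczSpace (h.orlicz (ρ f)) →ₗ[ℝ] PatternOrliczSum h ρ where
  toFun a := lp.single (E := fun j : J => OrliczSpace (h.orlicz (ρ j))) (ENNReal.ofReal p) f a
  map_add' a b := lp.single_add (E := fun j : J => OrliczSpace (h.orlicz (ρ j))) (ENNReal.ofReal p) f a b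
  map_smul' c a := by
    refine lp.ext (E := fun j : J => OrliczSpace (h.orlicz (ρ j))) (funext fun g => ?_)
    change _ = c • (lp.single (E := fun j : J => OrliczSpace (h.orlicz (ρ j))) (ENNReal.ofReal p) f a) g
    rw [lp.coeFn_single, lp.coeFn_single, Pi.single_smul]
    rfl

open Classical in
theorem norm_incl (f : J) (a : OrliczSpace (h.orlicz (ρ f))) :
    ‖(incl f a : PatternOrliczSum h ρ)‖ = ‖a‖ :=
  lp.norm_single (E := fun j : J => OrliczSpace (h.orlicz (ρ j)))
    (ENNReal.ofReal_pos.2 (exponent_pos h)) f a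

@[simp] theorem comp_incl_self (f : J) (a : OrliczSpace (h.orlicz (ρ f))) :
    comp f (incl f a : PatternOrliczSum h ρ) = a := by
  classical
  exact lp.single_apply_self (E := fun j : J => OrliczSpace (h.orlicz (ρ j))) (ENNReal.ofReal p) f a

theorem comp_incl_of_ne {f g : J} (hfg : g ≠ f) (a : OrliczSpace (h.orlicz (ρ f))) :
    comp g (incl f a : PatternOrliczSum h ρ) = 0 := by
  classical
  exact lp.single_apply_ne (E := fun j : J => OrliczSpace (h.orlicz (ρ j))) (ENNReal.ofReal p) f a hfg

/-- The finitely supported sequences in the `f`-th component. -/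
def inclFinsupp (f : J) : (ℕ →₀ ℝ) →ₗ[ℝ] PatternOrliczSum h ρ :=
  (incl f).comp (h.ofFinsupp (ρ f))

theorem norm_inclFinsupp (f : J) (a : ℕ →₀ ℝ) :
    ‖(inclFinsupp f a : PatternOrliczSum h ρ)‖ = ‖h.ofFinsupp (ρ f) a‖ := norm_incl f _

open Classical in
theorem coordinate_inclFinsupp (f g : J) (a : ℕ →₀ ℝ) (n : ℕ) :
    coordinate g n (inclFinsupp f a : PatternOrliczSum h ρ) = if g = f then a n else 0 := by
  split_ifs with hg
  · subst hg
    rw [coordinate, inclFinsupp, LinearMap.comp_apply, comp_incl_self, AdmissibleParams.seq_ofFinsupp]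
  · rw [coordinate, inclFinsupp, LinearMap.comp_apply, comp_incl_of_ne hg, OrliczSpace.seq_zero]

/-- The unit vectors. -/
def unitVector (f : J) (m : ℕ) : PatternOrliczSum h ρ := inclFinsupp f (Finsupp.single m 1)

open Classical in
theorem coordinate_unitVector (f g : J) (m n : ℕ) :
    coordinate g n (unitVector f m : PatternOrliczSum h ρ) = if g = f ∧ n = m then 1 else 0 := by
  rw [unitVector, coordinate_inclFinsupp, Finsupp.single_apply]
  split_ifs <;> simp_all

theorem restrict_finset_eq_sum (A : Finset (J × ℕ)) (x : PatternOrliczSum h ρ) :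
    restrict (A : Set (J × ℕ)) x = ∑ i ∈ A, coordinate i.1 i.2 x • unitVector i.1 i.2 := by
  classical
  refine ext_coordinate fun f n => ?_
  rw [coordinate_restrict, coordinate_sum]
  simp only [coordinate_smul, coordinate_unitVector, mul_ite, mul_one, mul_zero, Finset.mem_coe]
  have e : ∀ i : J × ℕ, (f = i.1 ∧ n = i.2) ↔ i = (f, n) := fun i => by
    rw [Prod.ext_iff, eq_comm, @eq_comm _ n]
  simp only [e]
  rw [Finset.sum_ite_eq']

theorem tendsto_norm_restrict_finset {ι : Type*} {l : Filter ι} {x : ι → PatternOrliczSum h ρ}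
    (hx : ∀ f n, Tendsto (fun i => coordinate f n (x i)) l (𝓝 0)) (A : Finset (J × ℕ)) :
    Tendsto (fun i => ‖restrict (A : Set (J × ℕ)) (x i)‖) l (𝓝 0) := by
  have h1 : Tendsto (fun i => ∑ j ∈ A, |coordinate j.1 j.2 (x i)| *
      ‖(unitVector j.1 j.2 : PatternOrliczSum h ρ)‖) l (𝓝 0) := by
    have := tendsto_finsetSum A fun j _ => ((hx j.1 j.2).abs.mul_const
      ‖(unitVector j.1 j.2 : PatternOrliczSum h ρ)‖)
    simpa using this
  refine squeeze_zero (fun _ => norm_nonneg _) (fun i => ?_) h1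
  rw [restrict_finset_eq_sum]
  refine (norm_sum_le _ _).trans (Finset.sum_le_sum fun j _ => ?_)
  rw [norm_smul, Real.norm_eq_abs]

/-! ### Estimates for sums of disjoint vectors -/

/-- The vectors have pairwise disjoint supports. -/
def DisjointSupports {ι : Type*} (w : ι → PatternOrliczSum h ρ) : Prop :=
  ∀ f n i j, i ≠ j → coordinate f n (w i) = 0 ∨ coordinate f n (w j) = 0

/-- The constant in the upper estimate. -/
def upperConst (h : AdmissibleParams τ r p) (D : ℝ) : ℝ := (D + h.growthConst * D + 1) * (2 * D)

/-- In component `f` let `l` decrease to `(∑ i, c i f ^ p * m i) ^ p⁻¹`. The `p`-th powers are then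
summed over `f`, and exchanging the sums leaves `∑ i, m i ≤ 1`. The masses must be common to all
components, while the exceptional index may depend on `f`. -/
theorem norm_sum_le_upperConst {ι : Type*} [Fintype ι] {w : ι → PatternOrliczSum h ρ}
    (hw : DisjointSupports w) {a m : ι → ℝ} {c : ι → J → ℝ} {D : ℝ}
    (hD : 1 ≤ D) (hm : ∀ i, 0 ≤ m i) (hm1 : ∑ i, m i ≤ 1) (hwc : ∀ i f, ‖comp f (w i)‖ ≤ c i f)
    (hc : ∀ i, ∀ s : Finset J, ∑ f ∈ s, c i f ^ p ≤ 1)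
    (ha : ∀ i, |a i| ^ p ≤ D * m i) {bad : J → ι → Prop}
    (hbad : ∀ f i j, bad f i → bad f j → i = j)
    (hgood : ∀ f i, ¬bad f i → 0 < c i f → orliczModular (patternFun τ r p (ρ f))
      (fun n => a i * coordinate f n (w i) / (2 * c i f)) ≤ ENNReal.ofReal (D * m i)) :
    ‖∑ i, a i • w i‖ ≤ upperConst h D := by
  have hp := exponent_pos h
  have hC := h.growthConst_pos
  have hK : 0 < upperConst h D := by unfold upperConst; positivity
  have hc0 : ∀ i f, 0 ≤ c i f := fun i f => (norm_nonneg _).trans (hwc i f)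
  have hL : ∀ f, 0 ≤ ∑ i, c i f ^ p * m i := fun f =>
    Finset.sum_nonneg fun i _ => mul_nonneg (Real.rpow_nonneg (hc0 i f) _) (hm i)
  have key : ∀ f, ‖comp f (∑ i, a i • w i)‖ ^ p ≤ upperConst h D ^ p * ∑ i, c i f ^ p * m i := by
    intro f
    have h1 : ∀ l, (∑ i, c i f ^ p * m i) ^ p⁻¹ < l →
        ‖comp f (∑ i, a i • w i)‖ / upperConst h D ≤ l := by
      intro l hl
      have hl0 : 0 < l := (Real.rpow_nonneg (hL f) _).trans_lt hl
      rw [div_le_iff₀ hK, map_sum]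
      simp only [map_smul]
      refine (h.norm_sum_le_of_orliczModular_le (u := fun i => comp f (w i)) (c := fun i => c i f)
        (fun n i j hij => hw f n i j hij) hD hm hm1 (fun i => hwc i f) ha (hbad f) (hgood f) hl0
        ?_).trans (le_of_eq ?_)
      · have := Real.rpow_le_rpow (Real.rpow_nonneg (hL f) _) hl.le hp.le
        rwa [Real.rpow_inv_rpow (hL f) hp.ne'] at this
      · unfold upperConst
        ring
    have h2 := le_of_forall_gt_imp_ge_of_dense h1
    rw [div_le_iff₀ hK] at h2
    calc _ ≤ ((∑ i, c i f ^ p * m i) ^ p⁻¹ * upperConst h D) ^ p :=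
          Real.rpow_le_rpow (norm_nonneg _) h2 hp.le
      _ = _ := by
        rw [Real.mul_rpow (Real.rpow_nonneg (hL f) _) hK.le, Real.rpow_inv_rpow (hL f) hp.ne',
          mul_comm]
  refine norm_le_of_forall_sum_le hK.le fun s => ?_
  calc ∑ f ∈ s, ‖comp f (∑ i, a i • w i)‖ ^ p
      ≤ ∑ f ∈ s, upperConst h D ^ p * ∑ i, c i f ^ p * m i := Finset.sum_le_sum fun f _ => key f
    _ = upperConst h D ^ p * ∑ i, (∑ f ∈ s, c i f ^ p) * m i := by
        rw [← Finset.mul_sum, Finset.sum_comm]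
        simp only [Finset.sum_mul]
    _ ≤ upperConst h D ^ p * 1 := by
        refine mul_le_mul_of_nonneg_left (le_trans (Finset.sum_le_sum fun i _ => ?_) hm1)
          (Real.rpow_nonneg hK.le _)
        exact mul_le_of_le_one_left (hm i) (hc i s)
    _ = _ := mul_one _

theorem sum_norm_rpow_le {ι : Type*} [Fintype ι] {w : ι → PatternOrliczSum h ρ}
    (hw : DisjointSupports w) :
    ∑ i, ‖w i‖ ^ p ≤ h.growthConst * 2 ^ p * ‖∑ i, w i‖ ^ p := by
  have hC := h.growthConst_pos
  have ht : Tendsto (fun s : Finset J => ∑ i, ∑ f ∈ s, ‖comp f (w i)‖ ^ p) atTop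
      (𝓝 (∑ i, ‖w i‖ ^ p)) :=
    tendsto_finsetSum _ fun i _ => hasSum_norm_comp_rpow (w i)
  refine le_of_tendsto' ht fun s => ?_
  rw [Finset.sum_comm]
  calc ∑ f ∈ s, ∑ i, ‖comp f (w i)‖ ^ p
      ≤ ∑ f ∈ s, h.growthConst * 2 ^ p * ‖comp f (∑ i, w i)‖ ^ p := by
        refine Finset.sum_le_sum fun f _ => ?_
        rw [map_sum]
        exact h.sum_norm_rpow_le fun n i j hij => hw f n i j hij
    _ = h.growthConst * 2 ^ p * ∑ f ∈ s, ‖comp f (∑ i, w i)‖ ^ p := by rw [Finset.mul_sum]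
    _ ≤ _ := mul_le_mul_of_nonneg_left (sum_norm_comp_rpow_le s _) (by positivity)

end PatternOrliczSum

namespace AdmissibleParams

variable {τ r p : ℝ} (h : AdmissibleParams τ r p) {η : ℕ → Fin 2}

theorem orliczModular_smul_le {u : OrliczSpace (h.orlicz η)} {a c x : ℝ} (hc : 0 < c)
    (huc : ‖u‖ ≤ c) (hx0 : 0 ≤ x)
    (hx : ∀ n, patternFun τ r p η (|a| * (|u.seq n| / (2 * c))) ≤
      x * patternFun τ r p η (|u.seq n| / (2 * c))) :
    orliczModular (patternFun τ r p η) (fun n => a * u.seq n / (2 * c)) ≤ ENNReal.ofReal x := by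
  -- The factor `2` makes the norm inequality strict, as the passage to modulars requires.
  have h1 := h.orliczModular_le_one_of_norm_lt (show ‖u‖ < 2 * c by linarith)
  have h2c : |2 * c| = 2 * c := abs_of_pos (by linarith)
  calc orliczModular (patternFun τ r p η) (fun n => a * u.seq n / (2 * c))
      ≤ ENNReal.ofReal x * orliczModular (patternFun τ r p η) (fun n => u.seq n / (2 * c)) := by
        rw [orliczModular, orliczModular, ← ENNReal.tsum_mul_left]
        refine ENNReal.tsum_le_tsum fun n => ?_
        rw [← ENNReal.ofReal_mul hx0, mul_div_assoc, abs_mul, abs_div, h2c]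
        exact ENNReal.ofReal_le_ofReal (hx n)
    _ ≤ ENNReal.ofReal x * 1 := mul_le_mul_right h1 _
    _ = _ := mul_one _

theorem div_two_mul_mem {u : OrliczSpace (h.orlicz η)} {c : ℝ} (hc : 0 < c) (huc : ‖u‖ ≤ c)
    (n : ℕ) : 0 ≤ |u.seq n| / (2 * c) ∧ |u.seq n| / (2 * c) ≤ 1 := by
  refine ⟨by positivity, (div_le_one (by positivity)).2 ?_⟩
  linarith [OrliczSpace.abs_le_norm u n]

theorem tendsto_norm_seqRestrict (a : OrliczSpace (h.orlicz η)) :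
    Tendsto (fun N : ℕ => ‖h.seqRestrict η {n | n < N} a‖) atTop (𝓝 ‖a‖) := by
  have hsub : ∀ N : ℕ, a = h.seqRestrict η {n | n < N} a + h.seqRestrict η {n | N ≤ n} a :=
    fun N => OrliczSpace.ext_seq fun n => by
      rw [OrliczSpace.seq_add, seq_seqRestrict, seq_seqRestrict]
      rcases lt_or_ge n N with hn | hn <;> simp [hn]
  rw [Metric.tendsto_atTop]
  intro ε hε
  obtain ⟨N, hN⟩ := h.exists_norm_tail_le a (half_pos hε)
  refine ⟨N, fun n hn => ?_⟩
  have h1 := h.norm_seqRestrict_le {m | m < n} a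
  have h2 : ‖h.seqRestrict η {m | n ≤ m} a‖ ≤ ‖h.seqRestrict η {m | N ≤ m} a‖ :=
    h.norm_le_norm_of_abs_le fun m => by
      rw [seq_seqRestrict, seq_seqRestrict]
      by_cases hm : n ≤ m
      · simp [hm, hn.trans hm]
      · rw [if_neg (by simpa using hm), abs_zero]
        exact abs_nonneg _
  have h3 : ‖a‖ ≤ ‖h.seqRestrict η {m | m < n} a‖ + ‖h.seqRestrict η {m | n ≤ m} a‖ := by
    conv_lhs => rw [hsub n]
    exact norm_add_le _ _
  rw [Real.dist_eq, abs_sub_lt_iff]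
  constructor <;> linarith

end AdmissibleParams

namespace PatternOrliczSum

variable {J : Type*} {τ r p : ℝ} {h : AdmissibleParams τ r p} {ρ : J → ℕ → Fin 2}

/-! ### Reflexivity -/

/-- An upper `r`-estimate: for `s = n ^ (-1/r)` one has `M (s * t) ≤ growthConst * s ^ r * M t` with
`s ^ r = 1 / n`, so with equal masses `1 / n` no index is exceptional. -/
theorem norm_sum_smul_le_of_disjoint {n : ℕ} (hn : 0 < n) {u : Fin n → PatternOrliczSum h ρ}
    (hu : DisjointSupports u) (hu1 : ∀ i, ‖u i‖ ≤ 1) :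
    ‖∑ i, ((n : ℝ) ^ (-r⁻¹)) • u i‖ ≤ upperConst h h.growthConst := by
  have hn1 : (1 : ℝ) ≤ n := by exact_mod_cast hn
  have hn0 : (0 : ℝ) < n := by exact_mod_cast hn
  have hr0 : 0 < r := by linarith [h.one_lt_r]
  have hC := h.growthConst_pos
  have hs0 : 0 ≤ (n : ℝ) ^ (-r⁻¹) := Real.rpow_nonneg hn0.le _
  have hs1 : (n : ℝ) ^ (-r⁻¹) ≤ 1 :=
    Real.rpow_le_one_of_one_le_of_nonpos hn1 (neg_nonpos.2 (inv_nonneg.2 hr0.le))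
  have hsr : ((n : ℝ) ^ (-r⁻¹)) ^ r = (n : ℝ)⁻¹ := by
    rw [← Real.rpow_mul hn0.le, neg_mul, inv_mul_cancel₀ hr0.ne', Real.rpow_neg_one]
  refine norm_sum_le_upperConst hu (m := fun _ => (n : ℝ)⁻¹) (c := fun i f => ‖comp f (u i)‖)
    (bad := fun _ _ => False) h.one_le_growthConst (fun _ => by positivity) ?_ (fun _ _ => le_rfl)
    (fun i s => (sum_norm_comp_rpow_le s (u i)).trans
      (Real.rpow_le_one (norm_nonneg _) (hu1 i) (exponent_pos h).le)) (fun i => ?_)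
    (fun _ _ _ hf => hf.elim) (fun f i _ hc => ?_)
  · simp [hn0.ne']
  · rw [abs_of_nonneg hs0]
    calc ((n : ℝ) ^ (-r⁻¹)) ^ p ≤ ((n : ℝ) ^ (-r⁻¹)) ^ r :=
          Real.rpow_le_rpow_of_exponent_ge (Real.rpow_pos_of_pos hn0 _) hs1 h.r_lt_p.le
      _ = (n : ℝ)⁻¹ := hsr
      _ ≤ _ := le_mul_of_one_le_left (by positivity) h.one_le_growthConst
  · refine h.orliczModular_smul_le (u := comp f (u i)) hc le_rfl (by positivity) fun m => ?_
    obtain ⟨h1, h2⟩ := h.div_two_mul_mem hc le_rfl m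
    rw [abs_of_nonneg hs0]
    refine (h.patternFun_mul_le_rpow hs0 hs1 h1 h2).trans (le_of_eq ?_)
    rw [hsr]
    ring

/-- The step of a gliding hump: a functional that is not small off `A` is large at a finitely
supported vector of the unit ball living off `A`. -/
theorem exists_block {φ : StrongDual ℝ (PatternOrliczSum h ρ)} {ε : ℝ} (hε : 0 < ε)
    (A : Finset (J × ℕ))
    (hA : ∃ x : PatternOrliczSum h ρ, ε * ‖x‖ < |φ (restrict (A : Set (J × ℕ))ᶜ x)|) :
    ∃ u : PatternOrliczSum h ρ, ∃ B : Finset (J × ℕ), ‖u‖ ≤ 1 ∧ ε / 2 ≤ φ u ∧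
      ∀ f n, coordinate f n u ≠ 0 → (f, n) ∈ B ∧ (f, n) ∉ A := by
  obtain ⟨x, hx⟩ := hA
  set y := restrict (A : Set (J × ℕ))ᶜ x with hy
  have hy0 : 0 < ‖y‖ := by
    refine norm_pos_iff.2 fun h0 => ?_
    rw [h0, map_zero, abs_zero] at hx
    exact (mul_nonneg hε.le (norm_nonneg x)).not_gt hx
  have hyx : ε * ‖y‖ < |φ y| :=
    (mul_le_mul_of_nonneg_left (norm_restrict_le _ x) hε.le).trans_lt hx
  obtain ⟨s, hs, hsφ⟩ : ∃ s : ℝ, |s| = 1 ∧ s * φ y = |φ y| := by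
    rcases le_total 0 (φ y) with h0 | h0
    · exact ⟨1, abs_one, by rw [one_mul, abs_of_nonneg h0]⟩
    · exact ⟨-1, by simp, by rw [neg_one_mul, abs_of_nonpos h0]⟩
  set v := (s / ‖y‖) • y with hv
  have hv1 : ‖v‖ ≤ 1 := by
    rw [hv, norm_smul, Real.norm_eq_abs, abs_div, hs, abs_of_pos hy0, one_div,
      inv_mul_cancel₀ hy0.ne']
  have hvφ : ε ≤ φ v := by
    rw [hv, map_smul, smul_eq_mul, div_mul_eq_mul_div, hsφ, le_div_iff₀ hy0]
    exact hyx.le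
  obtain ⟨B, hB⟩ := exists_finset_norm_restrict_compl_le v
    (show 0 < ε / (2 * (‖φ‖ + 1)) by positivity)
  refine ⟨restrict B v, B, (norm_restrict_le _ _).trans hv1, ?_, fun f n hfn => ?_⟩
  · have h1 : φ v = φ (restrict B v) + φ (restrict (B : Set (J × ℕ))ᶜ v) := by
      rw [← map_add, restrict_add_restrict_compl]
    have h2 : |φ (restrict (B : Set (J × ℕ))ᶜ v)| ≤ ε / 2 := by
      calc |φ (restrict (B : Set (J × ℕ))ᶜ v)| ≤ ‖φ‖ * ‖restrict (B : Set (J × ℕ))ᶜ v‖ :=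
            φ.le_opNorm _
        _ ≤ (‖φ‖ + 1) * (ε / (2 * (‖φ‖ + 1))) :=
            mul_le_mul (by linarith) hB (norm_nonneg _) (by positivity)
        _ = ε / 2 := by field_simp
    linarith [le_abs_self (φ (restrict (B : Set (J × ℕ))ᶜ v))]
  · rw [coordinate_restrict] at hfn
    have hB' : (f, n) ∈ B := by
      by_contra hcon
      rw [if_neg (by simpa using hcon)] at hfn
      exact hfn rfl
    refine ⟨hB', fun hcon => hfn ?_⟩
    rw [if_pos (by simpa using hB'), hv, coordinate_smul, hy, coordinate_restrict,
      if_neg (by simpa using hcon), mul_zero]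

/-- The unit vector basis is shrinking. -/
theorem exists_finset_abs_apply_le (φ : StrongDual ℝ (PatternOrliczSum h ρ)) {ε : ℝ} (hε : 0 < ε) :
    ∃ A : Finset (J × ℕ), ∀ x : PatternOrliczSum h ρ,
      |φ (restrict (A : Set (J × ℕ))ᶜ x)| ≤ ε * ‖x‖ := by
  classical
  by_contra! hcon
  choose u B hu1 huφ huB using fun A => exists_block hε A (hcon A)
  set S : ℕ → Finset (J × ℕ) := fun k => Nat.rec ∅ (fun _ A => A ∪ B A) k with hS
  have hSsucc : ∀ k, S (k + 1) = S k ∪ B (S k) := fun k => rfl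
  have hSmono : Monotone S := monotone_nat_of_le_succ fun k => by
    rw [hSsucc]
    exact Finset.subset_union_left
  have hdisj : ∀ i j : ℕ, i < j → ∀ f n, coordinate f n (u (S i)) = 0 ∨
      coordinate f n (u (S j)) = 0 := by
    intro i j hij f n
    by_contra! hne
    have h1 := (huB (S i) f n hne.1).1
    refine (huB (S j) f n hne.2).2 (hSmono (Nat.succ_le_of_lt hij) ?_)
    change (f, n) ∈ S (i + 1)
    rw [hSsucc]
    exact Finset.mem_union_right _ h1
  have hr0 : 0 < r := by linarith [h.one_lt_r]
  have hexp : 0 < 1 - r⁻¹ := by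
    have := inv_lt_one_of_one_lt₀ h.one_lt_r
    linarith
  -- The sum of `n` blocks with coefficients `n ^ (-1/r)` stays bounded, while `φ` takes on it at
  -- least the value `n ^ (1 - 1/r) * ε / 2`, which is unbounded because `r > 1`.
  have hbound : ∀ n : ℕ, 0 < n → (n : ℝ) ^ (1 - r⁻¹) ≤
      ‖φ‖ * upperConst h h.growthConst * (2 / ε) := by
    intro n hn
    have hn0 : (0 : ℝ) < n := by exact_mod_cast hn
    have h1 := norm_sum_smul_le_of_disjoint (h := h) (ρ := ρ) hn (u := fun i : Fin n => u (S i))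
      (fun f m i j hij => by
        rcases lt_or_gt_of_ne (fun e => hij (Fin.ext e)) with hlt | hlt
        · exact hdisj _ _ hlt f m
        · exact (hdisj _ _ hlt f m).symm) fun i => hu1 _
    have h2 : (n : ℝ) * ((n : ℝ) ^ (-r⁻¹) * (ε / 2)) ≤
        φ (∑ i : Fin n, ((n : ℝ) ^ (-r⁻¹)) • u (S i)) := by
      rw [map_sum]
      calc (n : ℝ) * ((n : ℝ) ^ (-r⁻¹) * (ε / 2))
          = ∑ i : Fin n, (n : ℝ) ^ (-r⁻¹) * (ε / 2) := by simp
        _ ≤ _ := Finset.sum_le_sum fun i _ => by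
            rw [map_smul, smul_eq_mul]
            exact mul_le_mul_of_nonneg_left (huφ _) (Real.rpow_nonneg hn0.le _)
    have h3 := (le_abs_self _).trans (φ.le_opNorm (∑ i : Fin n, ((n : ℝ) ^ (-r⁻¹)) • u (S i)))
    have h4 := mul_le_mul_of_nonneg_left h1 (norm_nonneg φ)
    have h5 : (n : ℝ) ^ (1 - r⁻¹) = n * (n : ℝ) ^ (-r⁻¹) := by
      rw [sub_eq_add_neg, Real.rpow_add hn0, Real.rpow_one]
    rw [h5, ← div_le_iff₀ (by positivity), div_div_eq_mul_div]
    linarith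
  have ht : Tendsto (fun n : ℕ => (n : ℝ) ^ (1 - r⁻¹)) atTop atTop :=
    (tendsto_rpow_atTop hexp).comp tendsto_natCast_atTop_atTop
  obtain ⟨n, hn0, hn⟩ := ((eventually_gt_atTop 0).and (ht.eventually_gt_atTop
    (‖φ‖ * upperConst h h.growthConst * (2 / ε)))).exists
  exact (hbound n hn0).not_gt hn

/-- The coordinate functionals. -/
def coordinateCLM (f : J) (n : ℕ) : StrongDual ℝ (PatternOrliczSum h ρ) :=
  LinearMap.mkContinuous
    { toFun := coordinate f n
      map_add' := coordinate_add f n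
      map_smul' := coordinate_smul f n } 1 fun x => by
    rw [one_mul]
    exact abs_coordinate_le f n x

@[simp] theorem coordinateCLM_apply (f : J) (n : ℕ) (x : PatternOrliczSum h ρ) :
    coordinateCLM f n x = coordinate f n x := rfl

theorem comp_restrict_finset_eq_sum (φ : StrongDual ℝ (PatternOrliczSum h ρ))
    (A : Finset (J × ℕ)) : φ.comp (restrict (A : Set (J × ℕ))) =
      ∑ i ∈ A, φ (unitVector i.1 i.2) • coordinateCLM i.1 i.2 := by
  ext x
  rw [ContinuousLinearMap.comp_apply, restrict_finset_eq_sum, map_sum]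
  simp [mul_comm]

/-- Applied to a norming functional `g`, the sum gives `Φ` of `g` composed with a restriction, and
restrictions are contractions. -/
theorem norm_bidual_sum_le (Φ : StrongDual ℝ (StrongDual ℝ (PatternOrliczSum h ρ)))
    (A : Finset (J × ℕ)) :
    ‖∑ i ∈ A, Φ (coordinateCLM i.1 i.2) • (unitVector i.1 i.2 : PatternOrliczSum h ρ)‖ ≤ ‖Φ‖ := by
  obtain ⟨g, hg1, hg2⟩ := exists_dual_vector'' ℝ
    (∑ i ∈ A, Φ (coordinateCLM i.1 i.2) • (unitVector i.1 i.2 : PatternOrliczSum h ρ))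
  have h1 : g (∑ i ∈ A, Φ (coordinateCLM i.1 i.2) • unitVector i.1 i.2) =
      Φ (g.comp (restrict (A : Set (J × ℕ)))) := by
    rw [comp_restrict_finset_eq_sum, map_sum, map_sum]
    simp [mul_comm]
  have h2 : ‖g.comp (restrict (A : Set (J × ℕ)))‖ ≤ 1 :=
    ContinuousLinearMap.opNorm_le_bound _ zero_le_one fun x => by
      refine (g.le_opNorm _).trans ?_
      exact mul_le_mul hg1 (norm_restrict_le _ x) (norm_nonneg _) zero_le_one
  calc _ = g (∑ i ∈ A, Φ (coordinateCLM i.1 i.2) • unitVector i.1 i.2) := hg2.symm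
    _ = Φ (g.comp (restrict (A : Set (J × ℕ)))) := h1
    _ ≤ ‖Φ‖ * ‖g.comp (restrict (A : Set (J × ℕ)))‖ :=
        (le_abs_self _).trans (Φ.le_opNorm _)
    _ ≤ ‖Φ‖ * 1 := mul_le_mul_of_nonneg_left h2 (ContinuousLinearMap.opNorm_nonneg Φ)
    _ = _ := mul_one _

open Classical in
theorem coordinate_sum_unitVector (A : Finset (J × ℕ)) (z : J → ℕ → ℝ) (f : J) (n : ℕ) :
    coordinate f n (∑ i ∈ A, z i.1 i.2 • (unitVector i.1 i.2 : PatternOrliczSum h ρ)) =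
      if (f, n) ∈ A then z f n else 0 := by
  rw [coordinate_sum]
  simp only [coordinate_smul, coordinate_unitVector, mul_ite, mul_one, mul_zero]
  have e : ∀ i : J × ℕ, (f = i.1 ∧ n = i.2) ↔ i = (f, n) := fun i => by
    rw [Prod.ext_iff, eq_comm, @eq_comm _ n]
  simp only [e]
  rw [Finset.sum_ite_eq']

/-- The unit vector basis is boundedly complete. -/
theorem exists_coordinate_eq {z : J → ℕ → ℝ} {C : ℝ} (hz : ∀ A : Finset (J × ℕ),
    ‖∑ i ∈ A, z i.1 i.2 • (unitVector i.1 i.2 : PatternOrliczSum h ρ)‖ ≤ C) :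
    ∃ x : PatternOrliczSum h ρ, ∀ f n, coordinate f n x = z f n := by
  classical
  have hC : 0 ≤ C := (norm_nonneg _).trans (hz ∅)
  have hR : 0 < C + 1 := by linarith
  have hfin : ∀ f, orliczModular (patternFun τ r p (ρ f)) (z f) ≠ ⊤ := by
    intro f
    -- Finite sections have norm at most `C < C + 1`, hence modular at most `1` at the scale `C +
    -- 1`; this passes to the infinite sum.
    have h1 : orliczModular (patternFun τ r p (ρ f)) (fun n => z f n / (C + 1)) ≤ 1 := by
      refine ENNReal.tsum_le_of_sum_range_le fun N => ?_
      set A : Finset (J × ℕ) := (Finset.range N).image fun n => (f, n) with hA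
      have h2 := h.orliczModular_le_one_of_norm_lt
        (((norm_comp_le f _).trans (hz A)).trans_lt (lt_add_one C))
      refine le_trans ?_ ((ENNReal.sum_le_tsum (Finset.range N)).trans h2)
      refine Finset.sum_le_sum fun n hn => le_of_eq ?_
      have h3 := coordinate_sum_unitVector (h := h) (ρ := ρ) A z f n
      rw [if_pos (Finset.mem_image.2 ⟨n, hn, rfl⟩), coordinate] at h3
      beta_reduce
      rw [h3]
    have h2 := h.orliczModular_div_ne_top (h1.trans_lt ENNReal.one_lt_top).ne (inv_pos.2 hR)
    have e : (fun n => z f n / (C + 1) / (C + 1)⁻¹) = z f := funext fun n => by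
      field_simp
    rwa [e] at h2
  obtain ⟨x, hx⟩ := exists_comp_eq (h := h) (ρ := ρ) (fun f => h.ofSeq (ρ f) (z f) (hfin f))
    (C := C ^ p) (by
      intro s
      have ht : Tendsto (fun N : ℕ => ∑ f ∈ s,
          ‖h.seqRestrict (ρ f) {n | n < N} (h.ofSeq (ρ f) (z f) (hfin f))‖ ^ p) atTop
          (𝓝 (∑ f ∈ s, ‖h.ofSeq (ρ f) (z f) (hfin f)‖ ^ p)) :=
        tendsto_finsetSum _ fun f _ => ((Real.continuous_rpow_const
          (exponent_pos h).le).tendsto _).comp (h.tendsto_norm_seqRestrict _)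
      refine le_of_tendsto' ht fun N => ?_
      refine le_trans (Finset.sum_le_sum fun f hf => le_of_eq ?_)
        ((sum_norm_comp_rpow_le s _).trans (Real.rpow_le_rpow (norm_nonneg _)
          (hz (s ×ˢ Finset.range N)) (exponent_pos h).le))
      congr 2
      refine OrliczSpace.ext_seq fun n => ?_
      have h3 := coordinate_sum_unitVector (h := h) (ρ := ρ) (s ×ˢ Finset.range N) z f n
      rw [coordinate] at h3
      rw [h3, AdmissibleParams.seq_seqRestrict, AdmissibleParams.seq_ofSeq]
      simp [hf])
  exact ⟨x, fun f n => by rw [coordinate, hx]; rfl⟩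

/-- James' argument. Bounded completeness turns the values of `Φ` on the coordinate functionals into
a vector `x`. The shrinking property approximates every `φ` by its restrictions to finitely many
coordinates, where `Φ` and `x` agree. -/
theorem isReflexiveSpace (h : AdmissibleParams τ r p) (ρ : J → ℕ → Fin 2) :
    IsReflexiveSpace (PatternOrliczSum h ρ) := by
  intro Φ
  obtain ⟨x, hx⟩ := exists_coordinate_eq (fun A => norm_bidual_sum_le Φ A)
    (z := fun f n => Φ (coordinateCLM f n))
  refine ⟨x, ContinuousLinearMap.ext fun φ => ?_⟩
  rw [NormedSpace.dual_def]
  refine eq_of_forall_dist_le fun ε hε => ?_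
  have hK : 0 < ‖Φ‖ + ‖x‖ + 1 := by positivity
  obtain ⟨A, hA⟩ := exists_finset_abs_apply_le φ (div_pos hε hK)
  have h1 : φ (restrict (A : Set (J × ℕ)) x) = Φ (φ.comp (restrict (A : Set (J × ℕ)))) := by
    rw [comp_restrict_finset_eq_sum, restrict_finset_eq_sum, map_sum, map_sum]
    simp [hx, mul_comm]
  have h2 : φ = φ.comp (restrict (A : Set (J × ℕ))) + φ.comp (restrict (A : Set (J × ℕ))ᶜ) := by
    ext y
    rw [add_apply, ContinuousLinearMap.comp_apply,
      ContinuousLinearMap.comp_apply, ← map_add, restrict_add_restrict_compl]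
  have h3 : φ x = φ (restrict (A : Set (J × ℕ)) x) + φ (restrict (A : Set (J × ℕ))ᶜ x) := by
    rw [← map_add, restrict_add_restrict_compl]
  have h4 : Φ φ = Φ (φ.comp (restrict (A : Set (J × ℕ)))) +
      Φ (φ.comp (restrict (A : Set (J × ℕ))ᶜ)) := by
    rw [← map_add, ← h2]
  have h5 : |Φ (φ.comp (restrict (A : Set (J × ℕ))ᶜ))| ≤ ‖Φ‖ * (ε / (‖Φ‖ + ‖x‖ + 1)) := by
    refine (Φ.le_opNorm _).trans (mul_le_mul_of_nonneg_left ?_ (norm_nonneg _))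
    exact ContinuousLinearMap.opNorm_le_bound _ (by positivity) hA
  have h6 := hA x
  rw [Real.dist_eq, h3, h4, h1, add_sub_add_left_eq_sub]
  calc _ ≤ |φ (restrict (A : Set (J × ℕ))ᶜ x)| + |Φ (φ.comp (restrict (A : Set (J × ℕ))ᶜ))| :=
        abs_sub _ _
    _ ≤ ε / (‖Φ‖ + ‖x‖ + 1) * ‖x‖ + ‖Φ‖ * (ε / (‖Φ‖ + ‖x‖ + 1)) := add_le_add h6 h5
    _ = ε / (‖Φ‖ + ‖x‖ + 1) * (‖Φ‖ + ‖x‖) := by ring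
    _ ≤ ε / (‖Φ‖ + ‖x‖ + 1) * (‖Φ‖ + ‖x‖ + 1) :=
        mul_le_mul_of_nonneg_left (by linarith) (by positivity)
    _ = ε := div_mul_cancel₀ _ hK.ne'

end PatternOrliczSum

/-! ### The unit vectors of the components -/

/-- By homogeneity. The strict inequality suits norms defined as infima, where it yields a modular
bound at once. -/
theorem Seminorm.le_mul_of_lt_one {E : Type*} [AddCommGroup E] [Module ℝ E] {N₁ N₂ : Seminorm ℝ E}
    {C : ℝ} (hN : ∀ a, N₂ a < 1 → N₁ a ≤ C) (a : E) : N₁ a ≤ C * N₂ a := by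
  have key : ∀ t, N₂ a < t → N₁ a ≤ C * t := by
    intro t ht
    have ht0 : 0 < t := (apply_nonneg N₂ a).trans_lt ht
    have h1 : ∀ N : Seminorm ℝ E, N (t⁻¹ • a) = t⁻¹ * N a := fun N => by
      rw [map_smul_eq_mul, Real.norm_eq_abs, abs_of_pos (inv_pos.2 ht0)]
    have h2 := hN (t⁻¹ • a) (by rw [h1, inv_mul_lt_one₀ ht0]; exact ht)
    rw [h1, inv_mul_le_iff₀ ht0] at h2
    linarith
  have ht : Tendsto (fun t : ℝ => C * t) (𝓝[>] N₂ a) (𝓝 (C * N₂ a)) :=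
    ((continuous_const.mul continuous_id).tendsto _).mono_left nhdsWithin_le_nhds
  exact ge_of_tendsto ht (by filter_upwards [self_mem_nhdsWithin] with t ht using key t ht)

theorem orliczModular_sum_single {ι : Type*} [Fintype ι] {τ r p : ℝ} {η : ℕ → Fin 2} {k : ι → ℕ}
    (hk : Function.Injective k) (a : ι → ℝ) (c : ℝ) :
    orliczModular (patternFun τ r p η) (fun n => (∑ i, Finsupp.single (k i) (a i)) n / c) =
      ∑ i, ENNReal.ofReal (patternFun τ r p η |a i / c|) := by
  have e : (fun n => (∑ i, Finsupp.single (k i) (a i)) n / c) =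
      fun n => ∑ i, Finsupp.single (k i) (a i) n / c := by
    funext n
    rw [Finsupp.finsetSum_apply, Finset.sum_div]
  rw [e, AdmissibleParams.orliczModular_sum fun n i j hij => by
    by_cases hn : k i = n
    · right
      rw [Finsupp.single_eq_of_ne, zero_div]
      intro hj
      exact hij (hk (hn.trans hj))
    · left
      rw [Finsupp.single_eq_of_ne (Ne.symm hn), zero_div]]
  refine Finset.sum_congr rfl fun i _ => ?_
  rw [orliczModular, tsum_eq_single (k i) fun n hn => by
    rw [Finsupp.single_eq_of_ne hn, zero_div, abs_zero, patternFun_zero, ENNReal.ofReal_zero],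
    Finsupp.single_eq_same]

namespace AdmissibleParams

variable {τ r p : ℝ} (h : AdmissibleParams τ r p)

/-- The norm of `ℓ_{M_η}` on the finitely supported sequences. -/
def patternNorm (η : ℕ → Fin 2) : Seminorm ℝ (ℕ →₀ ℝ) :=
  (normSeminorm ℝ (OrliczSpace (h.orlicz η))).comp (h.ofFinsupp η)

theorem patternNorm_apply (η : ℕ → Fin 2) (a : ℕ →₀ ℝ) :
    h.patternNorm η a = ‖h.ofFinsupp η a‖ := rfl

/-- The modular does not see the positions of the entries. Hence the unit vectors of a component
generate their own norm as spreading model, with all errors zero. -/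
theorem patternNorm_sum_single {ι : Type*} [Fintype ι] (η : ℕ → Fin 2) {k l : ι → ℕ}
    (hk : Function.Injective k) (hl : Function.Injective l) (a : ι → ℝ) :
    h.patternNorm η (∑ i, Finsupp.single (k i) (a i)) =
      h.patternNorm η (∑ i, Finsupp.single (l i) (a i)) := by
  rw [patternNorm_apply, patternNorm_apply, OrliczSpace.norm_def, OrliczSpace.norm_def]
  congr 1
  ext c
  change OrliczLeOne _ _ c ↔ OrliczLeOne _ _ c
  rw [h.orliczLeOne_iff, h.orliczLeOne_iff]
  refine and_congr_right fun _ => ?_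
  have e1 := orliczModular_sum_single (τ := τ) (r := r) (p := p) (η := η) hk a c
  have e2 := orliczModular_sum_single (τ := τ) (r := r) (p := p) (η := η) hl a c
  change orliczModular _ (fun n => (∑ i, Finsupp.single (k i) (a i)) n / c) ≤ 1 ↔
    orliczModular _ (fun n => (∑ i, Finsupp.single (l i) (a i)) n / c) ≤ 1
  rw [e1, e2]

theorem patternNorm_single_one (η : ℕ → Fin 2) (m : ℕ) :
    h.patternNorm η (Finsupp.single m 1) = 1 := by
  refine le_antisymm ?_ ?_
  · refine h.norm_le_of_orliczModular_le_one one_pos ?_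
    have := orliczModular_sum_single (τ := τ) (r := r) (p := p) (η := η) (ι := Fin 1)
      (k := fun _ => m) (fun _ _ _ => Subsingleton.elim _ _) (fun _ => 1) 1
    simp only [Finset.univ_unique, Finset.sum_singleton] at this
    change orliczModular _ (fun n => (Finsupp.single m (1 : ℝ)) n / 1) ≤ 1
    rw [this]
    simp [h.patternFun_map_one]
  · have := OrliczSpace.abs_le_norm (h.ofFinsupp η (Finsupp.single m 1)) m
    rw [seq_ofFinsupp, Finsupp.single_eq_same, abs_one] at this
    exact this

end AdmissibleParams

theorem Finsupp.exists_eq_sum_single (a : ℕ →₀ ℝ) :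
    ∃ n : ℕ, a = ∑ i : Fin n, Finsupp.single (i : ℕ) (a i) := by
  obtain ⟨n, hn⟩ := a.support.exists_nat_subset_range
  refine ⟨n, ?_⟩
  conv_lhs => rw [← Finsupp.sum_single a]
  rw [Finsupp.sum_of_support_subset a hn _ (by simp),
    Fin.sum_univ_eq_sum_range (fun i => Finsupp.single i (a i)) n]

namespace PatternOrliczSum

variable {J : Type*} {τ r p : ℝ} {h : AdmissibleParams τ r p} {ρ : J → ℕ → Fin 2}

theorem norm_unitVector (f : J) (m : ℕ) : ‖(unitVector f m : PatternOrliczSum h ρ)‖ = 1 := by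
  rw [unitVector, norm_inclFinsupp]
  exact h.patternNorm_single_one (ρ f) m

theorem isWeaklyNull_unitVector (f : J) :
    IsWeaklyNull fun n => (unitVector f n : PatternOrliczSum h ρ) := by
  intro φ
  rw [Metric.tendsto_atTop]
  intro ε hε
  obtain ⟨A, hA⟩ := exists_finset_abs_apply_le φ (half_pos hε)
  obtain ⟨N, hN⟩ := (A.image Prod.snd).exists_nat_subset_range
  refine ⟨N, fun n hn => ?_⟩
  have hnA : (f, n) ∉ A := fun hmem => by
    have := Finset.mem_range.1 (hN (Finset.mem_image_of_mem Prod.snd hmem))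
    exact this.not_ge hn
  have e : restrict (A : Set (J × ℕ))ᶜ (unitVector f n : PatternOrliczSum h ρ) = unitVector f n := by
    classical
    refine ext_coordinate fun g m => ?_
    rw [coordinate_restrict, coordinate_unitVector]
    by_cases hgm : g = f ∧ m = n
    · obtain ⟨rfl, rfl⟩ := hgm
      rw [if_pos (by simpa using hnA)]
    · simp [hgm]
  have := hA (unitVector f n)
  rw [e, norm_unitVector, mul_one] at this
  rw [Real.dist_eq, sub_zero]
  linarith

theorem isBasicSequence_unitVector (f : J) :
    IsBasicSequence fun n => (unitVector f n : PatternOrliczSum h ρ) := by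
  classical
  set x : ℕ → PatternOrliczSum h ρ := fun n => unitVector f n
  set Y := (Submodule.span ℝ (Set.range x)).topologicalClosure with hY
  have hxY : ∀ n, x n ∈ Y := fun n =>
    Submodule.le_topologicalClosure _ (Submodule.subset_span (mem_range_self n))
  have hzero : ∀ y ∈ Y, ∀ g, g ≠ f → ∀ n, coordinate g n y = 0 := by
    intro y hy g hg n
    have hle : Y ≤ LinearMap.ker
        (coordinateCLM g n : StrongDual ℝ (PatternOrliczSum h ρ)).toLinearMap := by
      refine Submodule.topologicalClosure_minimal _ (Submodule.span_le.2 ?_)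
        (coordinateCLM g n : StrongDual ℝ (PatternOrliczSum h ρ)).isClosed_ker
      rintro _ ⟨m, rfl⟩
      change coordinate g n (unitVector f m : PatternOrliczSum h ρ) = 0
      rw [coordinate_unitVector, if_neg fun hc => hg hc.1]
    exact hle hy
  have hexp : ∀ y ∈ Y, Tendsto (fun N => ∑ n ∈ Finset.range N, coordinate f n y • x n) atTop
      (𝓝 y) := by
    intro y hy
    rw [Metric.tendsto_atTop]
    intro ε hε
    obtain ⟨A, hA⟩ := exists_finset_norm_restrict_compl_le y (half_pos hε)
    obtain ⟨N, hN⟩ := (A.image Prod.snd).exists_nat_subset_range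
    refine ⟨N, fun n hn => ?_⟩
    rw [dist_comm, dist_eq_norm]
    refine lt_of_le_of_lt (le_trans (norm_le_norm_of_abs_le fun g m => ?_) hA) (half_lt_self hε)
    rw [coordinate_sub, coordinate_sum, coordinate_restrict]
    simp only [coordinate_smul, x, coordinate_unitVector]
    by_cases hg : g = f
    · subst hg
      by_cases hm : m < n
      · rw [Finset.sum_eq_single_of_mem m (Finset.mem_range.2 hm) fun j _ hj => by
          rw [if_neg fun hc => hj hc.2.symm, mul_zero]]
        simp
      · have hmA : (g, m) ∉ A := fun hmem => by
          have := Finset.mem_range.1 (hN (Finset.mem_image_of_mem Prod.snd hmem))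
          exact hm (this.trans_le hn)
        rw [if_pos (by simpa using hmA), Finset.sum_eq_zero, sub_zero]
        intro j hj
        rw [if_neg, mul_zero]
        rintro ⟨-, rfl⟩
        exact hm (Finset.mem_range.1 hj)
    · simp [hzero y hy g hg, hg]
  refine ⟨{ basis := fun n => ⟨x n, hxY n⟩
            coord := fun n => (coordinateCLM f n).comp Y.subtypeL
            ortho := fun i j => ?_
            expansion := fun y => ?_ }, fun i => rfl⟩
  · change coordinate f i (unitVector f j : PatternOrliczSum h ρ) = _
    rw [coordinate_unitVector]
    by_cases hij : i = j
    · subst hij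
      simp [Pi.single, Function.update]
    · simp [Pi.single, Function.update, hij]
  · rw [HasSum, SummationFilter.conditional_filter_eq_map_range, tendsto_map'_iff,
      tendsto_subtype_rng]
    refine (hexp y y.2).congr fun N => ?_
    simp

/-- The unit vectors of a component generate the norm of this component as a spreading model. -/
def unitVectorModel (h : AdmissibleParams τ r p) (ρ : J → ℕ → Fin 2) (f : J) :
    WeaklyNullSpreadingModel (PatternOrliczSum h ρ) where
  toSeminorm := h.patternNorm (ρ f)
  generated := by
    refine ⟨fun n => unitVector f n, norm_unitVector f, isBasicSequence_unitVector f,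
      isWeaklyNull_unitVector f, fun _ => 0, antitone_const, tendsto_const_nhds,
      fun n a _ k hk _ => ?_⟩
    have e : ∑ i, a i • (unitVector f (k i) : PatternOrliczSum h ρ) =
        inclFinsupp f (∑ i, Finsupp.single (k i) (a i)) := by
      rw [map_sum]
      refine Finset.sum_congr rfl fun i _ => ?_
      rw [unitVector, ← map_smul, Finsupp.smul_single, smul_eq_mul, mul_one]
    have e2 := h.patternNorm_sum_single (ρ f) hk.injective Fin.val_injective a
    rw [h.patternNorm_apply] at e2
    rw [e, norm_inclFinsupp, e2]
    simp

/-! ### Disjoint perturbations of weakly null sequences -/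

theorem norm_le_sum_norm_comp {y : PatternOrliczSum h ρ} {G : Finset J}
    (hG : ∀ f, f ∉ G → comp f y = 0) : ‖y‖ ≤ ∑ f ∈ G, ‖comp f y‖ := by
  classical
  have e : y = ∑ f ∈ G, incl f (comp f y) := by
    refine ext_comp fun g => ?_
    rw [map_sum]
    by_cases hg : g ∈ G
    · rw [Finset.sum_eq_single_of_mem g hg fun f _ hf => comp_incl_of_ne hf.symm _, comp_incl_self]
    · rw [hG g hg, Finset.sum_eq_zero]
      intro f hf
      exact comp_incl_of_ne (fun e => hg (by rwa [e])) _
  calc ‖y‖ = ‖∑ f ∈ G, incl f (comp f y)‖ := by rw [← e]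
    _ ≤ ∑ f ∈ G, ‖(incl f (comp f y) : PatternOrliczSum h ρ)‖ := norm_sum_le _ _
    _ = _ := by simp only [norm_incl]

/-- `A` is the support already used. Three pieces of norm at most `ε / 3` are removed: a tail, the
part on `A`, and the components outside `F` that meet `A` and have small norm. On a surviving
component outside `F` that meets `A`, the uniform bound on the coordinates becomes a bound relative
to the norm of that component. -/
theorem exists_disjoint_flat_approx {x : PatternOrliczSum h ρ} {A : Finset (J × ℕ)} {F : Set J}
    {ε δ : ℝ} (hε : 0 < ε) (hδ : 0 < δ) (hA : ‖restrict (A : Set (J × ℕ)) x‖ ≤ ε / 3)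
    (hF : ∀ f, f ∉ F → (∃ n, (f, n) ∈ A) → ∀ m,
      |coordinate f m x| ≤ δ * (ε / (3 * (A.card + 1)))) :
    ∃ w : PatternOrliczSum h ρ, ∃ B : Finset (J × ℕ), ‖x - w‖ ≤ ε ∧
      (∀ f m, |coordinate f m w| ≤ |coordinate f m x|) ∧
      (∀ f m, coordinate f m w ≠ 0 → (f, m) ∈ B ∧ (f, m) ∉ A) ∧
      ∀ f, f ∉ F → (∃ n, (f, n) ∈ A) → ∀ m, |coordinate f m w| ≤ δ * ‖comp f x‖ := by
  classical
  set κ := ε / (3 * (A.card + 1)) with hκ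
  have hκ0 : 0 < κ := by positivity
  obtain ⟨B, hB⟩ := exists_finset_norm_restrict_compl_le x (show 0 < ε / 3 by positivity)
  -- At most `A.card` components occur in `T`, each of norm at most `κ`; this is the reason for the
  -- value of `κ`.
  set T : Set (J × ℕ) := {q | (∃ n, (q.1, n) ∈ A) ∧ q.1 ∉ F ∧ ‖comp q.1 x‖ ≤ κ} with hT
  have hTn : ‖restrict T x‖ ≤ ε / 3 := by
    have h1 : ∀ f, f ∉ A.image Prod.fst → comp f (restrict T x) = 0 := by
      intro f hf
      refine OrliczSpace.ext_seq fun n => ?_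
      have := coordinate_restrict T x f n
      rw [coordinate] at this
      rw [this, if_neg, OrliczSpace.seq_zero]
      rintro ⟨⟨m, hm⟩, -⟩
      exact hf (Finset.mem_image_of_mem Prod.fst hm)
    have h2 : ∀ f, ‖comp f (restrict T x)‖ ≤ κ := by
      intro f
      by_cases hf : ‖comp f x‖ ≤ κ
      · exact (norm_comp_le_norm_comp_of_abs_le fun n =>
          abs_coordinate_restrict_le T x f n).trans hf
      · have : comp f (restrict T x) = 0 := OrliczSpace.ext_seq fun n => by
          have := coordinate_restrict T x f n
          rw [coordinate] at this
          rw [this, if_neg, OrliczSpace.seq_zero]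
          exact fun hc => hf hc.2.2
        rw [this, norm_zero]
        exact hκ0.le
    calc ‖restrict T x‖ ≤ ∑ f ∈ A.image Prod.fst, ‖comp f (restrict T x)‖ :=
          norm_le_sum_norm_comp h1
      _ ≤ ∑ f ∈ A.image Prod.fst, κ := Finset.sum_le_sum fun f _ => h2 f
      _ = (A.image Prod.fst).card * κ := by rw [Finset.sum_const, nsmul_eq_mul]
      _ ≤ (A.card + 1) * κ := by
          refine mul_le_mul_of_nonneg_right ?_ hκ0.le
          have : ((A.image Prod.fst).card : ℝ) ≤ A.card := by exact_mod_cast Finset.card_image_le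
          linarith
      _ = ε / 3 := by rw [hκ]; field_simp
  set S : Set (J × ℕ) := (B : Set (J × ℕ))ᶜ ∪ (A ∪ T) with hS
  refine ⟨restrict Sᶜ x, B, ?_, abs_coordinate_restrict_le _ x, fun f m hfm => ?_,
    fun f hf hfA m => ?_⟩
  · have e : x - restrict Sᶜ x = restrict S x :=
      sub_eq_of_eq_add (restrict_add_restrict_compl S x).symm
    rw [e]
    have h1 := norm_restrict_union_le (B : Set (J × ℕ))ᶜ (A ∪ T) x
    have h2 := norm_restrict_union_le (A : Set (J × ℕ)) T x
    linarith
  · rw [coordinate_restrict] at hfm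
    have hmem : (f, m) ∈ Sᶜ := by
      by_contra hc
      rw [if_neg hc] at hfm
      exact hfm rfl
    simp only [hS, mem_compl_iff, mem_union, not_or, not_not, Finset.mem_coe] at hmem
    exact ⟨hmem.1, hmem.2.1⟩
  · rw [coordinate_restrict]
    split_ifs with hmem
    · have hnot : ¬‖comp f x‖ ≤ κ := by
        simp only [hS, mem_compl_iff, mem_union, not_or] at hmem
        exact fun hc => hmem.2.2 ⟨hfA, hf, hc⟩
      exact (hF f hf hfA m).trans (mul_le_mul_of_nonneg_left (not_le.1 hnot).le hδ.le)
    · rw [abs_zero]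
      positivity

/-- The vectors are chosen inductively off the union `A` of the earlier supports. Once some vector
meets a component outside `F`, all later ones are flat there, so at most one vector per such
component is not flat. The set `K` lets the indices be taken from a prescribed frequent set. -/
theorem exists_disjoint_perturbation {x : ℕ → PatternOrliczSum h ρ}
    (hx : ∀ f m, Tendsto (fun i => coordinate f m (x i)) atTop (𝓝 0)) {F : Set J}
    (hF : ∀ f, f ∉ F → ∀ ε > 0, ∀ᶠ i in atTop, ∀ m, |coordinate f m (x i)| ≤ ε) {K : Set ℕ}
    (hK : ∃ᶠ i in atTop, i ∈ K) {ε δ : ℝ} (hε : 0 < ε) (hδ : 0 < δ) (N n : ℕ) :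
    ∃ (k : ℕ → ℕ) (w : ℕ → PatternOrliczSum h ρ) (A : Finset (J × ℕ)),
      (∀ i < n, k i ∈ K ∧ N ≤ k i ∧ ‖x (k i) - w i‖ ≤ ε ∧
        (∀ f m, |coordinate f m (w i)| ≤ |coordinate f m (x (k i))|) ∧
        ∀ f m, coordinate f m (w i) ≠ 0 → (f, m) ∈ A) ∧
      ∀ i j, i < j → j < n → k i < k j ∧
        (∀ f m, coordinate f m (w i) = 0 ∨ coordinate f m (w j) = 0) ∧
        ∀ f, f ∉ F → (∃ m, coordinate f m (w i) ≠ 0) →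
          ∀ m, |coordinate f m (w j)| ≤ δ * ‖comp f (x (k j))‖ := by
  classical
  induction n with
  | zero => exact ⟨fun _ => 0, fun _ => 0, ∅, by simp, by simp⟩
  | succ n ih =>
    obtain ⟨k, w, A, h1, h2⟩ := ih
    have hev1 : ∀ᶠ i in atTop, ∀ j ∈ Finset.range n, k j < i :=
      (Finset.range n).eventually_all.2 fun j _ => eventually_gt_atTop (k j)
    have hev2 : ∀ᶠ i in atTop, ‖restrict (A : Set (J × ℕ)) (x i)‖ < ε / 3 :=
      (tendsto_norm_restrict_finset hx A).eventually_lt_const (by positivity)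
    have hev3 : ∀ᶠ i in atTop, ∀ f ∈ A.image Prod.fst, f ∉ F →
        ∀ m, |coordinate f m (x i)| ≤ δ * (ε / (3 * (A.card + 1))) := by
      refine (A.image Prod.fst).eventually_all.2 fun f _ => ?_
      by_cases hf : f ∈ F
      · exact Eventually.of_forall fun _ hc => (hc hf).elim
      · exact (hF f hf _ (by positivity)).mono fun _ hi _ => hi
    obtain ⟨l, hlK, hlN, hl1, hl2, hl3⟩ := (hK.and_eventually
      ((eventually_ge_atTop N).and (hev1.and (hev2.and hev3)))).exists
    obtain ⟨v, B, hv1, hv2, hv3, hv4⟩ := exists_disjoint_flat_approx (F := F) hε hδ hl2.le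
      fun f hf ⟨m, hm⟩ => hl3 f (Finset.mem_image_of_mem Prod.fst hm) hf
    refine ⟨Function.update k n l, Function.update w n v, A ∪ B, fun i hi => ?_,
      fun i j hij hj => ?_⟩
    · rcases Nat.lt_succ_iff_lt_or_eq.1 hi with hi' | rfl
      · rw [Function.update_of_ne hi'.ne, Function.update_of_ne hi'.ne]
        obtain ⟨a, b, c, d, e⟩ := h1 i hi'
        exact ⟨a, b, c, d, fun f m hfm => Finset.mem_union_left _ (e f m hfm)⟩
      · rw [Function.update_self, Function.update_self]
        exact ⟨hlK, hlN, hv1, hv2, fun f m hfm => Finset.mem_union_right _ (hv3 f m hfm).1⟩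
    · rcases Nat.lt_succ_iff_lt_or_eq.1 hj with hj' | rfl
      · have hi' := hij.trans hj'
        rw [Function.update_of_ne hi'.ne, Function.update_of_ne hi'.ne,
          Function.update_of_ne hj'.ne, Function.update_of_ne hj'.ne]
        exact h2 i j hij hj'
      · rw [Function.update_of_ne hij.ne, Function.update_of_ne hij.ne, Function.update_self,
          Function.update_self]
        refine ⟨hl1 i (Finset.mem_range.2 hij), fun f m => ?_, fun f hf ⟨m, hm⟩ => ?_⟩
        · by_contra! hc
          exact (hv3 f m hc.2).2 ((h1 i hij).2.2.2.2 f m hc.1)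
        · exact hv4 f hf ⟨m, (h1 i hij).2.2.2.2 f m hm⟩

end PatternOrliczSum

/-! ### Spreading models and disjoint vectors. -/

/-- The finite sums of the sequence `x` are, far enough out, `E`-equivalent to the norm `N`. -/
def IsSpreadingEquivalent {X : Type*} [NormedAddCommGroup X] [NormedSpace ℝ X] (x : ℕ → X)
    (N : Seminorm ℝ (ℕ →₀ ℝ)) (E : ℝ) : Prop :=
  ∀ (n : ℕ) (a : Fin n → ℝ) (k : Fin n → ℕ), StrictMono k → (∀ i, n ≤ k i + 1) →
    N (∑ i : Fin n, Finsupp.single (i : ℕ) (a i)) ≤ E * ‖∑ i : Fin n, a i • x (k i)‖ ∧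
      ‖∑ i : Fin n, a i • x (k i)‖ ≤ E * N (∑ i : Fin n, Finsupp.single (i : ℕ) (a i))

/-- The errors decrease to zero, so they lie between `0` and `ε 0`; dividing by `1 + ∑ |a i|`
removes the restriction on the coefficients. -/
theorem GeneratesSpreadingModel.exists_isSpreadingEquivalent {X : Type*} [NormedAddCommGroup X]
    [NormedSpace ℝ X] {x : ℕ → X} {N : Seminorm ℝ (ℕ →₀ ℝ)} (hx : GeneratesSpreadingModel x N) :
    ∃ E, 1 ≤ E ∧ IsSpreadingEquivalent x N E := by
  obtain ⟨ε, hanti, hlim, hε⟩ := hx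
  have h0 : ∀ n, 0 ≤ ε n := fun n => hanti.le_of_tendsto hlim n
  refine ⟨1 + ε 0, by linarith [h0 0], fun n a k hk hnk => ?_⟩
  set s := 1 + ∑ i, |a i| with hs
  have hs0 : 0 < s := by
    have := Finset.sum_nonneg fun i (_ : i ∈ Finset.univ) => abs_nonneg (a i)
    linarith
  have hle : ∀ i, |a i| ≤ s := fun i => by
    have := Finset.single_le_sum (f := fun i => |a i|) (fun i _ => abs_nonneg (a i))
      (Finset.mem_univ i)
    linarith
  have hmem : ∀ i, s⁻¹ * a i ∈ Icc (-1 : ℝ) 1 := fun i => by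
    rw [mem_Icc, ← abs_le, abs_mul, abs_inv, abs_of_pos hs0, inv_mul_le_one₀ hs0]
    exact hle i
  obtain ⟨h1, h2⟩ := hε n (fun i => s⁻¹ * a i) hmem k hk hnk
  have e1 : N (∑ i : Fin n, Finsupp.single (i : ℕ) (s⁻¹ * a i)) =
      s⁻¹ * N (∑ i : Fin n, Finsupp.single (i : ℕ) (a i)) := by
    have : ∑ i : Fin n, Finsupp.single (i : ℕ) (s⁻¹ * a i) =
        s⁻¹ • ∑ i : Fin n, Finsupp.single (i : ℕ) (a i) := by
      rw [Finset.smul_sum]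
      simp
    rw [this, map_smul_eq_mul, Real.norm_eq_abs, abs_of_pos (inv_pos.2 hs0)]
  have e2 : ‖∑ i : Fin n, (s⁻¹ * a i) • x (k i)‖ = s⁻¹ * ‖∑ i : Fin n, a i • x (k i)‖ := by
    simp only [mul_smul]
    rw [← Finset.smul_sum, norm_smul, Real.norm_eq_abs, abs_of_pos (inv_pos.2 hs0)]
  have hεn : 1 + ε n ≤ 1 + ε 0 := by linarith [hanti (Nat.zero_le n)]
  rw [e1, e2, inv_mul_le_iff₀ (by linarith [h0 n])] at h1
  rw [e1, e2] at h2
  have hsi := inv_pos.2 hs0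
  constructor
  · have h3 : s⁻¹ * N (∑ i : Fin n, Finsupp.single (i : ℕ) (a i)) ≤
        s⁻¹ * ((1 + ε n) * ‖∑ i : Fin n, a i • x (k i)‖) := by linarith
    exact (le_of_mul_le_mul_left h3 hsi).trans
      (mul_le_mul_of_nonneg_right hεn (norm_nonneg _))
  · have h3 : s⁻¹ * ‖∑ i : Fin n, a i • x (k i)‖ ≤
        s⁻¹ * ((1 + ε n) * N (∑ i : Fin n, Finsupp.single (i : ℕ) (a i))) := by linarith
    exact (le_of_mul_le_mul_left h3 hsi).trans
      (mul_le_mul_of_nonneg_right hεn (apply_nonneg _ _))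

namespace PatternOrliczSum

variable {J : Type*} {τ r p : ℝ} {h : AdmissibleParams τ r p} {ρ : J → ℕ → Fin 2}

theorem IsWeaklyNull.tendsto_coordinate {x : ℕ → PatternOrliczSum h ρ} (hx : IsWeaklyNull x) (f : J)
    (m : ℕ) : Tendsto (fun i => coordinate f m (x i)) atTop (𝓝 0) :=
  hx (coordinateCLM f m)

theorem exists_spreading_perturbation {x : ℕ → PatternOrliczSum h ρ}
    {N : Seminorm ℝ (ℕ →₀ ℝ)} {E : ℝ} (hE : 1 ≤ E) (hN : IsSpreadingEquivalent x N E)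
    (hx : ∀ f m, Tendsto (fun i => coordinate f m (x i)) atTop (𝓝 0)) {F : Set J}
    (hF : ∀ f, f ∉ F → ∀ ε > 0, ∀ᶠ i in atTop, ∀ m, |coordinate f m (x i)| ≤ ε) {K : Set ℕ}
    (hK : ∃ᶠ i in atTop, i ∈ K) {ε δ : ℝ} (hε : 0 < ε) (hδ : 0 < δ) {n : ℕ} (a : Fin n → ℝ) :
    ∃ (k : Fin n → ℕ) (w : Fin n → PatternOrliczSum h ρ),
      (∀ i, k i ∈ K) ∧ (∀ i, ‖x (k i) - w i‖ ≤ ε) ∧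
      (∀ i f m, |coordinate f m (w i)| ≤ |coordinate f m (x (k i))|) ∧ DisjointSupports w ∧
      (∀ f, f ∉ F → ∀ i j, (∃ m, δ * ‖comp f (x (k i))‖ < |coordinate f m (w i)|) →
        (∃ m, δ * ‖comp f (x (k j))‖ < |coordinate f m (w j)|) → i = j) ∧
      N (∑ i : Fin n, Finsupp.single (i : ℕ) (a i)) ≤ E * (‖∑ i, a i • w i‖ + 1) ∧
      ‖∑ i, a i • w i‖ ≤ E * N (∑ i : Fin n, Finsupp.single (i : ℕ) (a i)) + 1 := by
  set s := 1 + ∑ i, |a i| with hs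
  have hs0 : 0 < s := by
    have := Finset.sum_nonneg fun i (_ : i ∈ Finset.univ) => abs_nonneg (a i)
    linarith
  -- Accuracy `s⁻¹` changes the linear combination by at most `1`, whatever the coefficients;
  -- indices at least `n` make the spreading equivalence applicable.
  obtain ⟨k, w, A, h1, h2⟩ := exists_disjoint_perturbation hx hF hK
    (lt_min hε (inv_pos.2 hs0)) hδ n n
  have hsymm : ∀ {P : Fin n → Fin n → Prop}, (∀ i j, P i j → P j i) → (∀ i j, i < j → P i j) →
      ∀ i j, i ≠ j → P i j := fun hP hlt i j hij => by
    rcases lt_or_gt_of_ne hij with hij | hij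
    · exact hlt i j hij
    · exact hP _ _ (hlt j i hij)
  have hk : StrictMono fun i : Fin n => k i := fun i j hij => (h2 i j hij j.2).1
  have hclose : ‖∑ i : Fin n, a i • x (k i) - ∑ i : Fin n, a i • w i‖ ≤ 1 := by
    rw [← Finset.sum_sub_distrib]
    calc ‖∑ i : Fin n, (a i • x (k i) - a i • w i)‖ ≤ ∑ i : Fin n, |a i| * s⁻¹ := by
          refine (norm_sum_le _ _).trans (Finset.sum_le_sum fun i _ => ?_)
          rw [← smul_sub, norm_smul, Real.norm_eq_abs]
          exact mul_le_mul_of_nonneg_left ((h1 i i.2).2.2.1.trans (min_le_right _ _))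
            (abs_nonneg _)
      _ = (∑ i, |a i|) * s⁻¹ := by rw [Finset.sum_mul]
      _ ≤ 1 := by
          rw [mul_inv_le_iff₀ hs0]
          linarith
  obtain ⟨h3, h4⟩ := hN n a (fun i => k i) hk fun i => ((h1 i i.2).2.1).trans (Nat.le_succ _)
  refine ⟨fun i => k i, fun i => w i, fun i => (h1 i i.2).1,
    fun i => (h1 i i.2).2.2.1.trans (min_le_left _ _), fun i => (h1 i i.2).2.2.2.1,
    fun f m i j hij => ?_, fun f hf i j hi hj => ?_, h3.trans ?_, ?_⟩
  · exact hsymm (P := fun i j => coordinate f m (w i) = 0 ∨ coordinate f m (w j) = 0)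
      (fun _ _ => Or.symm) (fun i j hij => (h2 i j hij j.2).2.1 f m) i j hij
  · by_contra hij
    refine hsymm (P := fun i j : Fin n => (∃ m, δ * ‖comp f (x (k i))‖ < |coordinate f m (w i)|) →
        (∃ m, δ * ‖comp f (x (k j))‖ < |coordinate f m (w j)|) → False)
      (fun _ _ hP hi hj => hP hj hi) (fun i j hij => ?_) i j hij hi hj
    rintro ⟨m, hm⟩ ⟨m', hm'⟩
    refine hm'.not_ge ((h2 i j hij j.2).2.2 f hf ⟨m, fun h0 => ?_⟩ m')
    rw [h0, abs_zero] at hm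
    exact hm.not_ge (by positivity)
  · refine mul_le_mul_of_nonneg_left ?_ (by linarith)
    have := norm_sub_norm_le (∑ i : Fin n, a i • x (k i)) (∑ i : Fin n, a i • w i)
    linarith
  · have := norm_sub_norm_le (∑ i : Fin n, a i • w i) (∑ i : Fin n, a i • x (k i))
    rw [norm_sub_rev] at this
    linarith

/-! ### Comparison of spreading models with the norms of the components -/

section Comparison

variable {x : ℕ → PatternOrliczSum h ρ} {N : Seminorm ℝ (ℕ →₀ ℝ)} {E : ℝ}

/-- Supplies the degree of flatness: entries below `δ` are below every nonzero coefficient, so the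
sparse estimate applies. -/
theorem exists_pos_le_abs {n : ℕ} (a : Fin n → ℝ) : ∃ δ > 0, ∀ i, a i ≠ 0 → δ ≤ |a i| := by
  classical
  rcases (Finset.univ.filter fun i => a i ≠ 0).eq_empty_or_nonempty with he | hne
  · refine ⟨1, one_pos, fun i hi => ?_⟩
    exact (Finset.notMem_empty i (he ▸ Finset.mem_filter.2 ⟨Finset.mem_univ i, hi⟩)).elim
  · obtain ⟨i, hi, hmin⟩ := Finset.exists_min_image _ (fun i => |a i|) hne
    exact ⟨|a i|, abs_pos.2 (Finset.mem_filter.1 hi).2, fun j hj =>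
      hmin j (Finset.mem_filter.2 ⟨Finset.mem_univ j, hj⟩)⟩

theorem sum_patternFun_div_le_one (h : AdmissibleParams τ r p) {η : ℕ → Fin 2} {n : ℕ}
    {a : Fin n → ℝ} {c : ℝ}
    (ha : h.patternNorm η (∑ i : Fin n, Finsupp.single (i : ℕ) (a i)) < c) :
    ∑ i, patternFun τ r p η |a i / c| ≤ 1 := by
  have h1 := h.orliczModular_le_one_of_norm_lt ha
  have h2 := orliczModular_sum_single (τ := τ) (r := r) (p := p) (η := η)
    (Fin.val_injective (n := n)) a c
  change orliczModular _ (fun m => (∑ i : Fin n, Finsupp.single (i : ℕ) (a i)) m / c) ≤ 1 at h1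
  rwa [h2, ← ENNReal.ofReal_sum_of_nonneg fun i _ => h.patternFun_nonneg _ _,
    ENNReal.ofReal_le_one] at h1

theorem patternNorm_sum_single_le (h : AdmissibleParams τ r p) {η : ℕ → Fin 2} {n : ℕ}
    {a : Fin n → ℝ} {c K : ℝ} (hc : 0 < c) (hK : 1 ≤ K)
    (ha : ∑ i, patternFun τ r p η |a i / c| ≤ K) :
    h.patternNorm η (∑ i : Fin n, Finsupp.single (i : ℕ) (a i)) ≤ K * c := by
  refine h.norm_le_of_orliczModular_le hc hK ?_
  have h2 := orliczModular_sum_single (τ := τ) (r := r) (p := p) (η := η)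
    (Fin.val_injective (n := n)) a c
  change orliczModular _ (fun m => (∑ i : Fin n, Finsupp.single (i : ℕ) (a i)) m / c) ≤ _
  rw [h2, ← ENNReal.ofReal_sum_of_nonneg fun i _ => h.patternFun_nonneg _ _]
  exact ENNReal.ofReal_le_ofReal ha

/-- The masses are `M_η |a i|`. For `f ∈ F` submultiplicativity and `ρ f ≤ η` at the nodes show that
every index is good. For `f ∉ F` a flat vector has normalized entries `t ≤ |a i|`, whence `M (|a i|
* t) ≤ C * |a i| ^ p * M t`, and `|a i| ^ p` is bounded by the mass; the one vector that is not flat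
is the exceptional index. -/
theorem exists_le_patternNorm (hE : 1 ≤ E) (hN : IsSpreadingEquivalent x N E)
    (hx1 : ∀ i, ‖x i‖ = 1)
    (hx : ∀ f m, Tendsto (fun i => coordinate f m (x i)) atTop (𝓝 0)) {F : Set J}
    (hF : ∀ f, f ∉ F → ∀ ε > 0, ∀ᶠ i in atTop, ∀ m, |coordinate f m (x i)| ≤ ε)
    (hsparse : ∀ f, IsSparsePattern (ρ f)) {η : ℕ → Fin 2}
    (hη : ∀ f ∈ F, ∀ k, patternValue τ r p (ρ f) k ≤ patternValue τ r p η k) :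
    ∃ C, ∀ a, N a ≤ C * h.patternNorm η a := by
  set g := h.growthConst with hg
  have hg1 : 1 ≤ g := h.one_le_growthConst
  -- In `D = 2 * g ^ 3`, the factor `g ^ 2` comes from submultiplicativity and `2 * g` from
  -- comparing `ρ f` with `η` through `patternFun_le_add`.
  have hD : 1 ≤ 2 * g ^ 3 := by
    have := one_le_pow₀ (n := 3) hg1
    linarith
  have hgD : g ≤ 2 * g ^ 3 := by nlinarith [one_le_pow₀ (n := 2) hg1]
  refine ⟨E * (upperConst h (2 * g ^ 3) + 1), Seminorm.le_mul_of_lt_one fun b hb => ?_⟩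
  obtain ⟨n, hn⟩ := Finsupp.exists_eq_sum_single b
  set a : Fin n → ℝ := fun i => b i with ha
  rw [hn] at hb ⊢
  have hsum := sum_patternFun_div_le_one h (a := a) hb
  simp only [div_one] at hsum
  have ha1 : ∀ i, |a i| ≤ 1 := fun i => by
    by_contra! hc
    have h1 := h.le_patternFun η hc.le
    have h2 := Finset.single_le_sum (f := fun i => patternFun τ r p η |a i|)
      (fun i _ => h.patternFun_nonneg _ _) (Finset.mem_univ i)
    linarith
  obtain ⟨δ, hδ, hδa⟩ := exists_pos_le_abs a
  obtain ⟨k, w, -, -, hwx, hdisj, hflat, hNw, -⟩ := exists_spreading_perturbation hE hN hx hF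
    (K := univ) (Eventually.of_forall fun _ => mem_univ _).frequently
    one_pos hδ a
  refine hNw.trans (mul_le_mul_of_nonneg_left ?_ (by linarith))
  have hlow : ∀ i, |a i| ^ p ≤ g * patternFun τ r p η |a i| := fun i =>
    h.rpow_le_patternFun (abs_nonneg _) (ha1 i)
  have hm0 : ∀ i, 0 ≤ patternFun τ r p η |a i| := fun i => h.patternFun_nonneg _ _
  refine add_le_add_left (norm_sum_le_upperConst hdisj (m := fun i => patternFun τ r p η |a i|)
    (c := fun i f => ‖comp f (x (k i))‖) hD hm0 hsum
    (fun i f => norm_comp_le_norm_comp_of_abs_le (hwx i f))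
    (fun i s => (sum_norm_comp_rpow_le s _).trans (by rw [hx1, Real.one_rpow]))
    (fun i => (hlow i).trans (mul_le_mul_of_nonneg_right hgD (hm0 i)))
    (bad := fun f i => f ∉ F ∧ ∃ m, δ * ‖comp f (x (k i))‖ < |coordinate f m (w i)|)
    (fun f i j hi hj => hflat f hi.1 i j hi.2 hj.2) fun f i hgood hc => ?_) 1
  have hwc : ‖comp f (w i)‖ ≤ ‖comp f (x (k i))‖ := norm_comp_le_norm_comp_of_abs_le (hwx i f)
  refine h.orliczModular_smul_le (u := comp f (w i)) hc hwc
    (mul_nonneg (by linarith) (hm0 i)) fun m => ?_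
  obtain ⟨ht0, ht1⟩ := h.div_two_mul_mem hc hwc m
  set t := |(comp f (w i)).seq m| / (2 * ‖comp f (x (k i))‖) with ht
  have hMt : 0 ≤ patternFun τ r p (ρ f) t := h.patternFun_nonneg _ _
  by_cases hfF : f ∈ F
  · have h1 := h.patternFun_mul_le (hsparse f) (abs_nonneg (a i)) (ha1 i) ht0 ht1
    have h2 := h.patternFun_le_add (η := ρ f) (η₁ := η) (η₂ := η)
      (fun k => by rw [max_self]; exact hη f hfF k) (abs_nonneg (a i))
    calc patternFun τ r p (ρ f) (|a i| * t)
        ≤ g ^ 2 * (patternFun τ r p (ρ f) |a i| * patternFun τ r p (ρ f) t) := h1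
      _ ≤ g ^ 2 * ((g * (patternFun τ r p η |a i| + patternFun τ r p η |a i|)) *
          patternFun τ r p (ρ f) t) :=
        mul_le_mul_of_nonneg_left (mul_le_mul_of_nonneg_right h2 hMt) (by positivity)
      _ = _ := by ring
  · rcases eq_or_ne (a i) 0 with ha0 | ha0
    · rw [ha0, abs_zero, zero_mul, patternFun_zero, patternFun_zero]
      simp
    have hle : |(comp f (w i)).seq m| ≤ δ * ‖comp f (x (k i))‖ := by
      by_contra! hcon
      exact hgood ⟨hfF, m, hcon⟩
    have hta : t ≤ |a i| := by
      rw [ht, div_le_iff₀ (by positivity)]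
      nlinarith [hδa i ha0]
    have h1 := h.patternFun_mul_le_of_le (hsparse f) hta ht0 (ha1 i)
    calc patternFun τ r p (ρ f) (|a i| * t) ≤ g * (|a i| ^ p * patternFun τ r p (ρ f) t) := h1
      _ ≤ g * ((g * patternFun τ r p η |a i|) * patternFun τ r p (ρ f) t) :=
        mul_le_mul_of_nonneg_left (mul_le_mul_of_nonneg_right (hlow i) hMt) (by linarith)
      _ = g ^ 2 * (patternFun τ r p η |a i| * patternFun τ r p (ρ f) t) := by ring
      _ ≤ (2 * g ^ 3) * (patternFun τ r p η |a i| * patternFun τ r p (ρ f) t) :=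
        mul_le_mul_of_nonneg_right (by nlinarith [pow_pos (one_pos.trans_le hg1) 2])
          (mul_nonneg (hm0 i) hMt)
      _ = _ := by ring

/-- Along the indices with a large `f`-coordinate, disjointness puts the large entries `≥ δ / 2` at
distinct positions. Keeping only these entries recovers the unit vectors of component `f`. -/
theorem exists_patternNorm_le (hE : 1 ≤ E) (hN : IsSpreadingEquivalent x N E)
    (hx : ∀ f m, Tendsto (fun i => coordinate f m (x i)) atTop (𝓝 0)) {f : J} {δ : ℝ} (hδ : 0 < δ)
    (hf : ∃ᶠ i in atTop, ∃ m, δ ≤ |coordinate f m (x i)|) :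
    ∃ C, ∀ a, h.patternNorm (ρ f) a ≤ C * N a := by
  refine ⟨2 / δ * (E + 1), Seminorm.le_mul_of_lt_one fun b hb => ?_⟩
  obtain ⟨n, hn⟩ := Finsupp.exists_eq_sum_single b
  set a : Fin n → ℝ := fun i => b i with ha
  rw [hn] at hb ⊢
  -- With `F = univ` the flatness requirement is void; accuracy `δ / 2` keeps the large entry.
  obtain ⟨k, w, hkK, hclose, -, hdisj, -, -, hwN⟩ := exists_spreading_perturbation hE hN hx
    (F := univ) (fun f hf => (hf (mem_univ f)).elim)
    (K := {i | ∃ m, δ ≤ |coordinate f m (x i)|}) hf (half_pos hδ) one_pos a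
  choose m hm using hkK
  have hwm : ∀ i, δ / 2 ≤ |coordinate f (m i) (w i)| := fun i => by
    have h1 := (abs_coordinate_le f (m i) (x (k i) - w i)).trans (hclose i)
    rw [coordinate_sub] at h1
    have h2 := abs_sub_abs_le_abs_sub (coordinate f (m i) (x (k i))) (coordinate f (m i) (w i))
    linarith [hm i]
  have hne : ∀ i, coordinate f (m i) (w i) ≠ 0 := fun i h0 => by
    have := hwm i
    rw [h0, abs_zero] at this
    linarith
  have hminj : Function.Injective m := fun i j hij => by
    by_contra hne'
    rcases hdisj f (m i) i j hne' with h0 | h0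
    · exact hne i h0
    · rw [hij] at h0
      exact hne j h0
  have hwN' : ‖∑ i, a i • w i‖ ≤ E + 1 := by
    have : E * N (∑ i : Fin n, Finsupp.single (i : ℕ) (a i)) ≤ E * 1 :=
      mul_le_mul_of_nonneg_left hb.le (by linarith)
    linarith
  change h.patternNorm (ρ f) (∑ i : Fin n, Finsupp.single (i : ℕ) (a i)) ≤ _
  rw [h.patternNorm_sum_single (ρ f) Fin.val_injective hminj a, h.patternNorm_apply]
  calc ‖h.ofFinsupp (ρ f) (∑ i, Finsupp.single (m i) (a i))‖
      ≤ ‖(2 / δ) • comp f (∑ i, a i • w i)‖ := by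
        refine h.norm_le_norm_of_abs_le fun l => ?_
        rw [OrliczSpace.seq_smul, abs_mul, abs_of_pos (show 0 < 2 / δ by positivity),
          AdmissibleParams.seq_ofFinsupp, Finsupp.finsetSum_apply]
        by_cases hl : ∃ i, m i = l
        · obtain ⟨i, rfl⟩ := hl
          rw [Fintype.sum_eq_single i fun j hj => Finsupp.single_eq_of_ne
            fun e => hj (hminj e.symm), Finsupp.single_eq_same]
          change _ ≤ 2 / δ * |coordinate f (m i) (∑ i, a i • w i)|
          rw [coordinate_sum, Fintype.sum_eq_single i fun j hj => by
            rw [coordinate_smul, (hdisj f (m i) i j hj.symm).resolve_left (hne i), mul_zero],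
            coordinate_smul, abs_mul]
          have h1 := mul_le_mul_of_nonneg_left (hwm i)
            (show 0 ≤ 2 / δ * |a i| by positivity)
          have h2 : 2 / δ * |a i| * (δ / 2) = |a i| := by field_simp
          linarith
        · rw [Finset.sum_eq_zero fun i _ => Finsupp.single_eq_of_ne
            fun e => hl ⟨i, e.symm⟩, abs_zero]
          positivity
    _ = 2 / δ * ‖comp f (∑ i, a i • w i)‖ := by
        rw [norm_smul, Real.norm_eq_abs, abs_of_pos (show 0 < 2 / δ by positivity)]
    _ ≤ _ := mul_le_mul_of_nonneg_left ((norm_comp_le f _).trans hwN') (by positivity)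

/-- The perturbed vectors have norm at least `1 / 2`, so the lower `p`-estimate bounds `∑ |a i| ^
p`, and the all-ones function is at most a multiple of `t ^ p`. -/
theorem exists_patternNorm_one_le (hE : 1 ≤ E) (hN : IsSpreadingEquivalent x N E)
    (hx1 : ∀ i, ‖x i‖ = 1)
    (hx : ∀ f m, Tendsto (fun i => coordinate f m (x i)) atTop (𝓝 0)) :
    ∃ C, ∀ a, h.patternNorm (fun _ => 1) a ≤ C * N a := by
  set g := h.growthConst with hg
  have hg0 : 0 < g := h.growthConst_pos
  have hp := exponent_pos h
  set R := g * 2 ^ p * (E + 1) ^ p * 2 ^ p with hR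
  refine ⟨max 1 (g * R), Seminorm.le_mul_of_lt_one fun b hb => ?_⟩
  obtain ⟨n, hn⟩ := Finsupp.exists_eq_sum_single b
  set a : Fin n → ℝ := fun i => b i with ha
  rw [hn] at hb ⊢
  obtain ⟨k, w, -, hclose, -, hdisj, -, -, hwN⟩ := exists_spreading_perturbation hE hN hx
    (F := univ) (fun f hf => (hf (mem_univ f)).elim)
    (K := univ) (Eventually.of_forall fun _ => mem_univ _).frequently
    (half_pos one_pos) one_pos a
  have hwN' : ‖∑ i, a i • w i‖ ≤ E + 1 := by
    have : E * N (∑ i : Fin n, Finsupp.single (i : ℕ) (a i)) ≤ E * 1 :=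
      mul_le_mul_of_nonneg_left hb.le (by linarith)
    linarith
  have hw : ∀ i, 1 / 2 ≤ ‖w i‖ := fun i => by
    have := norm_sub_norm_le (x (k i)) (w i)
    rw [hx1] at this
    linarith [hclose i]
  have h1 := sum_norm_rpow_le (w := fun i => a i • w i) fun f m i j hij => by
    rcases hdisj f m i j hij with h0 | h0 <;> simp [h0]
  have h2 : ∑ i, |a i| ^ p ≤ R := by
    have h3 : ∑ i, |a i| ^ p * (1 / 2) ^ p ≤ g * 2 ^ p * (E + 1) ^ p := by
      refine (Finset.sum_le_sum fun i _ => ?_).trans (h1.trans (mul_le_mul_of_nonneg_left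
        (Real.rpow_le_rpow (norm_nonneg _) hwN' hp.le) (by positivity)))
      rw [norm_smul, Real.norm_eq_abs, Real.mul_rpow (abs_nonneg _) (norm_nonneg _)]
      exact mul_le_mul_of_nonneg_left (Real.rpow_le_rpow (by norm_num) (hw i) hp.le)
        (Real.rpow_nonneg (abs_nonneg _) _)
    rw [← Finset.sum_mul, one_div, Real.inv_rpow (by norm_num),
      mul_inv_le_iff₀ (by positivity)] at h3
    exact h3
  have h3 := patternNorm_sum_single_le h (η := fun _ => 1) (a := a) one_pos
    (le_max_left 1 (g * R)) (by
      calc ∑ i, patternFun τ r p (fun _ => 1) |a i / 1| ≤ ∑ i, g * |a i| ^ p :=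
            Finset.sum_le_sum fun i _ => by
              rw [div_one]
              exact h.patternFun_one_le_rpow (abs_nonneg _)
        _ = g * ∑ i, |a i| ^ p := by rw [Finset.mul_sum]
        _ ≤ _ := (mul_le_mul_of_nonneg_left h2 hg0.le).trans (le_max_right _ _))
  rwa [mul_one] at h3

end Comparison

end PatternOrliczSum

/-! ### Patterns with a prescribed number of zeros -/

/-- `Z` counts the zeros among the first terms of a 0–1 sequence. -/
structure IsZeroCount (Z : ℕ → ℕ) : Prop where
  zero : Z 0 = 0
  le_succ : ∀ k, Z k ≤ Z (k + 1)
  succ_le : ∀ k, Z (k + 1) ≤ Z k + 1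

/-- The 0–1 sequence with `Z k` zeros among the first `k` terms. -/
def patternOfCount (Z : ℕ → ℕ) (n : ℕ) : Fin 2 := if Z (n + 1) = Z n then 1 else 0

namespace IsZeroCount

variable {Z Z₁ Z₂ : ℕ → ℕ}

theorem sum_patternOfCount (hZ : IsZeroCount Z) (k : ℕ) :
    (∑ n ∈ Finset.range k, ((patternOfCount Z n : ℕ) : ℝ)) = k - Z k := by
  induction k with
  | zero => simp [hZ.zero]
  | succ k ih =>
    rw [Finset.sum_range_succ, ih, patternOfCount]
    split_ifs with hk
    · rw [hk]
      push_cast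
      norm_num
      ring
    · have : Z (k + 1) = Z k + 1 := by
        have h1 := hZ.le_succ k
        have h2 := hZ.succ_le k
        omega
      rw [this]
      push_cast
      norm_num

theorem monotone (hZ : IsZeroCount Z) : Monotone Z := monotone_nat_of_le_succ hZ.le_succ

/-- For `j ≤ k` the window from `k` to `k + j` ends no later than `2 * k`. -/
theorem isSparsePattern (hZ : IsZeroCount Z) (h : ∀ k, Z (2 * k) ≤ Z k + 1) :
    IsSparsePattern (patternOfCount Z) := by
  intro k j hjk
  rw [hZ.sum_patternOfCount, hZ.sum_patternOfCount]
  have h1 : Z (k + j) ≤ Z k + 1 := (hZ.monotone (by omega)).trans (h k)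
  have h2 : (Z (k + j) : ℝ) ≤ Z k + 1 := by exact_mod_cast h1
  push_cast
  linarith

/-- Every zero contributes the same factor `τ ^ (-(p - r))`, so comparing values means comparing
counts. -/
theorem patternValue_eq (hZ : IsZeroCount Z) {τ r p : ℝ} (hτ0 : 0 < τ) (k : ℕ) :
    patternValue τ r p (patternOfCount Z) k = τ ^ (p * k) * (τ ^ (-(p - r))) ^ Z k := by
  rw [patternValue, hZ.sum_patternOfCount, ← Real.rpow_natCast (τ ^ (-(p - r))),
    ← Real.rpow_mul hτ0.le, ← Real.rpow_add hτ0]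
  congr 1
  ring

theorem patternValue_mono (hZ₁ : IsZeroCount Z₁) (hZ₂ : IsZeroCount Z₂) {τ r p : ℝ}
    (h : AdmissibleParams τ r p) {k : ℕ} (hk : Z₁ k ≤ Z₂ k) :
    patternValue τ r p (patternOfCount Z₁) k ≤ patternValue τ r p (patternOfCount Z₂) k := by
  rw [hZ₁.patternValue_eq h.tau_pos, hZ₂.patternValue_eq h.tau_pos]
  refine mul_le_mul_of_nonneg_left (pow_le_pow_right₀ ?_ hk) (Real.rpow_nonneg h.tau_pos.le _)
  exact Real.one_le_rpow_of_pos_of_le_one_of_nonpos h.tau_pos h.tau_lt_one.le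
    (by linarith [h.r_lt_p])

theorem exists_mul_patternValue_le (hZ₁ : IsZeroCount Z₁) (hZ₂ : IsZeroCount Z₂) {τ r p : ℝ}
    (h : AdmissibleParams τ r p) (hunb : ∀ m, ∃ k, Z₂ k + m ≤ Z₁ k) (B : ℝ) :
    ∃ k, B * patternValue τ r p (patternOfCount Z₂) k ≤
      patternValue τ r p (patternOfCount Z₁) k := by
  have hb : 1 < τ ^ (-(p - r)) :=
    Real.one_lt_rpow_of_pos_of_lt_one_of_neg h.tau_pos h.tau_lt_one (by linarith [h.r_lt_p])
  obtain ⟨m, hm⟩ := pow_unbounded_of_one_lt B hb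
  obtain ⟨k, hk⟩ := hunb m
  refine ⟨k, ?_⟩
  rw [hZ₁.patternValue_eq h.tau_pos, hZ₂.patternValue_eq h.tau_pos]
  have h0 : 0 < τ ^ (p * k) := Real.rpow_pos_of_pos h.tau_pos _
  have h1 : 0 < (τ ^ (-(p - r))) ^ Z₂ k := pow_pos (one_pos.trans hb) _
  calc B * (τ ^ (p * k) * (τ ^ (-(p - r))) ^ Z₂ k)
      ≤ (τ ^ (-(p - r))) ^ m * (τ ^ (p * k) * (τ ^ (-(p - r))) ^ Z₂ k) :=
        mul_le_mul_of_nonneg_right hm.le (mul_pos h0 h1).le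
    _ = τ ^ (p * k) * (τ ^ (-(p - r))) ^ (Z₂ k + m) := by rw [pow_add]; ring
    _ ≤ _ := mul_le_mul_of_nonneg_left (pow_le_pow_right₀ hb.le hk) h0.le

end IsZeroCount

/-! ### Zero counts that represent a lattice -/

section LatticeCount

/-- In the block `[q, 2q)`, `q = 2 ^ log₂ t`, this function increases from `q / 2` to `q` in the
first half. -/
def earlyCount (t : ℕ) : ℕ := min (t - 2 ^ Nat.log 2 t / 2) (2 ^ Nat.log 2 t)

/-- In the block `[q, 2q)`, `q = 2 ^ log₂ t`, this function increases from `q / 2` to `q` in the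
second half. -/
def lateCount (t : ℕ) : ℕ := max (2 ^ Nat.log 2 t / 2) (t - 2 ^ Nat.log 2 t)

theorem lateCount_le_earlyCount (t : ℕ) : lateCount t ≤ earlyCount t := by
  rcases Nat.eq_zero_or_pos t with rfl | ht
  · simp [lateCount, earlyCount]
  have h1 := Nat.pow_log_le_self 2 ht.ne'
  have h2 := Nat.lt_pow_succ_log_self one_lt_two t
  rw [pow_succ] at h2
  unfold lateCount earlyCount
  omega

variable {L : Type*} [Lattice L] [OrderBot L]

open Classical in
/-- The `log₂ t`-th block tests whether `e ≤ g (log₂ t)`. -/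
def latticeCount (g : ℕ → L) (e : L) (t : ℕ) : ℕ :=
  -- The separate value at `⊥` gives it the all-ones pattern, that is `ℓ_p`.
  if e = ⊥ then 0 else if e ≤ g (Nat.log 2 t) then lateCount t else earlyCount t

variable {g : ℕ → L} {e f : L}

theorem latticeCount_bot (g : ℕ → L) (t : ℕ) : latticeCount g ⊥ t = 0 := if_pos rfl

theorem latticeCount_zero (g : ℕ → L) (e : L) : latticeCount g e 0 = 0 := by
  unfold latticeCount
  split_ifs <;> simp [lateCount, earlyCount]

/-- At the start `2 * q` of the next block both branches have the value `q`, and at `2 * q - 1` each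
is `q` or `q - 1`. Hence the branches can be combined freely from block to block. -/
theorem latticeCount_succ (g : ℕ → L) (e : L) (t : ℕ) :
    latticeCount g e t ≤ latticeCount g e (t + 1) ∧
      latticeCount g e (t + 1) ≤ latticeCount g e t + 1 := by
  unfold latticeCount
  by_cases he : e = ⊥
  · simp [he]
  rw [if_neg he, if_neg he]
  rcases Nat.eq_zero_or_pos t with rfl | ht
  · split_ifs <;> simp [lateCount, earlyCount]
  have h1 := Nat.pow_log_le_self 2 ht.ne'
  have h2 := Nat.lt_pow_succ_log_self one_lt_two t
  rcases (Nat.succ_le_of_lt h2).lt_or_eq with h3 | h3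
  · have hlog : Nat.log 2 (t + 1) = Nat.log 2 t :=
      (Nat.log_eq_iff (Or.inr ⟨one_lt_two, by omega⟩)).2 ⟨h1.trans (Nat.le_succ t), h3⟩
    rw [pow_succ] at h2
    rw [hlog]
    by_cases hc : e ≤ g (Nat.log 2 t)
    · simp only [if_pos hc, lateCount, hlog]
      omega
    · simp only [if_neg hc, earlyCount, hlog]
      omega
  · have hlog : Nat.log 2 (t + 1) = Nat.log 2 t + 1 := by
      rw [show t + 1 = 2 ^ (Nat.log 2 t + 1) from h3, Nat.log_pow one_lt_two]
    -- The block `q = 1` is separate because `q / 2` is truncated there.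
    have hq : 2 ^ Nat.log 2 t = 1 ∨ ∃ q, 2 ^ Nat.log 2 t = 2 * q ∧ 0 < q := by
      rcases Nat.log 2 t with _ | m
      · exact Or.inl rfl
      · exact Or.inr ⟨2 ^ m, by rw [pow_succ, mul_comm], by positivity⟩
    rw [pow_succ] at h2 h3
    simp only [lateCount, earlyCount, hlog, pow_succ]
    have h3' : t + 1 = 2 ^ Nat.log 2 t * 2 := h3
    split_ifs <;> rcases hq with hq | ⟨q, hq, hq0⟩ <;> omega

theorem latticeCount_mono (hef : e ≤ f) (t : ℕ) : latticeCount g e t ≤ latticeCount g f t := by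
  have := lateCount_le_earlyCount t
  unfold latticeCount
  by_cases he : e = ⊥
  · simp [he]
  have hf : f ≠ ⊥ := fun hf => he (le_bot_iff.1 (hf ▸ hef))
  rw [if_neg he, if_neg hf]
  split_ifs with h1 h2 h2
  · exact le_rfl
  · exact this
  · exact (h1 (hef.trans h2)).elim
  · exact le_rfl

/-- The join passes the test exactly when `e` and `f` both do. So if the join is early, one of `e`,
`f` is early too. -/
theorem latticeCount_sup_le (e f : L) (t : ℕ) :
    latticeCount g (e ⊔ f) t ≤ max (latticeCount g e t) (latticeCount g f t) := by
  by_cases he : e = ⊥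
  · rw [he, bot_sup_eq]
    exact le_max_right _ _
  by_cases hf : f = ⊥
  · rw [hf, sup_bot_eq]
    exact le_max_left _ _
  by_cases h1 : e ≤ g (Nat.log 2 t)
  · by_cases h2 : f ≤ g (Nat.log 2 t)
    · have : latticeCount g (e ⊔ f) t ≤ latticeCount g e t := by
        unfold latticeCount
        rw [if_neg he, if_pos h1, if_neg (fun hc => he (sup_eq_bot_iff.1 hc).1),
          if_pos (sup_le h1 h2)]
      exact this.trans (le_max_left _ _)
    · have : latticeCount g (e ⊔ f) t ≤ latticeCount g f t := by
        unfold latticeCount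
        rw [if_neg hf, if_neg h2, if_neg (fun hc => he (sup_eq_bot_iff.1 hc).1),
          if_neg fun hc => h2 (le_sup_right.trans hc)]
      exact this.trans (le_max_right _ _)
  · have : latticeCount g (e ⊔ f) t ≤ latticeCount g e t := by
      unfold latticeCount
      rw [if_neg he, if_neg h1, if_neg (fun hc => he (sup_eq_bot_iff.1 hc).1),
        if_neg fun hc => h1 (le_sup_left.trans hc)]
    exact this.trans (le_max_left _ _)

/-- In a block that tests against `f` itself, `f` passes and `e` fails. Halfway through it, at `3 *
q / 2`, the counts differ by at least `q / 2`, which exceeds `m` in a late block. -/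
theorem exists_latticeCount_add_le (hg : ∀ f : L, ∀ m, ∃ i, m ≤ i ∧ g i = f) (hef : ¬e ≤ f)
    (m : ℕ) : ∃ t, latticeCount g f t + m ≤ latticeCount g e t := by
  obtain ⟨i, hi, hgi⟩ := hg f (m + 1)
  obtain ⟨j, rfl⟩ : ∃ j, i = j + 1 := ⟨i - 1, by omega⟩
  have hj : m < 2 ^ j := lt_of_le_of_lt (by omega) j.lt_two_pow_self
  have hlog : Nat.log 2 (3 * 2 ^ j) = j + 1 := by
    refine (Nat.log_eq_iff (Or.inl (Nat.succ_ne_zero j))).2 ⟨?_, ?_⟩ <;>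
      simp only [pow_succ] <;> omega
  refine ⟨3 * 2 ^ j, ?_⟩
  have he : e ≠ ⊥ := fun hc => hef (hc ▸ bot_le)
  have h1 : latticeCount g e (3 * 2 ^ j) = 2 ^ (j + 1) := by
    unfold latticeCount
    rw [if_neg he, hlog, hgi, if_neg hef, earlyCount, hlog, pow_succ]
    omega
  have h2 : latticeCount g f (3 * 2 ^ j) ≤ 2 ^ j := by
    unfold latticeCount
    split_ifs with h3 h4
    · exact Nat.zero_le _
    · rw [lateCount, hlog, pow_succ]
      omega
    · rw [hlog, hgi] at h4
      exact (h4 le_rfl).elim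
  rw [h1, pow_succ]
  omega

/-- The number of zeros among the first `k` terms of the pattern that represents `e`. -/
def latticeZeroCount (g : ℕ → L) (e : L) (k : ℕ) : ℕ := latticeCount g e (Nat.log 2 k)

theorem isZeroCount_latticeZeroCount (g : ℕ → L) (e : L) : IsZeroCount (latticeZeroCount g e) := by
  have hmono : Monotone (latticeCount g e) :=
    monotone_nat_of_le_succ fun t => (latticeCount_succ g e t).1
  refine ⟨?_, fun k => hmono (Nat.log_mono_right (Nat.le_succ k)), fun k => ?_⟩
  · rw [latticeZeroCount, Nat.log_zero_right, latticeCount_zero]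
  · refine (hmono ?_).trans (latticeCount_succ g e _).2
    rcases Nat.eq_zero_or_pos k with rfl | hk
    · simp
    · rw [← Nat.log_mul_base one_lt_two hk.ne']
      exact Nat.log_mono_right (by omega)

/-- The purpose of the logarithmic scale: doubling `k` advances the slow count by one step only. -/
theorem latticeZeroCount_two_mul_le (g : ℕ → L) (e : L) (k : ℕ) :
    latticeZeroCount g e (2 * k) ≤ latticeZeroCount g e k + 1 := by
  rcases Nat.eq_zero_or_pos k with rfl | hk
  · simp
  · rw [latticeZeroCount, latticeZeroCount, mul_comm, Nat.log_mul_base one_lt_two hk.ne']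
    exact (latticeCount_succ g e _).2

theorem exists_latticeZeroCount_add_le (hg : ∀ f : L, ∀ m, ∃ i, m ≤ i ∧ g i = f) (hef : ¬e ≤ f)
    (m : ℕ) : ∃ k, latticeZeroCount g f k + m ≤ latticeZeroCount g e k := by
  obtain ⟨t, ht⟩ := exists_latticeCount_add_le hg hef m
  exact ⟨2 ^ t, by rwa [latticeZeroCount, latticeZeroCount, Nat.log_pow one_lt_two]⟩

theorem exists_frequently_surjective (L : Type*) [Nonempty L] [Countable L] :
    ∃ g : ℕ → L, ∀ f : L, ∀ m, ∃ i, m ≤ i ∧ g i = f := by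
  obtain ⟨s, hs⟩ := exists_surjective_nat L
  refine ⟨fun n => s n.unpair.1, fun f m => ?_⟩
  obtain ⟨j, rfl⟩ := hs f
  exact ⟨Nat.pair j m, Nat.right_le_pair j m, by simp⟩

end LatticeCount

/-! ### Comparison of the norms -/

namespace PatternOrliczSum

variable {τ r p : ℝ}

theorem exists_patternNorm_le_of_max (h : AdmissibleParams τ r p) {η η₁ η₂ : ℕ → Fin 2}
    (hmax : ∀ k, patternValue τ r p η k ≤
      max (patternValue τ r p η₁ k) (patternValue τ r p η₂ k)) {N : Seminorm ℝ (ℕ →₀ ℝ)}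
    (h₁ : ∃ C, ∀ a, h.patternNorm η₁ a ≤ C * N a) (h₂ : ∃ C, ∀ a, h.patternNorm η₂ a ≤ C * N a) :
    ∃ C, ∀ a, h.patternNorm η a ≤ C * N a := by
  obtain ⟨C₁, h₁⟩ := h₁
  obtain ⟨C₂, h₂⟩ := h₂
  have hg := h.one_le_growthConst
  set c := |C₁| + |C₂| + 1 with hc
  have hc0 : 0 < c := by positivity
  have hlt : ∀ {C : ℝ} {η : ℕ → Fin 2}, |C| < c → (∀ a, h.patternNorm η a ≤ C * N a) →
      ∀ b, N b < 1 → h.patternNorm η b < c := fun {C η} hC hη b hb => by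
    have h3 : C * N b ≤ |C| * 1 := mul_le_mul (le_abs_self C) hb.le (apply_nonneg _ _) (abs_nonneg _)
    linarith [hη b]
  refine ⟨h.growthConst * 2 * c, Seminorm.le_mul_of_lt_one fun b hb => ?_⟩
  have hb₁ := hlt (by linarith [abs_nonneg C₂]) h₁ b hb
  have hb₂ := hlt (by linarith [abs_nonneg C₁]) h₂ b hb
  obtain ⟨n, hn⟩ := Finsupp.exists_eq_sum_single b
  rw [hn] at hb₁ hb₂ ⊢
  refine patternNorm_sum_single_le h hc0 (by linarith) ?_
  have e₁ := sum_patternFun_div_le_one h hb₁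
  have e₂ := sum_patternFun_div_le_one h hb₂
  refine (Finset.sum_le_sum fun i _ => h.patternFun_le_add hmax (abs_nonneg _)).trans ?_
  rw [← Finset.mul_sum, Finset.sum_add_distrib]
  exact mul_le_mul_of_nonneg_left (by linarith) (by linarith)

/-- The test vector is a sum of `n` unit vectors with `n` about `1 / V₂`. Its norm for `η₂` is at
most `1 / τ ^ k`. A norm below `D / τ ^ k` for `η₁` bounds `n * V₁` by a constant, although `V₁ /
V₂` can be made arbitrarily large. -/
theorem not_exists_patternNorm_le (h : AdmissibleParams τ r p) {η₁ η₂ : ℕ → Fin 2}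
    (hunb : ∀ B : ℝ, ∃ k, B * patternValue τ r p η₂ k ≤ patternValue τ r p η₁ k) :
    ¬∃ C, ∀ a, h.patternNorm η₁ a ≤ C * h.patternNorm η₂ a := by
  rintro ⟨C, hC⟩
  have hτ0 := h.tau_pos
  have hτ1 := h.tau_lt_one
  have hr := h.one_lt_r
  have hrp := h.r_lt_p
  have hg := h.growthConst_pos
  set D := |C| + 1 with hD
  have hD1 : 1 ≤ D := by linarith [abs_nonneg C]
  have hD0 : 0 < D := by linarith
  -- The modular will give `n * V₁ ≤ growthConst * D ^ p / τ ^ p`; the factor `2` compensates for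
  -- the floor, as `n * V₂ ≥ 1 / 2`.
  obtain ⟨k, hk⟩ := hunb (2 * (h.growthConst * D ^ p / τ ^ p + 1))
  set V₁ := patternValue τ r p η₁ k
  set V₂ := patternValue τ r p η₂ k
  have hV₁ : 0 < V₁ := patternValue_pos hτ0 k
  have hV₂ : 0 < V₂ := patternValue_pos hτ0 k
  have hk0 : 0 < τ ^ k := pow_pos hτ0 k
  have hV₂1 : V₂ ≤ 1 := (patternValue_le_pow hτ0 hτ1 hr.le hrp.le k).trans
    (pow_le_one₀ hτ0.le hτ1.le)
  set n := ⌊V₂⁻¹⌋₊ with hn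
  have hn1 : (n : ℝ) * V₂ ≤ 1 := by
    have := Nat.floor_le (inv_nonneg.2 hV₂.le)
    rwa [← le_div_iff₀ hV₂, one_div]
  have hn2 : 1 ≤ 2 * (n * V₂) := by
    have h1 : 1 ≤ n := Nat.le_floor (by simpa using (one_le_inv₀ hV₂).2 hV₂1)
    have h1' : (1 : ℝ) ≤ n := by exact_mod_cast h1
    have h2 := Nat.lt_floor_add_one V₂⁻¹
    have h3 : V₂⁻¹ ≤ 2 * n := by
      rw [← hn] at h2
      linarith
    rw [inv_le_iff_one_le_mul₀ hV₂] at h3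
    linarith
  have hN₂ : h.patternNorm η₂ (∑ i : Fin n, Finsupp.single (i : ℕ) (1 : ℝ)) ≤ (τ ^ k)⁻¹ := by
    have := patternNorm_sum_single_le h (η := η₂) (a := fun _ : Fin n => (1 : ℝ))
      (inv_pos.2 hk0) le_rfl (by
        rw [Finset.sum_const, Finset.card_univ, Fintype.card_fin, nsmul_eq_mul, one_div, inv_inv,
          abs_of_pos hk0]
        refine le_trans (mul_le_mul_of_nonneg_left ?_ (Nat.cast_nonneg n)) hn1
        exact patternFun_le_of_le_pow hτ0 hτ1 (by linarith) hrp.le hk0 le_rfl)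
    rwa [one_mul] at this
  have hN₁ : h.patternNorm η₁ (∑ i : Fin n, Finsupp.single (i : ℕ) (1 : ℝ)) < D * (τ ^ k)⁻¹ := by
    refine (hC _).trans_lt ?_
    have h1 : C * h.patternNorm η₂ (∑ i : Fin n, Finsupp.single (i : ℕ) (1 : ℝ)) ≤
        |C| * (τ ^ k)⁻¹ :=
      mul_le_mul (le_abs_self C) hN₂ (apply_nonneg _ _) (abs_nonneg _)
    have h2 := inv_pos.2 hk0
    rw [hD]
    linarith
  have h1 := sum_patternFun_div_le_one h (a := fun _ : Fin n => (1 : ℝ)) hN₁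
  rw [Finset.sum_const, Finset.card_univ, Fintype.card_fin, nsmul_eq_mul, one_div, mul_inv, inv_inv,
    abs_of_pos (by positivity)] at h1
  have h2 := h.rpow_mul_patternFun_le (η := η₁) (s := D⁻¹) (t := τ ^ k) (by positivity)
    (inv_le_one_of_one_le₀ hD1) hk0.le
  have h3 : τ ^ p * V₁ ≤ patternFun τ r p η₁ (τ ^ k) := by
    have h4 := patternValue_add_ge (η := η₁) hτ0 hτ1 hrp.le k 1
    rw [pow_one] at h4
    exact h4.trans (patternValue_le_of_pow_lt hτ0 hτ1 (by linarith) hrp.le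
      (pow_lt_pow_right_of_lt_one₀ hτ0 hτ1 (Nat.lt_succ_self k)) (pow_le_one₀ hτ0.le hτ1.le))
  have hτp := h.tau_rpow_mem.1
  have hDp : 0 < D ^ p := Real.rpow_pos_of_pos hD0 _
  rw [Real.inv_rpow hD0.le, inv_mul_le_iff₀ hDp] at h2
  have h4 : (n : ℝ) * V₁ ≤ h.growthConst * D ^ p / τ ^ p := by
    rw [le_div_iff₀ hτp]
    calc (n : ℝ) * V₁ * τ ^ p = n * (τ ^ p * V₁) := by ring
      _ ≤ n * (D ^ p * (h.growthConst * patternFun τ r p η₁ (D⁻¹ * τ ^ k))) :=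
          mul_le_mul_of_nonneg_left (h3.trans h2) (Nat.cast_nonneg n)
      _ = h.growthConst * D ^ p * (n * patternFun τ r p η₁ (D⁻¹ * τ ^ k)) := by ring
      _ ≤ h.growthConst * D ^ p * 1 := mul_le_mul_of_nonneg_left h1 (by positivity)
      _ = _ := mul_one _
  have h5 := mul_le_mul_of_nonneg_left hk (Nat.cast_nonneg (α := ℝ) n)
  set Q := h.growthConst * D ^ p / τ ^ p
  have hQ : 0 < Q := by positivity
  nlinarith [mul_le_mul_of_nonneg_left hn2 (show 0 ≤ Q + 1 by linarith)]

end PatternOrliczSum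

/-! ### The set of spreading models -/

section Classification

variable {L : Type*} [Lattice L] [OrderBot L] {τ r p : ℝ} {h : AdmissibleParams τ r p}
  {ρ : L → ℕ → Fin 2}

open PatternOrliczSum

/-- The chain condition gives a maximal element, and closure under joins makes it greatest. -/
theorem exists_isGreatest_of_sup_mem (hL : ¬∃ e : ℕ → L, StrictMono e) {D : Set L}
    (hbot : ⊥ ∈ D) (hsup : ∀ e ∈ D, ∀ f ∈ D, e ⊔ f ∈ D) : ∃ e, IsGreatest D e := by
  have hwf : WellFounded ((· > ·) : L → L → Prop) := by
    rw [RelEmbedding.wellFounded_iff_isEmpty]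
    refine ⟨fun φ => hL ⟨φ, fun a b hab => φ.map_rel_iff.2 hab⟩⟩
  obtain ⟨e, he, hmax⟩ := hwf.has_min D ⟨⊥, hbot⟩
  refine ⟨e, he, fun f hf => ?_⟩
  have h1 : ¬e < e ⊔ f := hmax _ (hsup e he f hf)
  exact sup_eq_left.1 (le_sup_left.lt_or_eq.resolve_left h1).symm

/-- Take `e` greatest among the elements whose norm `S` dominates. Every component in which the
coordinates are frequently large has such a norm, so it lies below `e`, and the upper estimate with
`η = ρ e` closes the circle. -/
theorem exists_equivalent_unitVectorModel (hL : ¬∃ e : ℕ → L, StrictMono e)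
    (hsparse : ∀ e, IsSparsePattern (ρ e)) (hbot : ρ ⊥ = fun _ => 1)
    (hmono : ∀ e f, e ≤ f → ∀ k, patternValue τ r p (ρ e) k ≤ patternValue τ r p (ρ f) k)
    (hsup : ∀ e f k, patternValue τ r p (ρ (e ⊔ f)) k ≤
      max (patternValue τ r p (ρ e) k) (patternValue τ r p (ρ f) k))
    (S : WeaklyNullSpreadingModel (PatternOrliczSum h ρ)) :
    ∃ e, unitVectorModel h ρ e ≤ S ∧ S ≤ unitVectorModel h ρ e := by
  obtain ⟨x, hx1, -, hx0, hgen⟩ := S.generated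
  obtain ⟨E, hE, hN⟩ := hgen.exists_isSpreadingEquivalent
  have hx := fun f m => IsWeaklyNull.tendsto_coordinate hx0 f m
  obtain ⟨e, he, hmax⟩ := exists_isGreatest_of_sup_mem hL
    (D := {e | ∃ C, ∀ a, h.patternNorm (ρ e) a ≤ C * S.toSeminorm a})
    (by
      rw [mem_ofPred_eq, hbot]
      exact exists_patternNorm_one_le hE hN hx1 hx)
    (fun e he f hf => exists_patternNorm_le_of_max h (hsup e f) he hf)
  refine ⟨e, he, exists_le_patternNorm hE hN hx1 hx
    (F := {f | ∃ δ > 0, ∃ᶠ i in atTop, ∃ m, δ ≤ |coordinate f m (x i)|})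
    (fun f hf ε hε => ?_) hsparse fun f hf => ?_⟩
  · have : ¬∃ᶠ i in atTop, ∃ m, ε ≤ |coordinate f m (x i)| := fun hc => hf ⟨ε, hε, hc⟩
    rw [not_frequently] at this
    filter_upwards [this] with i hi m
    by_contra! hc
    exact hi ⟨m, hc.le⟩
  · obtain ⟨δ, hδ, hfr⟩ := hf
    exact hmono f e (hmax (exists_patternNorm_le hE hN hx hδ hfr))

theorem nonempty_orderIso_SPw (hL : ¬∃ e : ℕ → L, StrictMono e)
    (hsparse : ∀ e, IsSparsePattern (ρ e)) (hbot : ρ ⊥ = fun _ => 1)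
    (hmono : ∀ e f, e ≤ f → ∀ k, patternValue τ r p (ρ e) k ≤ patternValue τ r p (ρ f) k)
    (hsup : ∀ e f k, patternValue τ r p (ρ (e ⊔ f)) k ≤
      max (patternValue τ r p (ρ e) k) (patternValue τ r p (ρ f) k))
    (hunb : ∀ e f, ¬e ≤ f → ∀ B : ℝ, ∃ k,
      B * patternValue τ r p (ρ f) k ≤ patternValue τ r p (ρ e) k) :
    Nonempty (SPw (PatternOrliczSum h ρ) ≃o L) := by
  have hle : ∀ e f, unitVectorModel h ρ e ≤ unitVectorModel h ρ f ↔ e ≤ f := by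
    intro e f
    constructor
    · intro hef
      by_contra hc
      exact not_exists_patternNorm_le h (hunb e f hc) hef
    · intro hef
      exact exists_patternNorm_le_of_max h (η₁ := ρ f) (η₂ := ρ f)
        (fun k => by rw [max_self]; exact hmono e f hef k)
        ⟨1, fun a => by rw [one_mul]; exact le_rfl⟩
        ⟨1, fun a => by rw [one_mul]; exact le_rfl⟩
  let φ : L ↪o SPw (PatternOrliczSum h ρ) := OrderEmbedding.ofMapLEIff
    (fun e => toAntisymmetrization (· ≤ ·) (unitVectorModel h ρ e)) fun e f => by
      rw [toAntisymmetrization_le_toAntisymmetrization_iff, hle]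
  have hφ : Function.Surjective φ := by
    intro S
    induction S using Antisymmetrization.ind with
    | _ S =>
      obtain ⟨e, h1, h2⟩ := exists_equivalent_unitVectorModel hL hsparse hbot hmono hsup S
      exact ⟨e, le_antisymm (toAntisymmetrization_le_toAntisymmetrization_iff.2 h1)
        (toAntisymmetrization_le_toAntisymmetrization_iff.2 h2)⟩
  exact ⟨(RelIso.ofSurjective φ hφ).symm⟩

end Classification

end

theorem theorem3p1 {L : Type*} [Lattice L] [OrderBot L] [Countable L]
    (hL : ¬ ∃ e : ℕ → L, StrictMono e)
    {τ p : ℝ} (hτ0 : 0 < τ) (hτ1 : τ < 1) (hp : 1 < p) :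
    (∃ r₀ : ℝ, r₀ < p ∧ ∀ r : ℝ, r₀ < r → r < p → AdmissibleParams τ r p) ∧
    ∀ (r : ℝ) (h : AdmissibleParams τ r p), ∃ ρ : L → ℕ → Fin 2,
      IsReflexiveSpace (PatternOrliczSum h ρ) ∧
      Nonempty (SPw (PatternOrliczSum h ρ) ≃o L) := by
  refine ⟨exists_admissibleParams hτ0 hτ1 hp, fun r h => ?_⟩
  obtain ⟨g, hg⟩ := exists_frequently_surjective L
  have hZ := isZeroCount_latticeZeroCount g
  refine ⟨fun e => patternOfCount (latticeZeroCount g e), PatternOrliczSum.isReflexiveSpace h _,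
    nonempty_orderIso_SPw hL
      (fun e => (hZ e).isSparsePattern (latticeZeroCount_two_mul_le g e))
      (funext fun n => if_pos (by rw [latticeZeroCount, latticeZeroCount, latticeCount_bot,
        latticeCount_bot]))
      (fun e f hef k => (hZ e).patternValue_mono (hZ f) h (latticeCount_mono hef _))
      (fun e f k => ?_)
      (fun e f hef B => (hZ e).exists_mul_patternValue_le (hZ f) h
        (exists_latticeZeroCount_add_le hg hef) B)⟩
  rcases le_max_iff.1 (latticeCount_sup_le (g := g) e f (Nat.log 2 k)) with h1 | h1
  · exact le_max_of_le_left ((hZ _).patternValue_mono (hZ e) h h1)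
  · exact le_max_of_le_right ((hZ _).patternValue_mono (hZ f) h h1)
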